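/- All graphs are finite, simple and undirected. The gem is the graph on five vertices obtained from a path $P_4$ on four vertices by adding one vertex adjacent to all four vertices of the path. A graph $H$ is an induced minor of a graph $G$ if a graph isomorphic to $H$ can be obtained from $G$ by repeated vertex deletion and edge contraction; $G$ is $H$-induced-minor-free if $H$ is not an induced minor of $G$. The clique-width $\mathrm{cw}(G)$ is the minimum number of labels needed to construct $G$ by means of the following operations: (i) creation of a new vertex with label $i$; (ii) disjoint union of two labeled graphs; (iii) joining by an edge every vertex labeled $i$ to every vertex labeled $j$, where $i\neq j$; (iv) renaming label $i$ to label $j$ (the graph without vertices has clique-width $0$). Theorem. Let $H$ be a graph isomorphic to an induced subgraph of the gem. Then the $H$-induced-minor-free graphs have bounded clique-width, that is, there is a constant $c_H$ such that $\mathrm{cw}(G)\le c_H$ for every $H$-induced-minor-free graph $G$. -/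

import Mathlib

universe u v

namespace SimpleGraph

/-- The gem: the path `0 - 1 - 2 - 3` on four vertices together with the vertex `4`, which is
adjacent to all vertices of the path. -/
def gem : SimpleGraph (Fin 5) :=
  fromEdgeSet {s(0, 1), s(1, 2), s(2, 3), s(4, 0), s(4, 1), s(4, 2), s(4, 3)}

/-- Deletion of the vertex `v` from `G`. -/
def vertexDeletion {V : Type u} (G : SimpleGraph V) (v : V) : SimpleGraph {w : V // w ≠ v} :=
  G.comap Subtype.val

/-- Contraction of the edge `uv` of `G`: the vertex `v` disappears, and `u`, which now stands for
the merged vertex, becomes adjacent to all (other) neighbors of `v` as well. The relation is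
symmetrized and made irreflexive by `fromRel`, so no loops or multiple edges arise. -/
def edgeContraction {V : Type u} (G : SimpleGraph V) (u v : V) : SimpleGraph {w : V // w ≠ v} :=
  fromRel fun x y => G.Adj x y ∨ ((x : V) = u ∧ G.Adj v y)

/-- `IsInducedMinor H G`: a graph isomorphic to `H` can be obtained from `G` by repeated vertex
deletion and edge contraction. -/
inductive IsInducedMinor {W : Type v} (H : SimpleGraph W) :
    ∀ {V : Type u}, SimpleGraph V → Prop
  | iso {V : Type u} {G : SimpleGraph V} (e : G ≃g H) : IsInducedMinor H G
  | deletion {V : Type u} {G : SimpleGraph V} (v : V)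
      (h : IsInducedMinor H (G.vertexDeletion v)) : IsInducedMinor H G
  | contraction {V : Type u} {G : SimpleGraph V} (u v : V) (huv : G.Adj u v)
      (h : IsInducedMinor H (G.edgeContraction u v)) : IsInducedMinor H G

/-- `G` is `H`-induced-minor-free. -/
def InducedMinorFree {W : Type v} (H : SimpleGraph W) {V : Type u} (G : SimpleGraph V) : Prop :=
  ¬ IsInducedMinor H G

/-- The graph obtained from `G`, whose vertices are labeled by `lab`, by joining every vertex
labeled `i` to every vertex labeled `j` by an edge. -/
def joinLabels {V : Type u} {k : ℕ} (G : SimpleGraph V) (lab : V → Fin k) (i j : Fin k) :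
    SimpleGraph V :=
  G ⊔ fromRel fun x y => lab x = i ∧ lab y = j

/-- `IsLabelConstructible k G lab`: the graph `G` labeled by `lab` can be constructed, up to
isomorphism of labeled graphs, with the labels from `Fin k` by means of the four operations that
define clique-width. -/
inductive IsLabelConstructible (k : ℕ) :
    ∀ {V : Type u}, SimpleGraph V → (V → Fin k) → Prop
  /-- Creation of a single vertex with label `i`. -/
  | vertex (i : Fin k) : IsLabelConstructible k (⊥ : SimpleGraph PUnit) (fun _ => i)
  /-- Disjoint union of two labeled graphs. -/
  | union {V₁ V₂ : Type u} {G₁ : SimpleGraph V₁} {G₂ : SimpleGraph V₂}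
      {lab₁ : V₁ → Fin k} {lab₂ : V₂ → Fin k}
      (h₁ : IsLabelConstructible k G₁ lab₁) (h₂ : IsLabelConstructible k G₂ lab₂) :
      IsLabelConstructible k (G₁ ⊕g G₂) (Sum.elim lab₁ lab₂)
  /-- Joining all vertices labeled `i` to all vertices labeled `j`. -/
  | join {V : Type u} {G : SimpleGraph V} {lab : V → Fin k} (i j : Fin k) (hij : i ≠ j)
      (h : IsLabelConstructible k G lab) : IsLabelConstructible k (G.joinLabels lab i j) lab
  /-- Renaming label `i` to label `j`. -/
  | rename {V : Type u} {G : SimpleGraph V} {lab : V → Fin k} (i j : Fin k)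
      (h : IsLabelConstructible k G lab) :
      IsLabelConstructible k G (fun x => if lab x = i then j else lab x)
  /-- Replacing a labeled graph by an isomorphic one. -/
  | iso {V V' : Type u} {G : SimpleGraph V} {G' : SimpleGraph V'} {lab : V → Fin k}
      {lab' : V' → Fin k} (e : G ≃g G') (he : ∀ x, lab' (e x) = lab x)
      (h : IsLabelConstructible k G lab) : IsLabelConstructible k G' lab'

/-- `G` can be constructed with `k` labels. The graph without vertices needs no operation at all,
hence no label. -/
def ConstructibleWithLabels {V : Type u} (G : SimpleGraph V) (k : ℕ) : Prop :=
  IsEmpty V ∨ ∃ lab : V → Fin k, IsLabelConstructible k G lab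

/-- The clique-width of `G`: the minimum number of labels needed to construct `G`
(and `⊤` if `G` cannot be constructed with finitely many labels). -/
noncomputable def cliqueWidth {V : Type u} (G : SimpleGraph V) : ℕ∞ :=
  ⨅ (k : ℕ) (_ : G.ConstructibleWithLabels k), (k : ℕ∞)

end SimpleGraph

/-! Induced minors correspond to families of disjoint connected bags with a prescribed touching
pattern (`IsModel`). Since `H` sits inside the gem, an `H`-induced-minor-free finite graph has no
model of the gem (`InducedMinorFree.gemFree`), so it suffices to bound the clique-width of the
finite graphs satisfying `GemFree`.

Consider first a 2-connected graph. If it has no induced path on four vertices, it is a cograph.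
Otherwise such a path yields a `Conf`: an induced path of length at least three together with a
connected set that sees just its ends. Finite checks on small touching patterns show that very
little can be attached to it (`GemFree.touch_of_chordPath`, `IsHole.attached`,
`GemFree.card_le_of_prism`). So the graph has at most six vertices, or all its degrees are at most
two, or it contains a `Terminal`: a path whose inner vertices have degree two. In the last case each
component off the path consists of vertices of degree two or lies in the neighborhood of the two
ends (`Terminal.component`). The components of the second kind contain no induced path on four
vertices, since the whole path would serve as the hub of a gem. This gives
`GemFree.exists_structure`: up to at most six vertices, the graph is a cograph together with a part
of vertices of degree at most two, with no edges between them.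

Such a graph has a recursive partition all of whose parts have a bounded number of types of
neighborhoods towards the outside (`GemFree.exists_partTree`): modules in the cograph, and an
ordering with small edge cuts in the other part. Assembling the graph along the partition, with the
type of a vertex as its label, needs boundedly many labels (`PartTree.builtOn`).

For arbitrary graphs the blocks are glued at cut vertices. To keep the number of labels fixed during
the induction, each vertex `x` carries an already constructed graph `F x` with a set `R x` of
attachment vertices, and a block hanging at `x` is absorbed into `F x` (`GemFree.goodOn_blowup`).
Everything is forgotten except one special label for the attachment vertices, so the same labels
serve all blocks. -/

namespace SimpleGraph

/-! ### Connected and touching vertex sets, components. -/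

section Sets

variable {V : Type*} (G : SimpleGraph V)

/-- Some vertex of `S` is adjacent to some vertex of `T`. -/
def Touch (S T : Set V) : Prop := ∃ a ∈ S, ∃ b ∈ T, G.Adj a b

/-- `S` is nonempty and induces a connected subgraph. -/
def Conn (S : Set V) : Prop :=
  S.Nonempty ∧ ∀ T : Set V, (∃ a ∈ S, a ∈ T) →
    (∀ a ∈ S, a ∈ T → ∀ b ∈ S, G.Adj a b → b ∈ T) → S ⊆ T

/-- The vertices reachable from `u` within `S`. -/
def compIn (S : Set V) (u : V) : Set V :=
  {w | w ∈ S ∧ ∀ T : Set V, u ∈ T → (∀ a ∈ S, a ∈ T → ∀ b ∈ S, G.Adj a b → b ∈ T) → w ∈ T}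

variable {G}

theorem Touch.symm {S T : Set V} (h : G.Touch S T) : G.Touch T S := by
  obtain ⟨a, ha, b, hb, hab⟩ := h
  exact ⟨b, hb, a, ha, hab.symm⟩

theorem touch_comm {S T : Set V} : G.Touch S T ↔ G.Touch T S := ⟨Touch.symm, Touch.symm⟩

theorem Touch.mono {S T S' T' : Set V} (h : G.Touch S T) (hS : S ⊆ S') (hT : T ⊆ T') :
    G.Touch S' T' := by
  obtain ⟨a, ha, b, hb, hab⟩ := h
  exact ⟨a, hS ha, b, hT hb, hab⟩

@[simp] theorem touch_singleton_singleton {a b : V} : G.Touch {a} {b} ↔ G.Adj a b := by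
  simp [Touch]

theorem touch_union_left {S S' T : Set V} :
    G.Touch (S ∪ S') T ↔ G.Touch S T ∨ G.Touch S' T := by
  simp only [Touch, Set.mem_union]
  grind

theorem touch_union_right {S T T' : Set V} :
    G.Touch S (T ∪ T') ↔ G.Touch S T ∨ G.Touch S T' := by
  rw [touch_comm, touch_union_left, touch_comm, touch_comm (S := T')]

theorem conn_singleton (a : V) : G.Conn {a} := by
  refine ⟨⟨a, rfl⟩, ?_⟩
  rintro T ⟨b, rfl, hb⟩ _ c rfl
  exact hb

/-- It suffices to check closed sets that contain a fixed vertex. -/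
theorem conn_of_root {S : Set V} {u : V} (hu : u ∈ S)
    (h : ∀ T : Set V, u ∈ T → (∀ a ∈ S, a ∈ T → ∀ b ∈ S, G.Adj a b → b ∈ T) → S ⊆ T) :
    G.Conn S := by
  refine ⟨⟨u, hu⟩, ?_⟩
  rintro T ⟨c, hcS, hcT⟩ hT
  by_cases huT : u ∈ T
  · exact h T huT hT
  -- By symmetry of adjacency, the complement of a closed set is closed too.
  · exact absurd hcT (h Tᶜ huT (fun a ha haT b hb hab hbT => haT (hT b hb hbT a ha hab.symm)) hcS)

theorem Conn.union {S T : Set V} (hS : G.Conn S) (hT : G.Conn T) (h : G.Touch S T) :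
    G.Conn (S ∪ T) := by
  obtain ⟨a, ha, b, hb, hab⟩ := h
  refine conn_of_root (Or.inl ha) fun X haX hX => ?_
  have h1 : S ⊆ X := hS.2 X ⟨a, ha, haX⟩
    fun c hc hcX d hd hcd => hX c (Or.inl hc) hcX d (Or.inl hd) hcd
  have hbX : b ∈ X := hX a (Or.inl ha) haX b (Or.inr hb) hab
  have h2 : T ⊆ X := hT.2 X ⟨b, hb, hbX⟩
    fun c hc hcX d hd hcd => hX c (Or.inr hc) hcX d (Or.inr hd) hcd
  exact Set.union_subset h1 h2

theorem Conn.insert {S : Set V} (hS : G.Conn S) {a b : V} (hb : b ∈ S) (hab : G.Adj a b) :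
    G.Conn (insert a S) := by
  rw [Set.insert_eq]
  exact (conn_singleton a).union hS ⟨a, rfl, b, hb, hab⟩

theorem conn_pair {a b : V} (hab : G.Adj a b) : G.Conn {a, b} :=
  (conn_singleton b).insert rfl hab

theorem compIn_subset (S : Set V) (u : V) : G.compIn S u ⊆ S := fun _ h => h.1

theorem mem_compIn_self {S : Set V} {u : V} (hu : u ∈ S) : u ∈ G.compIn S u :=
  ⟨hu, fun _ h _ => h⟩

theorem compIn_closed {S : Set V} {u a b : V} (ha : a ∈ G.compIn S u) (hb : b ∈ S)
    (hab : G.Adj a b) : b ∈ G.compIn S u :=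
  ⟨hb, fun T hu hT => hT a ha.1 (ha.2 T hu hT) b hb hab⟩

theorem conn_compIn {S : Set V} {u : V} (hu : u ∈ S) : G.Conn (G.compIn S u) := by
  refine conn_of_root (mem_compIn_self hu) fun T huT hT w hw => ?_
  -- Closedness of `T` is known only within the component, so `T` is weakened to an implication that
  -- is closed in all of `S`.
  have := hw.2 {x | x ∈ G.compIn S u → x ∈ T} (fun _ => huT) ?_
  · exact this hw
  · intro a ha haT b hb hab hbc
    exact hT a (compIn_closed hbc ha hab.symm) (haT (compIn_closed hbc ha hab.symm)) b hbc hab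

theorem Conn.subset_compIn {S T : Set V} {u : V} (hT : G.Conn T) (hTS : T ⊆ S) (hu : u ∈ T) :
    T ⊆ G.compIn S u := fun _ hw =>
  ⟨hTS hw, fun X hX hc => hT.2 X ⟨u, hu, hX⟩
    (fun a ha haX b hb hab => hc a (hTS ha) haX b (hTS hb) hab) hw⟩

theorem conn_biUnion {ι : Type*} {Γ : SimpleGraph ι} {b : ι → Set V} (hb : ∀ i, G.Conn (b i))
    (hΓ : ∀ i j, Γ.Adj i j → G.Touch (b i) (b j)) {s : Set ι} (hs : Γ.Conn s) :
    G.Conn (⋃ i ∈ s, b i) := by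
  obtain ⟨i₀, hi₀⟩ := hs.1
  obtain ⟨u, hu⟩ := (hb i₀).1
  refine conn_of_root (u := u) (Set.mem_biUnion hi₀ hu) fun T huT hT => ?_
  have key : ∀ i ∈ s, (∃ a ∈ b i, a ∈ T) → b i ⊆ T := fun i hi h =>
    (hb i).2 T h fun c hc hcT d hd hcd =>
      hT c (Set.mem_biUnion hi hc) hcT d (Set.mem_biUnion hi hd) hcd
  -- A closed set that meets a bag contains it, so the indices of the bags inside `T` form a closed
  -- set of `Γ`.
  have := hs.2 {i | b i ⊆ T} ⟨i₀, hi₀, key i₀ hi₀ ⟨u, hu, huT⟩⟩ ?_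
  · exact Set.iUnion₂_subset this
  · intro i hi hiT j hj hij
    obtain ⟨x, hx, y, hy, hxy⟩ := hΓ i j hij
    exact key j hj ⟨y, hy, hT x (Set.mem_biUnion hi hx) (hiT hx) y (Set.mem_biUnion hj hy) hxy⟩

end Sets

/-! ### Models by bags versus deletions and contractions. -/

section Models

/-- `b` is a model of `H` as an induced minor of `G`, by connected disjoint bags. -/
structure IsModel {W V : Type*} (H : SimpleGraph W) (G : SimpleGraph V) (b : W → Set V) :
    Prop where
  conn : ∀ w, G.Conn (b w)
  disj : ∀ w w', w ≠ w' → Disjoint (b w) (b w')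
  touch : ∀ w w', w ≠ w' → (H.Adj w w' ↔ G.Touch (b w) (b w'))

/-- Bags of bags are bags. This lifts a gem found in a small explicit graph to any graph that has
the small one as an induced minor. -/
theorem IsModel.comp {W V ι : Type*} {H : SimpleGraph W} {Γ : SimpleGraph ι} {G : SimpleGraph V}
    {b : ι → Set V} (hb : IsModel Γ G b) {f : W → Set ι} (hf : IsModel H Γ f) :
    IsModel H G fun w => ⋃ i ∈ f w, b i := by
  have hne : ∀ {w w' i j}, w ≠ w' → i ∈ f w → j ∈ f w' → i ≠ j := fun h hi hj e =>
    Set.disjoint_left.1 (hf.disj _ _ h) hi (e ▸ hj)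
  refine ⟨fun w => conn_biUnion hb.conn (fun i j h => (hb.touch i j h.ne).1 h) (hf.conn w),
    fun w w' h => ?_, fun w w' h => ?_⟩
  · simp only [Set.disjoint_iUnion_left, Set.disjoint_iUnion_right]
    exact fun i hi j hj => hb.disj _ _ (hne h hj hi)
  · rw [hf.touch w w' h]
    constructor
    · rintro ⟨i, hi, j, hj, hij⟩
      exact ((hb.touch i j hij.ne).1 hij).mono (Set.subset_biUnion_of_mem hi)
        (Set.subset_biUnion_of_mem hj)
    · rintro ⟨x, hx, y, hy, hxy⟩
      simp only [Set.mem_iUnion] at hx hy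
      obtain ⟨i, hi, hx⟩ := hx
      obtain ⟨j, hj, hy⟩ := hy
      exact ⟨i, hi, j, hj, (hb.touch i j (hne h hi hj)).2 ⟨x, hx, y, hy, hxy⟩⟩

theorem IsModel.comp_embedding {W W' V : Type*} {H : SimpleGraph W} {H' : SimpleGraph W'}
    {G : SimpleGraph V} {b : W → Set V} (hb : IsModel H G b) (e : H' ↪g H) :
    IsModel H' G (b ∘ e) :=
  ⟨fun w => hb.conn _, fun w w' h => hb.disj _ _ (e.injective.ne h), fun w w' h => by
    rw [Function.comp_apply, Function.comp_apply, ← hb.touch _ _ (e.injective.ne h),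
      e.map_adj_iff]⟩

variable {V : Type u} {W : Type v} {G : SimpleGraph V} {H : SimpleGraph W}

theorem IsModel.vertexDeletion {b : W → Set V} (hb : IsModel H G b) {v : V}
    (hv : ∀ w, v ∉ b w) :
    IsModel H (G.vertexDeletion v) fun w => {x | (x : V) ∈ b w} := by
  have hmem : ∀ {w} {x : V}, x ∈ b w → x ≠ v := fun {w} x hx e => hv w (e ▸ hx)
  refine ⟨fun w => ?_, fun w w' h => ?_, fun w w' h => ?_⟩
  · obtain ⟨u, hu⟩ := (hb.conn w).1
    refine conn_of_root (u := ⟨u, hmem hu⟩) hu fun T huT hT => ?_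
    have := (hb.conn w).2 (Subtype.val '' T) ⟨u, hu, ⟨u, hmem hu⟩, huT, rfl⟩ ?_
    · rintro x hx
      obtain ⟨y, hy, e⟩ := this hx
      exact Subtype.ext e ▸ hy
    · rintro _ ha ⟨a, haT, rfl⟩ c hc hac
      exact ⟨⟨c, hmem hc⟩, hT a ha haT ⟨c, hmem hc⟩ hc hac, rfl⟩
  · exact Set.disjoint_left.2 fun x hx hx' => Set.disjoint_left.1 (hb.disj w w' h) hx hx'
  · rw [hb.touch w w' h]
    constructor
    · rintro ⟨x, hx, y, hy, hxy⟩
      exact ⟨⟨x, hmem hx⟩, hx, ⟨y, hmem hy⟩, hy, hxy⟩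
    · rintro ⟨x, hx, y, hy, hxy⟩
      exact ⟨x, hx, y, hy, hxy⟩

theorem edgeContraction_adj {u v : V} {x y : {w : V // w ≠ v}} :
    (G.edgeContraction u v).Adj x y ↔ x ≠ y ∧
      ((G.Adj x y ∨ ((x : V) = u ∧ G.Adj v y)) ∨ (G.Adj y x ∨ ((y : V) = u ∧ G.Adj v x))) :=
  Iff.rfl

theorem IsModel.edgeContraction {b : W → Set V} (hb : IsModel H G b) {u v : V} (huv : G.Adj u v)
    (hs : ∀ w, u ∈ b w ↔ v ∈ b w) :
    IsModel H (G.edgeContraction u v) fun w => {x | (x : V) ∈ b w} := by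
  refine ⟨fun w => ?_, fun w w' h => ?_, fun w w' h => ?_⟩
  · obtain ⟨r, hr, hrv⟩ : ∃ r, r ∈ b w ∧ r ≠ v := by
      obtain ⟨r, hr⟩ := (hb.conn w).1
      by_cases e : r = v
      · exact ⟨u, (hs w).2 (e ▸ hr), huv.ne⟩
      · exact ⟨r, hr, e⟩
    refine conn_of_root (u := ⟨r, hrv⟩) hr fun T huT hT => ?_
    -- A closed set of the contracted bag is lifted to the original bag by letting `v` follow `u`.
    have := (hb.conn w).2
      {x | (∃ h : x ≠ v, (⟨x, h⟩ : {w : V // w ≠ v}) ∈ T) ∨ x = v ∧ ⟨u, huv.ne⟩ ∈ T}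
      ⟨r, hr, Or.inl ⟨hrv, huT⟩⟩ ?_
    · rintro ⟨x, hxv⟩ hx
      rcases this hx with ⟨_, h⟩ | ⟨h, _⟩
      · exact h
      · exact absurd h hxv
    · intro a ha haT c hc hac
      by_cases hcv : c = v
      · subst hcv
        refine Or.inr ⟨rfl, ?_⟩
        rcases haT with ⟨hav, haT⟩ | ⟨rfl, _⟩
        · by_cases hau : a = u
          · subst hau; exact haT
          · exact hT ⟨a, hav⟩ ha haT ⟨u, huv.ne⟩ ((hs w).2 hc) (edgeContraction_adj.2
              ⟨fun e => hau (congrArg Subtype.val e), Or.inr (Or.inr ⟨rfl, hac.symm⟩)⟩)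
        · exact absurd rfl hac.ne
      · refine Or.inl ⟨hcv, ?_⟩
        rcases haT with ⟨hav, haT⟩ | ⟨rfl, huT⟩
        · exact hT ⟨a, hav⟩ ha haT ⟨c, hcv⟩ hc (edgeContraction_adj.2
            ⟨fun e => hac.ne (congrArg Subtype.val e), Or.inl (Or.inl hac)⟩)
        · by_cases hcu : c = u
          · subst hcu; exact huT
          · exact hT ⟨u, huv.ne⟩ ((hs w).2 ha) huT ⟨c, hcv⟩ hc (edgeContraction_adj.2
              ⟨fun e => hcu (congrArg Subtype.val e).symm, Or.inl (Or.inr ⟨rfl, hac⟩)⟩)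
  · exact Set.disjoint_left.2 fun x hx hx' => Set.disjoint_left.1 (hb.disj w w' h) hx hx'
  · rw [hb.touch w w' h]
    have hd : ∀ x, x ∈ b w → x ∉ b w' := fun x hx hx' =>
      Set.disjoint_left.1 (hb.disj w w' h) hx hx'
    constructor
    · rintro ⟨x, hx, y, hy, hxy⟩
      have hne : ∀ {x y : {w : V // w ≠ v}}, (x : V) ∈ b w → (y : V) ∈ b w' → x ≠ y :=
        fun hx hy e => hd _ hx (e ▸ hy)
      by_cases hxv : x = v
      · subst hxv
        have hyv : y ≠ x := fun e => hd _ hx (e ▸ hy)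
        exact ⟨⟨u, huv.ne⟩, (hs w).2 hx, ⟨y, hyv⟩, hy, edgeContraction_adj.2
          ⟨hne ((hs w).2 hx) hy, Or.inl (Or.inr ⟨rfl, hxy⟩)⟩⟩
      · by_cases hyv : y = v
        · subst hyv
          exact ⟨⟨x, hxv⟩, hx, ⟨u, huv.ne⟩, (hs w').2 hy, edgeContraction_adj.2
            ⟨hne hx ((hs w').2 hy), Or.inr (Or.inr ⟨rfl, hxy.symm⟩)⟩⟩
        · exact ⟨⟨x, hxv⟩, hx, ⟨y, hyv⟩, hy, edgeContraction_adj.2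
            ⟨hne hx hy, Or.inl (Or.inl hxy)⟩⟩
    · rintro ⟨x, hx, y, hy, hxy⟩
      rcases (edgeContraction_adj.1 hxy).2 with (h | ⟨h, h'⟩) | (h | ⟨h, h'⟩)
      · exact ⟨x, hx, y, hy, h⟩
      · exact ⟨v, (hs w).1 (h ▸ hx), y, hy, h'⟩
      · exact ⟨x, hx, y, hy, h.symm⟩
      · exact ⟨x, hx, v, (hs w').1 (h ▸ hy), h'.symm⟩

/-- Induction on the number of vertices: a vertex in no bag is deleted, and an edge inside a bag is
contracted. If neither exists, the bags are singletons covering the graph, and the model is an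
isomorphism. -/
theorem IsModel.isInducedMinor_aux (H : SimpleGraph W) (n : ℕ) :
    ∀ {V : Type u} [Finite V] {G : SimpleGraph V} {b : W → Set V}, Nat.card V = n →
      IsModel H G b → IsInducedMinor H G := by
  induction n using Nat.strong_induction_on with
  | _ n ih =>
  intro V _ G b hn hb
  have hcard : ∀ v : V, Nat.card {w : V // w ≠ v} < n := fun v => by
    rw [← hn]
    exact Finite.card_subtype_lt (x := v) (by simp)
  by_cases h1 : ∃ v, ∀ w, v ∉ b w
  · obtain ⟨v, hv⟩ := h1
    exact .deletion v (ih _ (hcard v) rfl (hb.vertexDeletion hv))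
  by_cases h2 : ∃ w, ¬ (b w).Subsingleton
  · obtain ⟨w, hw⟩ := h2
    obtain ⟨x, hx, y, hy, hxy⟩ := Set.not_subsingleton_iff.1 hw
    obtain ⟨v, hv, hxv⟩ : ∃ v ∈ b w, G.Adj x v := by
      by_contra! hcon
      have := (hb.conn w).2 {x} ⟨x, hx, rfl⟩ (by
        rintro a ha rfl c hc hac
        exact absurd hac (hcon c hc))
      exact hxy (this hy).symm
    refine .contraction x v hxv (ih _ (hcard v) rfl (hb.edgeContraction hxv fun w' => ?_))
    by_cases e : w' = w
    · subst e; exact ⟨fun _ => hv, fun _ => hx⟩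
    · have := Set.disjoint_left.1 (hb.disj w' w e)
      exact ⟨fun h => absurd hx (this h), fun h => absurd hv (this h)⟩
  push Not at h1 h2
  choose f hf using h1
  have hfeq : ∀ {v w}, v ∈ b w → f v = w := fun {v w} h => by
    by_contra e
    exact Set.disjoint_left.1 (hb.disj _ _ e) (hf v) h
  have hbij : Function.Bijective f := by
    refine ⟨fun x y e => h2 (f x) (hf x) (e ▸ hf y), fun w => ?_⟩
    obtain ⟨x, hx⟩ := (hb.conn w).1
    exact ⟨x, hfeq hx⟩
  refine .iso ⟨Equiv.ofBijective f hbij, fun {x y} => ?_⟩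
  simp only [Equiv.ofBijective_apply]
  by_cases e : x = y
  · subst e; simp
  · rw [hb.touch _ _ (hbij.1.ne e)]
    constructor
    · rintro ⟨x', hx', y', hy', h⟩
      rwa [h2 _ (hf x) hx', h2 _ (hf y) hy']
    · exact fun h => ⟨x, hf x, y, hf y, h⟩

theorem IsModel.isInducedMinor [Finite V] {b : W → Set V} (hb : IsModel H G b) :
    IsInducedMinor H G := IsModel.isInducedMinor_aux H _ rfl hb

/-- `G` has no model of the gem. -/
def GemFree {V : Type*} (G : SimpleGraph V) : Prop := ∀ b : Fin 5 → Set V, ¬ IsModel gem G b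

theorem InducedMinorFree.gemFree [Finite V] (hH : H.IsIndContained gem)
    (hG : InducedMinorFree H G) : G.GemFree := fun _ hb =>
  let ⟨e⟩ := hH
  hG (hb.comp_embedding e).isInducedMinor

end Models
-- Reduction to decidable checks on small touching patterns.
section Finite

/-- Adjacency in the gem. -/
def gemAdj : Fin 5 → Fin 5 → Bool :=
  ![![false, true, false, false, true], ![true, false, true, false, true],
    ![false, true, false, true, true], ![false, false, true, false, true],
    ![true, true, true, true, false]]

theorem gem_adj (i j : Fin 5) : gem.Adj i j ↔ gemAdj i j = true := by
  fin_cases i <;> fin_cases j <;> simp [gem, gemAdj]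

/-- The graph on `Fin n` given by the entries of `t` above the diagonal. -/
def upperGraph {n : ℕ} (t : Fin n → Fin n → Bool) : SimpleGraph (Fin n) where
  Adj i j := i ≠ j ∧ t (min i j) (max i j) = true
  symm := ⟨fun i j h => ⟨h.1.symm, by rw [min_comm, max_comm]; exact h.2⟩⟩
  loopless := ⟨fun _ h => h.1 rfl⟩

instance {n : ℕ} (t : Fin n → Fin n → Bool) : DecidableRel (upperGraph t).Adj :=
  fun i j => inferInstanceAs (Decidable (i ≠ j ∧ t (min i j) (max i j) = true))

/-- The classes of `f` form a model of the gem in `upperGraph t` with star-shaped bags; the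
vertices in class `5` are not used. -/
def gemCheck {n : ℕ} (t : Fin n → Fin n → Bool) (f : Fin n → Fin 6) : Bool :=
  decide ((∀ w : Fin 5, ∃ c, f c = w.castSucc ∧
      ∀ i, f i = w.castSucc → i = c ∨ (upperGraph t).Adj c i) ∧
    ∀ w w' : Fin 5, w < w' → (gemAdj w w' = true ↔
      ∃ i, f i = w.castSucc ∧ ∃ j, f j = w'.castSucc ∧ (upperGraph t).Adj i j))

theorem isModel_of_gemCheck {n : ℕ} {t : Fin n → Fin n → Bool} {f : Fin n → Fin 6}
    (h : gemCheck t f = true) :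
    IsModel gem (upperGraph t) fun w => {i | f i = w.castSucc} := by
  rw [gemCheck, decide_eq_true_eq] at h
  have hlt : ∀ w w' : Fin 5, w < w' → (gem.Adj w w' ↔ (upperGraph t).Touch
      {i | f i = w.castSucc} {i | f i = w'.castSucc}) := fun w w' hw => by
    rw [gem_adj, h.2 w w' hw]; rfl
  refine ⟨fun w => ?_, fun w w' hw => ?_, fun w w' hw => ?_⟩
  · obtain ⟨c, hc, hi⟩ := h.1 w
    refine conn_of_root (u := c) hc fun T hcT hT i hiw => ?_
    rcases hi i hiw with rfl | hadj
    · exact hcT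
    · exact hT c hc hcT i hiw hadj
  · exact Set.disjoint_left.2 fun i hi hi' =>
      hw (Fin.castSucc_injective _ ((show f i = _ from hi).symm.trans hi'))
  · rcases lt_or_gt_of_ne hw with hw | hw
    · exact hlt w w' hw
    · rw [adj_comm, hlt w' w hw, touch_comm]

variable {V : Type*} {G : SimpleGraph V}

/-- The bags realize `upperGraph t` as an induced minor, so a gem in that small graph would lift by
`IsModel.comp`. The case analyses thus become Boolean computations in which `f` tells which bags are
merged into which vertex of the gem. -/
theorem GemFree.gemCheck_eq_false (hG : G.GemFree) {n : ℕ} {b : Fin n → Set V}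
    (hc : ∀ i, G.Conn (b i)) (hd : ∀ i j, i < j → Disjoint (b i) (b j))
    {t : Fin n → Fin n → Bool} (ht : ∀ i j, i < j → (t i j = true ↔ G.Touch (b i) (b j)))
    (f : Fin n → Fin 6) : gemCheck t f = false := by
  by_contra h
  rw [Bool.not_eq_false] at h
  have hm : IsModel (upperGraph t) G b := by
    refine ⟨hc, fun i j hij => ?_, fun i j hij => ?_⟩
    · rcases lt_or_gt_of_ne hij with h | h
      · exact hd i j h
      · exact (hd j i h).symm
    · rcases lt_or_gt_of_ne hij with h | h
      · rw [← ht i j h]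
        simp [upperGraph, hij, min_eq_left h.le, max_eq_right h.le]
      · rw [touch_comm, ← ht j i h]
        simp [upperGraph, hij, min_eq_right h.le, max_eq_left h.le]
  exact hG _ (hm.comp (isModel_of_gemCheck h))

theorem GemFree.false_of_gemCheck (hG : G.GemFree) {n : ℕ} {t : Fin n → Fin n → Bool}
    {f : Fin n → Fin 6} (hf : gemCheck t f = true) (b : Fin n → Set V)
    (hc : ∀ i, G.Conn (b i)) (hd : ∀ i j, i < j → Disjoint (b i) (b j))
    (ht : ∀ i j, i < j → (t i j = true ↔ G.Touch (b i) (b j))) : False :=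
  Bool.false_ne_true ((hG.gemCheck_eq_false hc hd ht f).symm.trans hf)

/-- Four connected bags that form an induced path, and a connected bag that touches all of them. -/
theorem GemFree.false_of_bags (hG : G.GemFree) {A B C D H : Set V} (hA : G.Conn A)
    (hB : G.Conn B) (hC : G.Conn C) (hD : G.Conn D) (hH : G.Conn H)
    (dAB : Disjoint A B) (dAC : Disjoint A C) (dAD : Disjoint A D) (dAH : Disjoint A H)
    (dBC : Disjoint B C) (dBD : Disjoint B D) (dBH : Disjoint B H)
    (dCD : Disjoint C D) (dCH : Disjoint C H) (dDH : Disjoint D H)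
    (tAB : G.Touch A B) (tBC : G.Touch B C) (tCD : G.Touch C D)
    (tHA : G.Touch H A) (tHB : G.Touch H B) (tHC : G.Touch H C) (tHD : G.Touch H D)
    (nAC : ¬ G.Touch A C) (nAD : ¬ G.Touch A D) (nBD : ¬ G.Touch B D) : False := by
  have := hG.gemCheck_eq_false (b := ![A, B, C, D, H]) (t := gemAdj)
    (by intro i; fin_cases i <;> assumption)
    (by
      intro i j hij
      fin_cases i <;> fin_cases j <;> first | exact absurd hij (by decide) | assumption)
    (by
      intro i j hij
      fin_cases i <;> fin_cases j <;> first
        | exact absurd hij (by decide)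
        | exact ⟨fun h => absurd h (by decide), fun h => by contradiction⟩
        | exact ⟨fun _ => by first | assumption | exact Touch.symm (by assumption),
            fun _ => by decide⟩)
    ![0, 1, 2, 3, 4]
  exact absurd this (by decide)

/-- The first five bags `X, Y, K, Q₁, Q₂` form a four-cycle with a triangle on one edge. The sixth
bag touches `Q₁`, and `a, b, c, d` record whether it touches `X, Y, K, Q₂`. The only pattern with a
further contact that is excluded here is `K` and `Q₂` alone, where the six bags form a prism. -/
theorem chord_check : ∀ a b c d : Bool, (a || b || c || d) = true → (a || b || !c || !d) = true →
    ∃ f ∈ [![1, 4, 0, 2, 3, 4], ![4, 0, 1, 3, 5, 2], ![4, 1, 0, 2, 2, 3], ![1, 4, 0, 2, 4, 3],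
      ![4, 1, 2, 4, 0, 3]],
    gemCheck ![![false, true, true, true, false, a], ![false, false, true, false, true, b],
      ![false, false, false, false, false, c], ![false, false, false, false, true, true],
      ![false, false, false, false, false, d], fun _ => false] f = true := by
  decide

end Finite
-- Attaching a bag to a four-cycle with a triangle on one edge.
section Chord

variable {V : Type*} {G : SimpleGraph V}

/-- A cycle of connected bags `X, Q₁, Q₂, Y` of length four with no chords between opposite bags,
together with a connected bag `K` that touches just `X` and `Y`. -/
structure ChordBags (G : SimpleGraph V) (X Y K Q₁ Q₂ : Set V) : Prop where
  cX : G.Conn X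
  cY : G.Conn Y
  cK : G.Conn K
  c₁ : G.Conn Q₁
  c₂ : G.Conn Q₂
  dXY : Disjoint X Y
  dXK : Disjoint X K
  dX₁ : Disjoint X Q₁
  dX₂ : Disjoint X Q₂
  dYK : Disjoint Y K
  dY₁ : Disjoint Y Q₁
  dY₂ : Disjoint Y Q₂
  dK₁ : Disjoint K Q₁
  dK₂ : Disjoint K Q₂
  d₁₂ : Disjoint Q₁ Q₂
  tXY : G.Touch X Y
  tXK : G.Touch X K
  tX₁ : G.Touch X Q₁
  tYK : G.Touch Y K
  tY₂ : G.Touch Y Q₂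
  t₁₂ : G.Touch Q₁ Q₂
  nX₂ : ¬ G.Touch X Q₂
  nY₁ : ¬ G.Touch Y Q₁
  nK₁ : ¬ G.Touch K Q₁
  nK₂ : ¬ G.Touch K Q₂

theorem ChordBags.symm {X Y K Q₁ Q₂ : Set V} (h : ChordBags G X Y K Q₁ Q₂) :
    ChordBags G Y X K Q₂ Q₁ :=
  ⟨h.cY, h.cX, h.cK, h.c₂, h.c₁, h.dXY.symm, h.dYK, h.dY₂, h.dY₁, h.dXK, h.dX₂, h.dX₁, h.dK₂,
    h.dK₁, h.d₁₂.symm, h.tXY.symm, h.tYK, h.tY₂, h.tXK, h.tX₁, h.t₁₂.symm, h.nY₁, h.nX₂, h.nK₂,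
    h.nK₁⟩

/-- By `chord_check`, everything but the prism pattern creates a gem. -/
theorem GemFree.touch_of_chordBags (hG : G.GemFree) {X Y K Q₁ Q₂ U : Set V}
    (h : ChordBags G X Y K Q₁ Q₂) (hU : G.Conn U) (dX : Disjoint X U) (dY : Disjoint Y U)
    (dK : Disjoint K U) (d₁ : Disjoint Q₁ U) (d₂ : Disjoint Q₂ U) (t₁ : G.Touch U Q₁)
    (ht : G.Touch U X ∨ G.Touch U Y ∨ G.Touch U K ∨ G.Touch U Q₂) :
    ¬ G.Touch U X ∧ ¬ G.Touch U Y ∧ G.Touch U K ∧ G.Touch U Q₂ := by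
  classical
  by_contra hcon
  obtain ⟨f, -, hf⟩ := chord_check (decide (G.Touch X U)) (decide (G.Touch Y U))
    (decide (G.Touch K U)) (decide (G.Touch Q₂ U))
    (by simpa [touch_comm (T := U), or_assoc] using ht)
    (by
      simp only [touch_comm (T := U), Bool.or_eq_true, decide_eq_true_eq, Bool.not_eq_true',
        decide_eq_false_iff_not]
      tauto)
  refine hG.false_of_gemCheck hf ![X, Y, K, Q₁, Q₂, U]
    (by intro i; fin_cases i; exacts [h.cX, h.cY, h.cK, h.c₁, h.c₂, hU])
    (by
      intro i j hij
      fin_cases i <;> fin_cases j <;> first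
        | exact absurd hij (by decide)
        | assumption
        | exact h.dXY
        | exact h.dXK
        | exact h.dX₁
        | exact h.dX₂
        | exact h.dYK
        | exact h.dY₁
        | exact h.dY₂
        | exact h.dK₁
        | exact h.dK₂
        | exact h.d₁₂)
    (by
      have := t₁.symm
      intro i j hij
      fin_cases i <;> fin_cases j <;> first
        | exact absurd hij (by decide)
        | exact decide_eq_true_iff
        | exact iff_of_true rfl this
        | exact iff_of_true rfl h.tXY
        | exact iff_of_true rfl h.tXK
        | exact iff_of_true rfl h.tX₁
        | exact iff_of_true rfl h.tYK.symm.symm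
        | exact iff_of_true rfl h.tY₂
        | exact iff_of_true rfl h.t₁₂
        | exact iff_of_false Bool.false_ne_true h.nX₂
        | exact iff_of_false Bool.false_ne_true h.nY₁
        | exact iff_of_false Bool.false_ne_true h.nK₁
        | exact iff_of_false Bool.false_ne_true h.nK₂)

end Chord

/-! ### Finite facts about the prism and its models. -/

section Prism

variable {V : Type*} {G : SimpleGraph V}

/-- The triangular prism: triangles `0 1 2` and `3 4 5`, and the edges `0 3`, `1 4`, `2 5`. -/
def prism : SimpleGraph (Fin 6) :=
  upperGraph ![![false, true, true, true, false, false], ![false, false, true, false, true, false],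
    ![false, false, false, false, false, true], ![false, false, false, false, true, true],
    ![false, false, false, false, false, true], fun _ => false]

instance : DecidableRel prism.Adj := inferInstanceAs (DecidableRel (upperGraph _).Adj)

/-- The last bag is an outside set and `a, …, f` record its contacts with the six bags of the prism:
two contacts already force a gem. -/
theorem prism_outside_check : ∀ a b c d e f : Bool,
    2 ≤ a.toNat + b.toNat + c.toNat + d.toNat + e.toNat + f.toNat →
    ∃ g ∈ [![0, 1, 4, 4, 2, 3, 4], ![0, 4, 1, 5, 3, 2, 4], ![1, 0, 5, 2, 4, 3, 4],
      ![0, 1, 4, 4, 2, 4, 3], ![1, 2, 4, 4, 3, 4, 0], ![4, 1, 2, 4, 4, 3, 0],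
      ![1, 4, 2, 0, 4, 4, 3], ![0, 0, 5, 4, 1, 2, 3], ![1, 4, 4, 2, 2, 3, 0]],
    gemCheck ![![false, true, true, true, false, false, a],
      ![false, false, true, false, true, false, b], ![false, false, false, false, false, true, c],
      ![false, false, false, false, true, true, d], ![false, false, false, false, false, true, e],
      ![false, false, false, false, false, false, f], fun _ => false] g = true := by
  decide

/-- Here bag `0` of the prism is cut into the first and the last bag. The primed variables are the
contacts of the second piece, and both pieces must have some contact. -/
theorem prism_split_check : ∀ a b c a' b' c' : Bool, (a || a') = true → (b || b') = true →
    (c || c') = true → (a || b || c) = true → (a' || b' || c') = true →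
    ∃ g ∈ [![0, 1, 4, 4, 2, 3, 4], ![0, 2, 4, 4, 3, 4, 1], ![1, 4, 2, 4, 4, 3, 0],
      ![1, 4, 4, 2, 2, 3, 0]],
    gemCheck ![![false, a, b, c, false, false, true],
      ![false, false, true, false, true, false, a'], ![false, false, false, false, false, true, b'],
      ![false, false, false, false, true, true, c'],
      ![false, false, false, false, false, true, false], fun _ => false, fun _ => false] g
        = true := by
  decide

/-- A prism with one triangle edge subdivided contains a gem, whether or not the new vertex sees the
third vertex of that triangle. -/
theorem long_prism_check : ∀ a : Bool,
    gemCheck ![![false, true, true, true, false, false, false],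
      ![false, false, true, false, false, true, false],
      ![false, false, false, false, false, false, true],
      ![false, false, false, false, true, false, true],
      ![false, false, false, false, false, true, a],
      ![false, false, false, false, false, false, true], fun _ => false]
      ![0, 1, 1, 4, 3, 2, 4] = true := by
  decide

/-- Vertex transitivity of the prism, by explicit automorphisms, so that splitting a bag has to be
checked for bag `0` only. -/
theorem exists_prism_embedding : ∀ i : Fin 6, ∃ e : prism ↪g prism, e 0 = i := by
  have key : ∀ f : Fin 6 → Fin 6, Function.Injective f →
      (∀ i j, prism.Adj (f i) (f j) ↔ prism.Adj i j) → ∃ e : prism ↪g prism, e 0 = f 0 :=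
    fun f hf h => ⟨⟨⟨f, hf⟩, fun {i j} => h i j⟩, rfl⟩
  intro i
  fin_cases i
  · exact key ![0, 1, 2, 3, 4, 5] (by decide) (by decide)
  · exact key ![1, 2, 0, 4, 5, 3] (by decide) (by decide)
  · exact key ![2, 0, 1, 5, 3, 4] (by decide) (by decide)
  · exact key ![3, 4, 5, 0, 1, 2] (by decide) (by decide)
  · exact key ![4, 5, 3, 1, 2, 0] (by decide) (by decide)
  · exact key ![5, 3, 4, 2, 0, 1] (by decide) (by decide)

theorem IsModel.touch_iff_of_prism {b : Fin 6 → Set V} (hb : IsModel prism G b) {i j : Fin 6}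
    (hij : i ≠ j) {c : Bool} (hc : decide (prism.Adj i j) = c) :
    c = true ↔ G.Touch (b i) (b j) := by
  rw [← hb.touch i j hij, ← hc, decide_eq_true_iff]

theorem GemFree.touch_prism_unique (hG : G.GemFree) {b : Fin 6 → Set V} (hb : IsModel prism G b)
    {U : Set V} (hU : G.Conn U) (hd : ∀ i, Disjoint (b i) U) {i j : Fin 6}
    (hi : G.Touch (b i) U) (hj : G.Touch (b j) U) : i = j := by
  classical
  by_contra hij
  obtain ⟨f, -, hf⟩ := prism_outside_check (decide (G.Touch (b 0) U)) (decide (G.Touch (b 1) U))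
    (decide (G.Touch (b 2) U)) (decide (G.Touch (b 3) U)) (decide (G.Touch (b 4) U))
    (decide (G.Touch (b 5) U)) (by
      have h : ∑ k : Fin 6, (decide (G.Touch (b k) U)).toNat ≥
          ∑ k ∈ {i, j}, (decide (G.Touch (b k) U)).toNat :=
        Finset.sum_le_sum_of_subset (Finset.subset_univ _)
      rw [Finset.sum_pair hij, decide_eq_true hi, decide_eq_true hj] at h
      simpa [Fin.sum_univ_succ, add_assoc] using h)
  refine hG.false_of_gemCheck hf ![b 0, b 1, b 2, b 3, b 4, b 5, U]
    (by intro i; fin_cases i <;> first | exact hb.conn _ | exact hU)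
    (by
      intro i j hij
      fin_cases i <;> fin_cases j <;> first
        | exact absurd hij (by decide)
        | exact hd _
        | exact hb.disj _ _ (by decide))
    (by
      intro i j hij
      fin_cases i <;> fin_cases j <;> first
        | exact absurd hij (by decide)
        | exact decide_eq_true_iff
        | exact hb.touch_iff_of_prism (by decide) rfl)

theorem GemFree.prism_not_split (hG : G.GemFree) {b : Fin 6 → Set V} (hb : IsModel prism G b)
    {i : Fin 6} {S T : Set V} (hS : G.Conn S) (hT : G.Conn T) (hST : Disjoint S T)
    (hbi : b i = S ∪ T) (ht : G.Touch S T) (hS' : ∃ j, j ≠ i ∧ G.Touch S (b j))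
    (hT' : ∃ j, j ≠ i ∧ G.Touch T (b j)) : False := by
  classical
  obtain ⟨e, rfl⟩ := exists_prism_embedding i
  have hb' := hb.comp_embedding e
  have e0 : (b ∘ e) 0 = S ∪ T := hbi
  have hsurj : Function.Surjective e := Finite.injective_iff_surjective.1 e.injective
  replace hS' : ∃ j, j ≠ 0 ∧ G.Touch S ((b ∘ e) j) := by
    obtain ⟨j, hj, h⟩ := hS'
    obtain ⟨j, rfl⟩ := hsurj j
    exact ⟨j, fun h => hj (h ▸ rfl), h⟩
  replace hT' : ∃ j, j ≠ 0 ∧ G.Touch T ((b ∘ e) j) := by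
    obtain ⟨j, hj, h⟩ := hT'
    obtain ⟨j, rfl⟩ := hsurj j
    exact ⟨j, fun h => hj (h ▸ rfl), h⟩
  clear hbi hb
  generalize b ∘ e = b at *
  have hor : ∀ j, j ≠ 0 → (prism.Adj 0 j ↔ G.Touch S (b j) ∨ G.Touch T (b j)) := fun j hj => by
    rw [hb'.touch 0 j hj.symm, e0, touch_union_left]
  have hnot : ∀ j, j ≠ 0 → ¬ prism.Adj 0 j → ¬ G.Touch S (b j) ∧ ¬ G.Touch T (b j) :=
    fun j hj h => not_or.1 fun h' => h ((hor j hj).2 h')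
  have n4 := hnot 4 (by decide) (by decide)
  have n5 := hnot 5 (by decide) (by decide)
  have three : ∀ S : Set V, ¬ G.Touch S (b 4) → ¬ G.Touch S (b 5) →
      (∃ j, j ≠ 0 ∧ G.Touch S (b j)) → G.Touch S (b 1) ∨ G.Touch S (b 2) ∨ G.Touch S (b 3) := by
    rintro S h4 h5 ⟨j, hj, h⟩
    fin_cases j
    · exact absurd rfl hj
    · exact Or.inl h
    · exact Or.inr (Or.inl h)
    · exact Or.inr (Or.inr h)
    · exact absurd h h4
    · exact absurd h h5
  have hSj := three S n4.1 n5.1 hS'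
  have hTj := three T n4.2 n5.2 hT'
  have h1 := (hor 1 (by decide)).1 (by decide)
  have h2 := (hor 2 (by decide)).1 (by decide)
  have h3 := (hor 3 (by decide)).1 (by decide)
  obtain ⟨f, -, hf⟩ := prism_split_check (decide (G.Touch S (b 1))) (decide (G.Touch S (b 2)))
    (decide (G.Touch S (b 3))) (decide (G.Touch (b 1) T)) (decide (G.Touch (b 2) T))
    (decide (G.Touch (b 3) T)) (by simpa [touch_comm (T := T)] using h1)
    (by simpa [touch_comm (T := T)] using h2) (by simpa [touch_comm (T := T)] using h3)
    (by simpa [or_assoc] using hSj) (by simpa [touch_comm (T := T), or_assoc] using hTj)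
  have hd : ∀ j, j ≠ 0 → Disjoint S (b j) ∧ Disjoint (b j) T := fun j hj => by
    have := hb'.disj 0 j hj.symm
    rw [e0, Set.disjoint_union_left] at this
    exact ⟨this.1, this.2.symm⟩
  refine hG.false_of_gemCheck hf ![S, b 1, b 2, b 3, b 4, b 5, T]
    (by intro i; fin_cases i <;> first | exact hS | exact hT | exact hb'.conn _)
    (by
      intro i j hij
      fin_cases i <;> fin_cases j <;> first
        | exact absurd hij (by decide)
        | exact hST
        | exact (hd _ (by decide)).1
        | exact (hd _ (by decide)).2
        | exact hb'.disj _ _ (by decide))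
    (by
      intro i j hij
      fin_cases i <;> fin_cases j <;> first
        | exact absurd hij (by decide)
        | exact decide_eq_true_iff
        | exact iff_of_true rfl ht
        | exact iff_of_false Bool.false_ne_true n4.1
        | exact iff_of_false Bool.false_ne_true n5.1
        | exact iff_of_false Bool.false_ne_true fun h => n4.2 h.symm
        | exact iff_of_false Bool.false_ne_true fun h => n5.2 h.symm
        | exact hb'.touch_iff_of_prism (by decide) rfl)

end Prism
-- Induced paths, their segments, and shortest walks.
section Paths

variable {V : Type*} {G : SimpleGraph V}

/-- `p 0, …, p m` is a path without chords, except that its ends may be adjacent. -/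
structure IndPath (G : SimpleGraph V) (p : ℕ → V) (m : ℕ) : Prop where
  ne : ∀ i j, i < j → j ≤ m → p i ≠ p j
  adj : ∀ i, i < m → G.Adj (p i) (p (i + 1))
  not_adj : ∀ i j, i + 1 < j → j ≤ m → 0 < i ∨ j < m → ¬ G.Adj (p i) (p j)

/-- The vertices `p i, …, p j`. -/
def seg (p : ℕ → V) (i j : ℕ) : Set V := p '' Set.Icc i j

theorem mem_seg {p : ℕ → V} {i j : ℕ} {v : V} : v ∈ seg p i j ↔ ∃ t, (i ≤ t ∧ t ≤ j) ∧ p t = v :=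
  Iff.rfl

theorem mem_seg_of_le {p : ℕ → V} {i j t : ℕ} (h : i ≤ t) (h' : t ≤ j) : p t ∈ seg p i j :=
  ⟨t, ⟨h, h'⟩, rfl⟩

theorem seg_self (p : ℕ → V) (i : ℕ) : seg p i i = {p i} := by simp [seg]

theorem conn_seg {p : ℕ → V} {i j : ℕ} (hij : i ≤ j)
    (h : ∀ t, i ≤ t → t < j → G.Adj (p t) (p (t + 1))) : G.Conn (seg p i j) := by
  induction j, hij using Nat.le_induction with
  | base => rw [seg_self]; exact conn_singleton _
  | succ j hij ih =>
    have : seg p i (j + 1) = seg p i j ∪ {p (j + 1)} := by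
      ext v
      simp only [mem_seg, Set.mem_union, Set.mem_singleton_iff]
      constructor
      · rintro ⟨t, ⟨h1, h2⟩, rfl⟩
        rcases Nat.lt_or_ge j t with h3 | h3
        · right; congr 1; omega
        · exact Or.inl ⟨t, ⟨h1, h3⟩, rfl⟩
      · rintro (⟨t, ⟨h1, h2⟩, rfl⟩ | rfl)
        · exact ⟨t, ⟨h1, by omega⟩, rfl⟩
        · exact ⟨j + 1, ⟨by omega, le_rfl⟩, rfl⟩
    rw [this]
    exact (ih fun t h1 h2 => h t h1 (by omega)).union (conn_singleton _)
      ⟨p j, mem_seg_of_le hij le_rfl, _, rfl, h j hij (by omega)⟩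

namespace IndPath

variable {p : ℕ → V} {m : ℕ}

theorem conn_seg (h : IndPath G p m) {i j : ℕ} (hij : i ≤ j) (hj : j ≤ m) : G.Conn (seg p i j) :=
  SimpleGraph.conn_seg hij fun t _ ht => h.adj t (by omega)

theorem eq_of_eq (h : IndPath G p m) {i j : ℕ} (hi : i ≤ m) (hj : j ≤ m) (e : p i = p j) :
    i = j := by
  rcases lt_trichotomy i j with h1 | h1 | h1
  · exact absurd e (h.ne i j h1 hj)
  · exact h1
  · exact absurd e.symm (h.ne j i h1 hi)

theorem mem_seg_iff (h : IndPath G p m) {i j t : ℕ} (hj : j ≤ m) (ht : t ≤ m) :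
    p t ∈ seg p i j ↔ i ≤ t ∧ t ≤ j := by
  constructor
  · rintro ⟨s, ⟨h1, h2⟩, e⟩
    have := h.eq_of_eq (by omega) ht e
    omega
  · exact fun h => mem_seg_of_le h.1 h.2

theorem disjoint_seg (h : IndPath G p m) {i j k l : ℕ} (hjk : j < k) (hl : l ≤ m) :
    Disjoint (seg p i j) (seg p k l) := by
  rw [Set.disjoint_left]
  rintro _ ⟨t, ⟨h1, h2⟩, rfl⟩ ⟨s, ⟨h3, h4⟩, e⟩
  exact h.ne t s (by omega) (by omega) e.symm

theorem touch_seg (h : IndPath G p m) {i j l : ℕ} (hij : i ≤ j) (hjl : j + 1 ≤ l) (hl : l ≤ m) :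
    G.Touch (seg p i j) (seg p (j + 1) l) :=
  ⟨p j, mem_seg_of_le hij le_rfl, p (j + 1), mem_seg_of_le le_rfl hjl, h.adj j (by omega)⟩

theorem not_adj' (h : IndPath G p m) {i j : ℕ} (hij : i + 1 < j) (hj : j ≤ m)
    (h' : 0 < i ∨ j < m ∨ ¬ G.Adj (p 0) (p m)) : ¬ G.Adj (p i) (p j) := by
  by_cases h1 : 0 < i ∨ j < m
  · exact h.not_adj i j hij hj h1
  · have h2 : i = 0 := by omega
    have h3 : j = m := by omega
    subst h2 h3
    tauto

theorem not_touch_seg (h : IndPath G p m) {i j k l : ℕ} (hjk : j + 1 < k) (hl : l ≤ m)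
    (h' : 0 < i ∨ l < m ∨ ¬ G.Adj (p 0) (p m)) : ¬ G.Touch (seg p i j) (seg p k l) := by
  rintro ⟨_, ⟨t, ⟨h1, h2⟩, rfl⟩, _, ⟨s, ⟨h3, h4⟩, rfl⟩, e⟩
  refine h.not_adj' (i := t) (j := s) (by omega) (by omega) ?_ e
  rcases h' with h' | h' | h'
  · left; omega
  · right; left; omega
  · exact Or.inr (Or.inr h')

theorem reverse (h : IndPath G p m) : IndPath G (fun i => p (m - i)) m := by
  refine ⟨fun i j hij hj => (h.ne _ _ (by omega) (by omega)).symm, fun i hi => ?_,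
    fun i j hij hj h' e => h.not_adj _ _ ?_ ?_ ?_ e.symm⟩
  · have := h.adj (m - (i + 1)) (by omega)
    rw [show m - (i + 1) + 1 = m - i by omega] at this
    exact this.symm
  all_goals omega

theorem adj_iff (h : IndPath G p m) {i j : ℕ} (hi : i ≤ m) (hj : j ≤ m) (h0 : 0 < i)
    (hm : i < m) : G.Adj (p i) (p j) ↔ j = i + 1 ∨ i = j + 1 := by
  constructor
  · intro e
    by_contra hcon
    rcases lt_trichotomy i j with h1 | h1 | h1
    · exact h.not_adj i j (by omega) hj (Or.inl h0) e
    · exact e.ne (by rw [h1])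
    · exact h.not_adj j i (by omega) hi (Or.inr hm) e.symm
  · rintro (rfl | rfl)
    · exact h.adj i hm
    · exact (h.adj j (by omega)).symm

end IndPath

/-- A connected bag that touches four vertices of an induced path yields a gem. -/
theorem GemFree.false_of_hub (hG : G.GemFree) {p : ℕ → V} {m : ℕ} (hp : IndPath G p m)
    {H : Set V} (hH : G.Conn H) {i₁ i₂ i₃ i₄ : ℕ} (h₁₂ : i₁ < i₂) (h₂₃ : i₂ < i₃) (h₃₄ : i₃ < i₄)
    (h₄ : i₄ ≤ m) (hne : 0 < i₁ ∨ i₄ < m ∨ ¬ G.Adj (p 0) (p m))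
    (hd : ∀ t, i₁ ≤ t → t ≤ i₄ → p t ∉ H) (t₁ : G.Touch H {p i₁}) (t₂ : G.Touch H {p i₂})
    (t₃ : G.Touch H {p i₃}) (t₄ : G.Touch H {p i₄}) : False := by
  have hdis : ∀ i j, i₁ ≤ i → j ≤ i₄ → Disjoint (seg p i j) H := by
    intro i j hi hj
    rw [Set.disjoint_left]
    rintro _ ⟨t, ⟨h1, h2⟩, rfl⟩
    exact hd t (by omega) (by omega)
  have ht : ∀ i j, i ≤ j → G.Touch H {p i} → G.Touch H (seg p i j) := fun i j hij h =>
    h.mono subset_rfl (Set.singleton_subset_iff.2 (mem_seg_of_le le_rfl hij))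
  -- The path is cut just before each touched vertex: the four segments are the path of the gem and
  -- `H` is its hub.
  refine hG.false_of_bags (A := seg p i₁ (i₂ - 1)) (B := seg p i₂ (i₃ - 1))
    (C := seg p i₃ (i₄ - 1)) (D := seg p i₄ i₄) (H := H) (hp.conn_seg (by omega) (by omega))
    (hp.conn_seg (by omega) (by omega)) (hp.conn_seg (by omega) (by omega))
    (hp.conn_seg (by omega) (by omega)) hH
    (hp.disjoint_seg (by omega) (by omega)) (hp.disjoint_seg (by omega) (by omega))
    (hp.disjoint_seg (by omega) (by omega)) (hdis _ _ (by omega) (by omega))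
    (hp.disjoint_seg (by omega) (by omega)) (hp.disjoint_seg (by omega) (by omega))
    (hdis _ _ (by omega) (by omega))
    (hp.disjoint_seg (by omega) (by omega)) (hdis _ _ (by omega) (by omega))
    (hdis _ _ (by omega) (by omega)) ?_ ?_ ?_ (ht _ _ (by omega) t₁) (ht _ _ (by omega) t₂)
    (ht _ _ (by omega) t₃) (ht _ _ (by omega) t₄)
    (hp.not_touch_seg (by omega) (by omega) (by omega))
    (hp.not_touch_seg (by omega) (by omega) (by tauto))
    (hp.not_touch_seg (by omega) (by omega) (by omega))
  · have := hp.touch_seg (i := i₁) (j := i₂ - 1) (l := i₃ - 1) (by omega) (by omega) (by omega)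
    rwa [show i₂ - 1 + 1 = i₂ by omega] at this
  · have := hp.touch_seg (i := i₂) (j := i₃ - 1) (l := i₄ - 1) (by omega) (by omega) (by omega)
    rwa [show i₃ - 1 + 1 = i₃ by omega] at this
  · have := hp.touch_seg (i := i₃) (j := i₄ - 1) (l := i₄) (by omega) (by omega) (by omega)
    rwa [show i₄ - 1 + 1 = i₄ by omega] at this

/-- A walk from `x` to `y` of length `m` with interior in `S`. -/
def WalkIn (G : SimpleGraph V) (S : Set V) (x y : V) (p : ℕ → V) (m : ℕ) : Prop :=
  p 0 = x ∧ p m = y ∧ (∀ i, i < m → G.Adj (p i) (p (i + 1))) ∧ ∀ i, 0 < i → i < m → p i ∈ S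

theorem exists_walkIn {S : Set V} (hS : G.Conn S) {x y : V} (hx : G.Touch {x} S)
    (hy : G.Touch {y} S) : ∃ m p, 2 ≤ m ∧ WalkIn G S x y p m := by
  obtain ⟨_, rfl, a, ha, hxa⟩ := hx
  obtain ⟨_, rfl, b, hb, hyb⟩ := hy
  rename_i x y
  have key := hS.2 {v | ∃ m p, 1 ≤ m ∧ p 0 = x ∧ p m = v ∧ (∀ i, i < m → G.Adj (p i) (p (i + 1))) ∧
    ∀ i, 0 < i → i ≤ m → p i ∈ S} ⟨a, ha, 1, fun i => if i = 0 then x else a, le_rfl, rfl, rfl,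
      fun i hi => by
        have : i = 0 := by omega
        subst this
        simpa using hxa,
      fun i hi _ => by simpa [hi.ne'] using ha⟩ ?_
  · obtain ⟨m, p, hm, h0, h1, h2, h3⟩ := key hb
    refine ⟨m + 1, fun i => if i ≤ m then p i else y, by omega, by simp [h0], by simp,
      fun i hi => ?_, fun i hi hi' => ?_⟩
    · rcases Nat.lt_or_ge i m with h | h
      · have h' : i + 1 ≤ m := h
        simpa [h.le, h'] using h2 i h
      · have : i = m := by omega
        subst this
        simpa [h1] using hyb.symm
    · have : i ≤ m := by omega
      simpa [this] using h3 i hi this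
  · rintro c hc ⟨m, p, hm, h0, h1, h2, h3⟩ d hd hcd
    refine ⟨m + 1, fun i => if i ≤ m then p i else d, by omega, by simp [h0], by simp,
      fun i hi => ?_, fun i hi hi' => ?_⟩
    · rcases Nat.lt_or_ge i m with h | h
      · have h' : i + 1 ≤ m := h
        simpa [h.le, h'] using h2 i h
      · have : i = m := by omega
        subst this
        simpa [h1] using hcd
    · by_cases h : i ≤ m
      · simpa [h] using h3 i hi h
      · simpa [h] using hd

theorem WalkIn.shortcut {S : Set V} {x y : V} {p : ℕ → V} {m i d : ℕ} (h : WalkIn G S x y p m)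
    (him : i + d < m) (hadj : G.Adj (p i) (p (i + d + 1)))  :
    WalkIn G S x y (fun t => if t ≤ i then p t else p (t + d)) (m - d) := by
  obtain ⟨h0, h1, h2, h3⟩ := h
  refine ⟨by simp [h0], ?_, fun t ht => ?_, fun t ht ht' => ?_⟩
  · have : ¬ (m - d ≤ i) := by omega
    simp only [this, if_false]
    rw [← h1]; congr 1; omega
  · rcases lt_trichotomy t i with h | h | h
    · have h' : t + 1 ≤ i := h
      simpa [h.le, h'] using h2 t (by omega)
    · subst h
      simpa [show t + 1 + d = t + d + 1 by omega] using hadj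
    · have h4 : ¬ t ≤ i := by omega
      have h5 : ¬ t + 1 ≤ i := by omega
      simp only [h4, h5, if_false]
      have := h2 (t + d) (by omega)
      rwa [show t + d + 1 = t + 1 + d by omega] at this
  · by_cases h : t ≤ i
    · simpa [h] using h3 t ht (by omega)
    · simpa [h] using h3 (t + d) (by omega) (by omega)

/-- Two vertices that touch a connected set are joined by an induced path through this set. -/
theorem exists_indPath {S : Set V} (hS : G.Conn S) {x y : V} (hxS : x ∉ S) (hyS : y ∉ S)
    (hxy : x ≠ y) (hx : G.Touch {x} S) (hy : G.Touch {y} S) :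
    ∃ l p, 1 ≤ l ∧ p 0 = x ∧ p (l + 1) = y ∧ IndPath G p (l + 1) ∧
      ∀ i, 0 < i → i ≤ l → p i ∈ S := by
  classical
  -- The walk is shortest among those of length at least two, so that a possible edge between `x`
  -- and `y` does not bypass `S`.
  have hex : ∃ m, 2 ≤ m ∧ ∃ p, WalkIn G S x y p m := by
    obtain ⟨m, p, hm, hp⟩ := exists_walkIn hS hx hy
    exact ⟨m, hm, p, hp⟩
  obtain ⟨hm, p, hp⟩ := Nat.find_spec hex
  have hmin : ∀ k, 2 ≤ k → k < Nat.find hex → ∀ q, ¬ WalkIn G S x y q k := fun k h2 hk q hq =>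
    Nat.find_min hex hk ⟨h2, q, hq⟩
  generalize Nat.find hex = m at *
  have hno : ∀ i d, 0 < d → i + d < m → 0 < i ∨ i + d + 1 < m → ¬ G.Adj (p i) (p (i + d + 1)) :=
    fun i d hd him h' hadj => hmin (m - d) (by omega) (by omega) _ (hp.shortcut him hadj)
  obtain ⟨h0, h1, h2, h3⟩ := hp
  refine ⟨m - 1, p, by omega, h0, by rw [show m - 1 + 1 = m by omega]; exact h1,
    ⟨fun i j hij hj e => ?_, fun i hi => h2 i (by omega), fun i j hij hj h' => ?_⟩,
    fun i hi hi' => h3 i hi (by omega)⟩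
  · rcases Nat.eq_zero_or_pos i with rfl | hi
    · rcases Nat.lt_or_ge j m with hjm | hjm
      · exact hxS (by rw [← h0, e]; exact h3 j hij hjm)
      · have : j = m := by omega
        subst this
        exact hxy (by rw [← h0, e, h1])
    · rcases Nat.lt_or_ge j m with hjm | hjm
      · have hij' := h2 j hjm
        rw [← e] at hij'
        refine hno i (j - i) (by omega) (by omega) (Or.inl hi) ?_
        rwa [show i + (j - i) + 1 = j + 1 by omega]
      · have : j = m := by omega
        subst this
        exact hyS (by rw [← h1, ← e]; exact h3 i hi hij)
  · have := hno i (j - i - 1) (by omega) (by omega) (by omega)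
    rwa [show i + (j - i - 1) + 1 = j by omega] at this

end Paths
-- From an induced path on four vertices to a configuration.
section Conf

variable {V : Type*} {G : SimpleGraph V}

/-- No set of vertices is separated from the rest of the graph by a single vertex. -/
def TwoConn (G : SimpleGraph V) : Prop :=
  ∀ (S : Set V) (v : V), S.Nonempty → v ∉ S → (∀ a ∈ S, ∀ b ∉ S, G.Adj a b → b = v) →
    ∀ w, w ∈ S ∨ w = v

theorem TwoConn.exists_adj (h : G.TwoConn) {S : Set V} (hS : S.Nonempty) {v w : V} (hv : v ∉ S)
    (hw : w ∉ S) (hwv : w ≠ v) : ∃ a ∈ S, ∃ b, b ∉ S ∧ b ≠ v ∧ G.Adj a b := by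
  by_contra! hcon
  rcases h S v hS hv (fun a ha b hb hab => by
    by_contra hbv
    exact hcon a ha b hb hbv hab) w with h1 | h1
  · exact hw h1
  · exact hwv h1

/-- A path `q 0, …, q (k + 1)` of length at least three, without chords except possibly the one
between its ends, and a connected set `K` off the path that touches the ends of the path only. -/
structure Conf (G : SimpleGraph V) (q : ℕ → V) (k : ℕ) (K : Set V) : Prop where
  path : IndPath G q (k + 1)
  two_le : 2 ≤ k
  conn : G.Conn K
  not_mem : ∀ i, i ≤ k + 1 → q i ∉ K
  touch_left : G.Touch {q 0} K
  touch_right : G.Touch {q (k + 1)} K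
  not_touch : ∀ i, 0 < i → i ≤ k → ¬ G.Touch {q i} K

/-- The path with the vertices `x, a, b, y`. -/
def path4 (x a b y : V) (t : ℕ) : V := if t = 0 then x else if t = 1 then a else if t = 2 then b
  else y

theorem indPath4 {x a b y : V} (hxa : G.Adj x a) (hab : G.Adj a b) (hby : G.Adj b y)
    (hxb : ¬ G.Adj x b) (hay : ¬ G.Adj a y) (hxb' : x ≠ b) (hay' : a ≠ y) (hxy : x ≠ y) :
    IndPath G (path4 x a b y) 3 := by
  have h1 := hxa.ne
  have h2 := hab.ne
  have h3 := hby.ne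
  refine ⟨fun i j hij hj => ?_, fun i hi => ?_, fun i j hij hj h => ?_⟩
  · have : j = 1 ∨ j = 2 ∨ j = 3 := by omega
    rcases this with rfl | rfl | rfl <;> interval_cases i <;> simpa [path4]
  · interval_cases i <;> simpa [path4]
  · have : j = 2 ∨ j = 3 := by omega
    have hi : i ≤ 1 := by omega
    rcases this with rfl | rfl <;> interval_cases i <;> simp_all [path4]

theorem conf4 {x a b y : V} {K : Set V} (hp : IndPath G (path4 x a b y) 3) (hK : G.Conn K)
    (hxK : x ∉ K) (haK : a ∉ K) (hbK : b ∉ K) (hyK : y ∉ K) (tx : G.Touch {x} K)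
    (ty : G.Touch {y} K) (na : ¬ G.Touch {a} K) (nb : ¬ G.Touch {b} K) :
    Conf G (path4 x a b y) 2 K := by
  refine ⟨hp, le_rfl, hK, fun i hi => ?_, by simpa [path4], by simpa [path4], fun i hi hi' => ?_⟩
  · interval_cases i <;> simpa [path4]
  · interval_cases i <;> simpa [path4]

/-- The path `b, p 0, …, p i` has no chord except possibly between its ends, and the rest of `p`
serves as `K`: it meets `b` through its last vertex and `p i` through its first. -/
theorem conf_of_single {p : ℕ → V} {l : ℕ} (hp : IndPath G p (l + 1))
    (hne : ¬ G.Adj (p 0) (p (l + 1))) {b : V} (hb : ∀ t, t ≤ l + 1 → p t ≠ b)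
    (h0 : G.Adj b (p 0)) (h1 : G.Adj b (p (l + 1))) {i : ℕ} (hi : 2 ≤ i) (hil : i ≤ l)
    (huniq : ∀ j, 0 < j → j ≤ l → G.Adj b (p j) → j = i) :
    ∃ q k K, Conf G q k K := by
  refine ⟨fun t => if t = 0 then b else p (t - 1), i, seg p (i + 1) (l + 1), ⟨?_, ?_, ?_⟩, hi,
    hp.conn_seg (by omega) le_rfl, ?_, ?_, ?_, ?_⟩
  · intro s t hst ht
    have ht' : t ≠ 0 := by omega
    rcases Nat.eq_zero_or_pos s with rfl | hs
    · simpa [ht'] using (hb (t - 1) (by omega)).symm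
    · simpa [ht', hs.ne'] using hp.ne (s - 1) (t - 1) (by omega) (by omega)
  · intro t ht
    rcases Nat.eq_zero_or_pos t with rfl | h
    · simpa using h0
    · have := hp.adj (t - 1) (by omega)
      rw [show t - 1 + 1 = t by omega] at this
      simpa [h.ne'] using this
  · intro s t hst ht h
    have ht' : t ≠ 0 := by omega
    rcases Nat.eq_zero_or_pos s with rfl | hs
    · simp only [if_true, ht', if_false]
      intro e
      have := huniq (t - 1) (by omega) (by omega) e
      omega
    · simpa [ht', hs.ne'] using hp.not_adj' (i := s - 1) (j := t - 1) (by omega) (by omega)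
        (Or.inr (Or.inr hne))
  · intro t ht
    rcases Nat.eq_zero_or_pos t with rfl | h
    · rintro ⟨s, ⟨h1, h2⟩, e⟩
      exact hb s h2 (by simpa using e)
    · simp only [h.ne', if_false]
      rw [hp.mem_seg_iff le_rfl (by omega)]
      omega
  · exact ⟨b, by simp, p (l + 1), mem_seg_of_le (by omega) le_rfl, h1⟩
  · exact ⟨p i, by simp, p (i + 1), mem_seg_of_le le_rfl (by omega), hp.adj i (by omega)⟩
  · intro t ht ht'
    simp only [ht.ne', if_false]
    rw [← seg_self]
    exact hp.not_touch_seg (by omega) le_rfl (Or.inr (Or.inr hne))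

/-- By 2-connectivity a component off `{a, b, c}` joins `a` to `c`. On a shortest path through it, a
single inner vertex is the common neighbor. If there are more inner vertices, the number of them
seen by `b` decides: none gives a configuration with `K = {b}`, one gives `conf_of_single`, and two
make `b` the hub of a gem. -/
theorem conf_or_common_neighbor (hG : G.GemFree) (h2 : G.TwoConn) {a b c : V} (hab : G.Adj a b)
    (hbc : G.Adj b c) (hac : ¬ G.Adj a c) (hne : a ≠ c) :
    (∃ q k K, Conf G q k K) ∨ ∃ r, r ≠ b ∧ G.Adj r a ∧ G.Adj r c := by
  -- Otherwise `a`, with all components off `{a, b, c}` that contain a neighbor of `a`, is separated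
  -- from `c` by `b`.
  obtain ⟨u, huS, hau, hcu⟩ : ∃ u ∈ ({a, b, c} : Set V)ᶜ, G.Adj a u ∧
      G.Touch {c} (G.compIn {a, b, c}ᶜ u) := by
    by_contra! hcon
    have hbT : b ∉ insert a {w | ∃ u ∈ ({a, b, c} : Set V)ᶜ, G.Adj a u ∧
        w ∈ G.compIn {a, b, c}ᶜ u} := by
      rintro (h | ⟨u, -, -, h⟩)
      · exact hab.ne h.symm
      · exact h.1 (by simp)
    have hcl : ∀ e ∈ insert a {w | ∃ u ∈ ({a, b, c} : Set V)ᶜ, G.Adj a u ∧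
        w ∈ G.compIn {a, b, c}ᶜ u}, ∀ f ∉ insert a {w | ∃ u ∈ ({a, b, c} : Set V)ᶜ, G.Adj a u ∧
        w ∈ G.compIn {a, b, c}ᶜ u}, G.Adj e f → f = b := by
      rintro e (rfl | ⟨u, hu, hau, he⟩) f hf hef
      · by_contra hfb
        refine hf (Or.inr ⟨f, ?_, hef, mem_compIn_self ?_⟩) <;>
        · rintro (h | h | h)
          · exact hef.ne h.symm
          · exact hfb h
          · rw [Set.mem_singleton_iff] at h
            exact hac (h ▸ hef)
      · by_contra hfb
        refine hf (Or.inr ⟨u, hu, hau, compIn_closed he ?_ hef⟩)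
        rintro (h | h | h)
        · exact hf (Or.inl h)
        · exact hfb h
        · rw [Set.mem_singleton_iff] at h
          subst h
          exact hcon u hu hau ⟨f, rfl, e, he, hef.symm⟩
    rcases h2 _ b ⟨a, Or.inl rfl⟩ hbT hcl c with h | h
    · rcases h with h | ⟨u, -, -, h⟩
      · exact hne h.symm
      · exact h.1 (by simp)
    · exact hbc.ne h.symm
  have hsub := compIn_subset (G := G) ({a, b, c} : Set V)ᶜ u
  obtain ⟨l, p, hl, h0, h1, hp, hS⟩ := exists_indPath (conn_compIn huS) (x := a) (y := c)
    (fun h => hsub h (by simp)) (fun h => hsub h (by simp)) hne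
    ⟨a, rfl, u, mem_compIn_self huS, hau⟩ hcu
  have hb : ∀ t, t ≤ l + 1 → p t ≠ b := by
    intro t ht
    rcases Nat.eq_zero_or_pos t with rfl | h
    · rw [h0]; exact hab.ne
    · rcases Nat.lt_or_ge l t with h' | h'
      · rw [show t = l + 1 by omega, h1]; exact hbc.ne.symm
      · exact fun e => hsub (hS t h h') (by simp [e])
  have hpne : ¬ G.Adj (p 0) (p (l + 1)) := by rwa [h0, h1]
  have hb0 : G.Adj b (p 0) := by rw [h0]; exact hab.symm
  have hb1 : G.Adj b (p (l + 1)) := by rwa [h1]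
  rcases Nat.lt_or_ge 1 l with hl2 | hl2
  swap
  · have : l = 1 := by omega
    subst this
    refine Or.inr ⟨p 1, hb 1 (by omega), ?_, ?_⟩
    · rw [← h0]; exact (hp.adj 0 (by omega)).symm
    · rw [← h1]; exact hp.adj 1 (by omega)
  left
  by_cases hex : ∃ i, 0 < i ∧ i ≤ l ∧ G.Adj b (p i)
  · obtain ⟨i, hi, hil, hbi⟩ := hex
    by_cases huniq : ∀ j, 0 < j → j ≤ l → G.Adj b (p j) → j = i
    · rcases Nat.lt_or_ge 1 i with hi2 | hi2
      · exact conf_of_single hp hpne hb hb0 hb1 hi2 hil huniq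
      · have : i = 1 := by omega
        subst this
        refine conf_of_single (l := l) (i := l) hp.reverse ?_ (fun t ht => hb _ (by omega))
          (by simpa using hb1) (by simpa using hb0) hl2 le_rfl
          fun j hj hjl e => ?_
        · simpa [adj_comm] using hpne
        · have := huniq _ (by omega) (by omega) e
          omega
    · push Not at huniq
      obtain ⟨j, hj, hjl, hbj, hji⟩ := huniq
      exfalso
      have hub : ∀ i j, 0 < i → i < j → j ≤ l → G.Adj b (p i) → G.Adj b (p j) → False :=
        fun i j hi hij hj hbi hbj => hG.false_of_hub hp (conn_singleton b) (i₁ := 0) (i₂ := i)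
          (i₃ := j) (i₄ := l + 1) hi hij (by omega) le_rfl (Or.inr (Or.inr hpne))
          (fun t _ ht => hb t ht) (by simpa) (by simpa) (by simpa) (by simpa)
      rcases lt_or_gt_of_ne hji with h | h
      · exact hub j i hj h hil hbj hbi
      · exact hub i j hi h hjl hbi hbj
  · push Not at hex
    refine ⟨p, l, {b}, hp, hl2, conn_singleton b, fun i hi => hb i hi, by simpa using hb0.symm,
      by simpa using hb1.symm, fun i hi hil => ?_⟩
    simpa [adj_comm] using hex i hi hil

theorem exists_conf_aux (hG : G.GemFree) {a b c d r : V} (hab : G.Adj a b)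
    (hbc : G.Adj b c) (hcd : G.Adj c d) (hac : ¬ G.Adj a c) (hbd : ¬ G.Adj b d)
    (had : ¬ G.Adj a d) (nac : a ≠ c) (nbd : b ≠ d) (nad : a ≠ d) (hrb : r ≠ b)
    (hra : G.Adj r a) (hrc : G.Adj r c) (hrd : G.Adj r d) : ∃ q k K, Conf G q k K := by
  by_cases hbr : G.Adj b r
  · exact (hG.false_of_bags (A := {a}) (B := {b}) (C := {c}) (D := {d}) (H := {r})
      (conn_singleton _) (conn_singleton _) (conn_singleton _) (conn_singleton _)
      (conn_singleton _) (by simpa using hab.ne) (by simpa using nac) (by simpa using nad)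
      (by simpa using hra.ne.symm) (by simpa using hbc.ne) (by simpa using nbd)
      (by simpa using hbr.ne) (by simpa using hcd.ne) (by simpa using hrc.ne.symm)
      (by simpa using hrd.ne.symm) (by simpa) (by simpa) (by simpa) (by simpa)
      (by simpa using hbr.symm) (by simpa) (by simpa) (by simpa) (by simpa) (by simpa)).elim
  -- Without the edge `br`, the vertices `r, a, b, c` form an induced four-cycle, and `d` sees just
  -- `r` and `c`.
  · refine ⟨_, _, {d}, conf4 (indPath4 hra hab hbc (fun h => hbr h.symm) hac hrb nac hrc.ne)
      (conn_singleton d) hrd.ne nad nbd hcd.ne (by simpa) (by simpa) (by simpa) (by simpa)⟩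

/-- An induced path on four vertices yields a configuration. -/
theorem exists_conf (hG : G.GemFree) (h2 : G.TwoConn) {a b c d : V} (hab : G.Adj a b)
    (hbc : G.Adj b c) (hcd : G.Adj c d) (hac : ¬ G.Adj a c) (hbd : ¬ G.Adj b d)
    (had : ¬ G.Adj a d) (nac : a ≠ c) (nbd : b ≠ d) (nad : a ≠ d) : ∃ q k K, Conf G q k K := by
  -- A second common neighbor `r` of `a, c` and a second common neighbor `s` of `b, d` are compared:
  -- every pattern of edges among `r, s` and the path gives a gem or a configuration.
  rcases conf_or_common_neighbor hG h2 hab hbc hac nac with h | ⟨r, hrb, hra, hrc⟩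
  · exact h
  rcases conf_or_common_neighbor hG h2 hcd.symm hbc.symm (fun h => hbd h.symm) nbd.symm with
    h | ⟨s, hsc, hsd, hsb⟩
  · exact h
  by_cases hrd : G.Adj r d
  · exact exists_conf_aux hG hab hbc hcd hac hbd had nac nbd nad hrb hra hrc hrd
  by_cases hsa : G.Adj s a
  · exact exists_conf_aux hG hcd.symm hbc.symm hab.symm (fun h => hbd h.symm)
      (fun h => hac h.symm) (fun h => had h.symm) nbd.symm nac.symm nad.symm hsc hsd hsb hsa
  have nrs : r ≠ s := fun h => hrd (h ▸ hsd)
  have nrd : r ≠ d := fun h => had (h ▸ hra).symm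
  have nsa : s ≠ a := fun h => had (h ▸ hsd)
  by_cases hrs : G.Adj r s
  · exact (hG.false_of_bags (A := {a}) (B := {r}) (C := {s}) (D := {d}) (H := {b, c})
      (conn_singleton _) (conn_singleton _) (conn_singleton _) (conn_singleton _)
      (conn_pair hbc) (by simpa using hra.ne.symm) (by simpa using nsa.symm) (by simpa using nad)
      (by simpa using ⟨hab.ne, nac⟩) (by simpa using nrs) (by simpa using nrd)
      (by simpa using ⟨hrb, hrc.ne⟩) (by simpa using hsd.ne) (by simpa using ⟨hsb.ne, hsc⟩)
      (by simpa using ⟨nbd.symm, hcd.ne.symm⟩) (by simpa using hra.symm) (by simpa) (by simpa)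
      ⟨b, by simp, a, rfl, hab.symm⟩ ⟨c, by simp, r, rfl, hrc.symm⟩ ⟨b, by simp, s, rfl, hsb.symm⟩
      ⟨c, by simp, d, rfl, hcd⟩ (by simpa [adj_comm] using hsa) (by simpa) (by simpa)).elim
  by_cases hbr : G.Adj b r
  · by_cases hcs : G.Adj c s
    · exact (hG.false_of_bags (A := {a}) (B := {r}) (C := {c}) (D := {s}) (H := {b})
        (conn_singleton _) (conn_singleton _) (conn_singleton _) (conn_singleton _)
        (conn_singleton _) (by simpa using hra.ne.symm) (by simpa using nac)
        (by simpa using nsa.symm) (by simpa using hab.ne) (by simpa using hrc.ne)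
        (by simpa using nrs) (by simpa using hrb) (by simpa using hcs.ne)
        (by simpa using hbc.ne.symm) (by simpa using hsb.ne) (by simpa using hra.symm) (by simpa)
        (by simpa) (by simpa using hab.symm) (by simpa) (by simpa) (by simpa using hsb.symm)
        (by simpa) (by simpa [adj_comm] using hsa) (by simpa)).elim
    · refine ⟨_, _, {a, r}, conf4 (indPath4 hcd hsd.symm hsb hcs (fun h => hbd h.symm) hsc.symm
        nbd.symm hbc.ne.symm) (conn_pair hra.symm) ?_ ?_ ?_ ?_ ⟨c, rfl, r, by simp, hrc.symm⟩
        ⟨b, rfl, a, by simp, hab.symm⟩ ?_ ?_⟩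
      · simpa using ⟨nac.symm, hrc.ne.symm⟩
      · simpa using ⟨nad.symm, nrd.symm⟩
      · simpa using ⟨nsa, nrs.symm⟩
      · simpa using ⟨hab.ne.symm, hrb.symm⟩
      · rintro ⟨_, rfl, _, rfl | rfl, h⟩
        exacts [had h.symm, hrd h.symm]
      · rintro ⟨_, rfl, _, rfl | rfl, h⟩
        exacts [hsa h, hrs h.symm]
  · refine ⟨_, _, {d, s}, conf4 (indPath4 hab.symm hra.symm hrc hbr hac hrb.symm
      nac hbc.ne) (conn_pair hsd.symm) ?_ ?_ ?_ ?_ ⟨b, rfl, s, by simp, hsb.symm⟩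
      ⟨c, rfl, d, by simp, hcd⟩ ?_ ?_⟩
    · simpa using ⟨nbd, hsb.ne.symm⟩
    · simpa using ⟨nad, nsa.symm⟩
    · simpa using ⟨nrd, nrs⟩
    · simpa using ⟨hcd.ne, hsc.symm⟩
    · rintro ⟨_, rfl, _, rfl | rfl, h⟩
      exacts [had h, hsa h.symm]
    · rintro ⟨_, rfl, _, rfl | rfl, h⟩
      exacts [hrd h, hrs h]

end Conf
-- Attaching a set to a long chorded path.
section ChordPath

variable {V : Type*} {G : SimpleGraph V}

theorem compIn_separated {S : Set V} {u w : V} (hwu : w ∉ G.compIn S u) :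
    Disjoint (G.compIn S w) (G.compIn S u) ∧ ¬ G.Touch (G.compIn S w) (G.compIn S u) := by
  have key : ∀ x ∈ G.compIn S w, x ∉ G.compIn S u := by
    intro x hx
    refine hx.2 {x | x ∉ G.compIn S u} hwu ?_
    exact fun a ha haT b _ hab hb => haT (compIn_closed hb ha hab.symm)
  refine ⟨Set.disjoint_left.2 key, ?_⟩
  rintro ⟨a, ha, b, hb, hab⟩
  exact key b (compIn_closed ha hb.1 hab) hb

/-- An induced path of length at least three whose ends lie in adjacent connected sets `X` and `Y`,
and a connected set `K` that touches `X` and `Y` but not the interior of the path. -/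
structure ChordPath (G : SimpleGraph V) (p : ℕ → V) (k : ℕ) (X Y K : Set V) : Prop where
  path : IndPath G p (k + 1)
  two_le : 2 ≤ k
  cX : G.Conn X
  cY : G.Conn Y
  cK : G.Conn K
  memX : p 0 ∈ X
  memY : p (k + 1) ∈ Y
  dXY : Disjoint X Y
  dXK : Disjoint X K
  dYK : Disjoint Y K
  notX : ∀ i, 0 < i → i ≤ k → p i ∉ X
  notY : ∀ i, 0 < i → i ≤ k → p i ∉ Y
  notK : ∀ i, 0 < i → i ≤ k → p i ∉ K
  tXY : G.Touch X Y
  tXK : G.Touch X K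
  tYK : G.Touch Y K
  nX : ∀ i, 1 < i → i ≤ k → ¬ G.Touch X {p i}
  nY : ∀ i, 0 < i → i < k → ¬ G.Touch Y {p i}
  nK : ∀ i, 0 < i → i ≤ k → ¬ G.Touch K {p i}

theorem touch_seg_iff {p : ℕ → V} {i j : ℕ} {U : Set V} :
    G.Touch U (seg p i j) ↔ ∃ t, i ≤ t ∧ t ≤ j ∧ G.Touch U {p t} := by
  constructor
  · rintro ⟨a, ha, _, ⟨t, ⟨h1, h2⟩, rfl⟩, h⟩
    exact ⟨t, h1, h2, a, ha, _, rfl, h⟩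
  · rintro ⟨t, h1, h2, a, ha, _, rfl, h⟩
    exact ⟨a, ha, _, mem_seg_of_le h1 h2, h⟩

theorem disjoint_seg_iff {p : ℕ → V} {i j : ℕ} {U : Set V} :
    Disjoint U (seg p i j) ↔ ∀ t, i ≤ t → t ≤ j → p t ∉ U := by
  rw [Set.disjoint_right]
  constructor
  · exact fun h t h1 h2 => h (mem_seg_of_le h1 h2)
  · rintro h _ ⟨t, ⟨h1, h2⟩, rfl⟩
    exact h t h1 h2

/-- Contracting the two halves of the interior, cut after position `s`, leaves the pattern of
`chord_check`. The freedom in `s` lets single vertices be isolated. -/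
theorem ChordPath.chordBags {p : ℕ → V} {k : ℕ} {X Y K : Set V} (h : ChordPath G p k X Y K)
    {s : ℕ} (hs : 0 < s) (hsk : s < k) :
    ChordBags G X Y K (seg p 1 s) (seg p (s + 1) k) := by
  have hk := h.two_le
  refine ⟨h.cX, h.cY, h.cK, h.path.conn_seg (by omega) (by omega),
    h.path.conn_seg (by omega) (by omega), h.dXY, h.dXK, ?_, ?_, h.dYK, ?_, ?_, ?_, ?_,
    h.path.disjoint_seg (by omega) (by omega), h.tXY, h.tXK, ?_, h.tYK, ?_,
    h.path.touch_seg (by omega) (by omega) (by omega), ?_, ?_, ?_, ?_⟩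
  · exact disjoint_seg_iff.2 fun t h1 h2 => h.notX t (by omega) (by omega)
  · exact disjoint_seg_iff.2 fun t h1 h2 => h.notX t (by omega) (by omega)
  · exact disjoint_seg_iff.2 fun t h1 h2 => h.notY t (by omega) (by omega)
  · exact disjoint_seg_iff.2 fun t h1 h2 => h.notY t (by omega) (by omega)
  · exact disjoint_seg_iff.2 fun t h1 h2 => h.notK t (by omega) (by omega)
  · exact disjoint_seg_iff.2 fun t h1 h2 => h.notK t (by omega) (by omega)
  · exact ⟨p 0, h.memX, p 1, mem_seg_of_le le_rfl (by omega), h.path.adj 0 (by omega)⟩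
  · exact ⟨p (k + 1), h.memY, p k, mem_seg_of_le (by omega) le_rfl,
      (h.path.adj k (by omega)).symm⟩
  all_goals
    rw [touch_seg_iff]
    rintro ⟨t, h1, h2, ht⟩
  · exact h.nX t (by omega) (by omega) ht
  · exact h.nY t (by omega) (by omega) ht
  · exact h.nK t (by omega) (by omega) ht
  · exact h.nK t (by omega) (by omega) ht

/-- A connected set that touches the interior of the path of a `ChordPath` and something else
touches `K` and both ends of the interior, but neither `X` nor `Y`. -/
theorem GemFree.touch_of_chordPath (hG : G.GemFree) {p : ℕ → V} {k : ℕ} {X Y K U : Set V}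
    (h : ChordPath G p k X Y K) (hU : G.Conn U) (dX : Disjoint X U) (dY : Disjoint Y U)
    (dK : Disjoint K U) (dp : ∀ i, 0 < i → i ≤ k → p i ∉ U) {i : ℕ} (hi : 0 < i) (hik : i ≤ k)
    (ti : G.Touch U {p i}) (ht : G.Touch U X ∨ G.Touch U Y ∨ G.Touch U K ∨
      ∃ j, 0 < j ∧ j ≤ k ∧ j ≠ i ∧ G.Touch U {p j}) :
    ¬ G.Touch U X ∧ ¬ G.Touch U Y ∧ G.Touch U K ∧ G.Touch U {p 1} ∧ G.Touch U {p k} := by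
  have hk := h.two_le
  -- For a given cut `s`, whichever half contains the contact `p i` plays the role of `Q₁`; the
  -- symmetric form of the bags covers the right half.
  have key : ∀ s, 0 < s → s < k → (G.Touch U X ∨ G.Touch U Y ∨ G.Touch U K ∨
      G.Touch U (seg p 1 s) ∧ G.Touch U (seg p (s + 1) k)) →
      (¬ G.Touch U X ∧ ¬ G.Touch U Y ∧ G.Touch U K) ∧ G.Touch U (seg p 1 s) ∧
        G.Touch U (seg p (s + 1) k) := by
    intro s hs hsk hor
    have hb := h.chordBags hs hsk
    have d1 : Disjoint (seg p 1 s) U :=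
      (disjoint_seg_iff.2 fun t h1 h2 => dp t (by omega) (by omega)).symm
    have d2 : Disjoint (seg p (s + 1) k) U :=
      (disjoint_seg_iff.2 fun t h1 h2 => dp t (by omega) (by omega)).symm
    rcases Nat.lt_or_ge s i with hsi | hsi
    · have ht2 : G.Touch U (seg p (s + 1) k) := touch_seg_iff.2 ⟨i, by omega, hik, ti⟩
      have := hG.touch_of_chordBags hb.symm hU dY dX dK d2 d1 ht2 (by tauto)
      tauto
    · have ht1 : G.Touch U (seg p 1 s) := touch_seg_iff.2 ⟨i, by omega, hsi, ti⟩
      have := hG.touch_of_chordBags hb hU dX dY dK d1 d2 ht1 (by tauto)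
      tauto
  have hfirst : ¬ G.Touch U X ∧ ¬ G.Touch U Y ∧ G.Touch U K := by
    by_cases hXYK : G.Touch U X ∨ G.Touch U Y ∨ G.Touch U K
    · exact (key 1 one_pos (by omega) (by tauto)).1
    · obtain ⟨j, hj, hjk, hji, tj⟩ : ∃ j, 0 < j ∧ j ≤ k ∧ j ≠ i ∧ G.Touch U {p j} := by
        rcases ht with h | h | h | h
        exacts [absurd (Or.inl h) hXYK, absurd (Or.inr (Or.inl h)) hXYK,
          absurd (Or.inr (Or.inr h)) hXYK, h]
      rcases lt_or_gt_of_ne hji with hlt | hlt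
      · exact (key j hj (by omega) (Or.inr (Or.inr (Or.inr
          ⟨touch_seg_iff.2 ⟨j, by omega, le_rfl, tj⟩,
            touch_seg_iff.2 ⟨i, by omega, hik, ti⟩⟩)))).1
      · exact (key i hi (by omega) (Or.inr (Or.inr (Or.inr
          ⟨touch_seg_iff.2 ⟨i, by omega, le_rfl, ti⟩,
            touch_seg_iff.2 ⟨j, by omega, hjk, tj⟩⟩)))).1
  -- The contact with `K` now permits every cut; the first and the last cut isolate `p 1` and `p k`.
  refine ⟨hfirst.1, hfirst.2.1, hfirst.2.2, ?_, ?_⟩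
  · have := (key 1 one_pos (by omega) (by tauto)).2.1
    rwa [seg_self] at this
  · have := (key (k - 1) (by omega) (by omega) (by tauto)).2.2
    rwa [show k - 1 + 1 = k by omega, seg_self] at this

end ChordPath

/-! ### Which vertices of a hole have neighbors outside it. -/

section Hole

variable {V : Type*} {G : SimpleGraph V}

/-- `c` runs periodically around an induced cycle of length `n ≥ 5`. -/
structure IsHole (G : SimpleGraph V) (n : ℕ) (c : ℕ → V) : Prop where
  five_le : 5 ≤ n
  period : ∀ i, c (i + n) = c i
  ne : ∀ i d, 0 < d → d < n → c i ≠ c (i + d)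
  adj : ∀ i, G.Adj (c i) (c (i + 1))
  not_adj : ∀ i d, 1 < d → d + 1 < n → ¬ G.Adj (c i) (c (i + d))

namespace IsHole

variable {n : ℕ} {c : ℕ → V}

theorem indPath (h : IsHole G n c) (o : ℕ) {m : ℕ} (hm : m < n) :
    IndPath G (fun i => c (o + i)) m := by
  refine ⟨fun i j hij hj => ?_, fun i _ => h.adj (o + i), fun i j hij hj h' => ?_⟩
  · have := h.ne (o + i) (j - i) (by omega) (by omega)
    rwa [show o + i + (j - i) = o + j by omega] at this
  · have := h.not_adj (o + i) (j - i) (by omega) (by omega)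
    rwa [show o + i + (j - i) = o + j by omega] at this

theorem period_mul (h : IsHole G n c) (i k : ℕ) : c (i + n * k) = c i := by
  induction k with
  | zero => rfl
  | succ k ih => rw [Nat.mul_succ, ← add_assoc, h.period, ih]

theorem exists_eq (h : IsHole G n c) (o t : ℕ) : ∃ i, i < n ∧ c t = c (o + i) := by
  have hn := h.five_le
  have h1 := Nat.mod_lt (t + n * o - o) (show 0 < n by omega)
  refine ⟨(t + n * o - o) % n, h1, ?_⟩
  have h2 := Nat.mod_add_div (t + n * o - o) n
  have h3 : o ≤ n * o := Nat.le_mul_of_pos_left o (by omega)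
  rw [← h.period_mul t o, ← h.period_mul (o + _) ((t + n * o - o) / n)]
  congr 1
  omega

/-- A connected set off the hole that touches a vertex of the hole touches at most one vertex of
the hole which is not adjacent to it. -/
theorem false_of_touch (hG : G.GemFree) (h : IsHole G n c) {U : Set V} (hU : G.Conn U)
    (hd : ∀ t, c t ∉ U) {o i j : ℕ} (hi : 2 ≤ i) (hij : i < j) (hj : j + 2 ≤ n)
    (t0 : G.Touch U {c o}) (ti : G.Touch U {c (o + i)}) (tj : G.Touch U {c (o + j)}) : False := by
  have hn := h.five_le
  -- The hub is `c o` with `U`: on the path that remains of the hole, `c o` sees both ends and `U`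
  -- sees two inner vertices.
  refine hG.false_of_hub (h.indPath (o + 1) (m := n - 2) (by omega))
    ((conn_singleton (c o)).union hU t0.symm) (i₁ := 0) (i₂ := i - 1) (i₃ := j - 1)
    (i₄ := n - 2) (by omega) (by omega) (by omega) le_rfl (Or.inr (Or.inr ?_)) ?_ ?_ ?_ ?_ ?_
  · exact h.not_adj (o + 1) (n - 2) (by omega) (by omega)
  · rintro t - ht (e | e)
    · refine h.ne o (1 + t) (by omega) (by omega) ?_
      rw [← add_assoc]
      exact e.symm
    · exact hd _ e
  · exact touch_union_left.2 (Or.inl ⟨c o, rfl, _, rfl, h.adj o⟩)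
  · refine touch_union_left.2 (Or.inr ?_)
    rwa [show o + 1 + (i - 1) = o + i by omega]
  · refine touch_union_left.2 (Or.inr ?_)
    rwa [show o + 1 + (j - 1) = o + j by omega]
  · refine touch_union_left.2 (Or.inl ⟨c o, rfl, _, rfl, ?_⟩)
    have := h.adj (o + (n - 1))
    rw [show o + (n - 1) + 1 = o + n by omega, h.period] at this
    rw [show o + 1 + (n - 2) = o + (n - 1) by omega]
    exact this.symm

/-- With a third contact on the far arc, `false_of_touch` applies around `c o`, or around `c (o +
j)` if that contact is the hole neighbor of `c o`. The far arc has at least two inner vertices, so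
the latter is then not adjacent to the contact. -/
theorem not_touch_arc (hG : G.GemFree) (h : IsHole G n c) {U : Set V} (hU : G.Conn U)
    (hd : ∀ t, c t ∉ U) {o j : ℕ} (hj : 2 ≤ j) (hjn : j + 3 ≤ n)
    (t0 : G.Touch U {c o}) (tj : G.Touch U {c (o + j)}) {i : ℕ} (hji : j < i) (hin : i < n) :
    ¬ G.Touch U {c (o + i)} := by
  intro ti
  rcases Nat.lt_or_ge (i + 1) n with h1 | h1
  · exact h.false_of_touch hG hU hd hj hji (by omega) t0 tj ti
  · refine h.false_of_touch hG hU hd (o := o + j) (i := i - j) (j := n - j) (by omega) (by omega)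
      (by omega) tj ?_ ?_
    · rwa [show o + j + (i - j) = o + i by omega]
    · rwa [show o + j + (n - j) = o + n by omega, h.period]

/-- The far arc is the path, `U` is contracted into the end `c o` to make the ends adjacent, and the
interior of the near arc plays the role of `K`. -/
theorem chordPath (hG : G.GemFree) (h : IsHole G n c) {U : Set V} (hU : G.Conn U)
    (hd : ∀ t, c t ∉ U) {o j : ℕ} (hj : 2 ≤ j) (hjn : j + 3 ≤ n)
    (t0 : G.Touch U {c o}) (tj : G.Touch U {c (o + j)}) :
    ChordPath G (fun t => c (o + j + t)) (n - j - 1) {c (o + j)} ({c o} ∪ U)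
      (seg c (o + 1) (o + j - 1)) := by
  have hp := h.indPath (o + j) (m := n - j) (by omega)
  have hlast : c (o + j + (n - j)) = c o := by
    rw [show o + j + (n - j) = o + n by omega, h.period]
  have hoff : ∀ t, o + j + t = o + (j + t) := fun t => by omega
  refine ⟨by rwa [show n - j - 1 + 1 = n - j by omega], by omega, conn_singleton _,
    (conn_singleton _).union hU t0.symm, conn_seg (by omega) fun t _ _ => h.adj t, rfl,
    Or.inl ?_, ?_, ?_, ?_, ?_, ?_, ?_, ?_, ?_, ?_, ?_, ?_, ?_⟩
  · rw [show n - j - 1 + 1 = n - j by omega, hlast]; rfl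
  · rw [Set.disjoint_singleton_left]
    rintro (e | e)
    · exact h.ne o j (by omega) (by omega) e.symm
    · exact hd _ e
  · rw [disjoint_seg_iff]
    intro t h1 h2 e
    refine h.ne t (o + j - t) (by omega) (by omega) ?_
    rw [show t + (o + j - t) = o + j by omega]
    exact e
  · rw [disjoint_seg_iff]
    rintro t h1 h2 (e | e)
    · refine h.ne o (t - o) (by omega) (by omega) ?_
      rw [show o + (t - o) = t by omega]
      exact e.symm
    · exact hd _ e
  · intro i hi hik e
    exact h.ne (o + j) i hi (by omega) e.symm
  · rintro i hi hik (e | e)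
    · refine h.ne o (j + i) (by omega) (by omega) ?_
      rw [← hoff]; exact e.symm
    · exact hd _ e
  · rintro i hi hik ⟨t, ⟨h1, h2⟩, e⟩
    refine h.ne t (o + j + i - t) (by omega) (by omega) ?_
    rw [show t + (o + j + i - t) = o + j + i by omega]
    exact e
  · exact touch_union_right.2 (Or.inr tj.symm)
  · refine ⟨_, rfl, c (o + j - 1), mem_seg_of_le (by omega) le_rfl, ?_⟩
    have := h.adj (o + j - 1)
    rw [show o + j - 1 + 1 = o + j by omega] at this
    exact this.symm
  · exact ⟨c o, Or.inl rfl, c (o + 1), mem_seg_of_le le_rfl (by omega), h.adj o⟩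
  · intro i hi hik
    rw [touch_singleton_singleton]
    exact h.not_adj (o + j) i hi (by omega)
  · intro i hi hik ht
    rcases touch_union_left.1 ht with ht | ht
    · rw [touch_singleton_singleton, hoff] at ht
      exact h.not_adj o (j + i) (by omega) (by omega) ht
    · rw [hoff] at ht
      exact h.not_touch_arc hG hU hd hj hjn t0 tj (by omega) (by omega) ht
  · intro i hi hik ht
    obtain ⟨t, h1, h2, ht⟩ := touch_seg_iff.1 ht.symm
    rw [touch_singleton_singleton] at ht
    refine h.not_adj t (o + j + i - t) (by omega) (by omega) ?_
    rw [show t + (o + j + i - t) = o + j + i by omega]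
    exact ht.symm

/-- By `touch_of_chordPath`, `U'` would see the near arc and both ends of the interior of the far
arc, three vertices that contradict `false_of_touch`. -/
theorem not_touch_arc' (hG : G.GemFree) (h : IsHole G n c) {U U' : Set V} (hU : G.Conn U)
    (hd : ∀ t, c t ∉ U) (hU' : G.Conn U') (hd' : ∀ t, c t ∉ U') (hUU' : Disjoint U U')
    {o j : ℕ} (hj : 2 ≤ j) (hjn : j + 3 ≤ n)
    (t0 : G.Touch U {c o}) (tj : G.Touch U {c (o + j)}) {i : ℕ} (hji : j < i) (hin : i < n)
    (hother : ∃ t, c t ≠ c (o + i) ∧ G.Touch U' {c t}) :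
    ¬ G.Touch U' {c (o + i)} := by
  intro ti
  have hc := h.chordPath hG hU hd hj hjn t0 tj
  have hi : o + j + (i - j) = o + i := by omega
  have hres := hG.touch_of_chordPath hc hU'
    (Set.disjoint_singleton_left.2 (hd' _))
    (Set.disjoint_union_left.2 ⟨Set.disjoint_singleton_left.2 (hd' _), hUU'⟩)
    (disjoint_seg_iff.2 fun t _ _ => hd' t).symm (fun t _ _ => hd' _) (i := i - j) (by omega)
    (by omega) (by rwa [hi]) (by
      obtain ⟨t, hne, ht⟩ := hother
      obtain ⟨s, hs, e⟩ := h.exists_eq o t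
      rw [e] at ht hne
      rcases Nat.eq_zero_or_pos s with rfl | hs0
      · exact Or.inr (Or.inl (touch_union_right.2 (Or.inl ht)))
      rcases lt_trichotomy s j with hsj | rfl | hsj
      · exact Or.inr (Or.inr (Or.inl (touch_seg_iff.2 ⟨o + s, by omega, by omega, ht⟩)))
      · exact Or.inl ht
      · refine Or.inr (Or.inr (Or.inr ⟨s - j, by omega, by omega, ?_, ?_⟩))
        · rintro e'
          exact hne (by rw [show s = i by omega])
        · rwa [show o + j + (s - j) = o + s by omega])
  obtain ⟨-, -, hK, h1, hk⟩ := hres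
  obtain ⟨s, hs1, hs2, hs⟩ := touch_seg_iff.1 hK
  refine h.false_of_touch hG hU' hd' (o := s) (i := o + j + 1 - s) (j := o + n - 1 - s) (by omega)
    (by omega) (by omega) hs ?_ ?_
  · rwa [show s + (o + j + 1 - s) = o + j + 1 by omega]
  · rwa [show s + (o + n - 1 - s) = o + j + (n - j - 1) by omega]

/-- The vertices of a hole with neighbors off the hole are just two vertices, or two vertices with
a common neighbor in the hole, together with this neighbor. -/
theorem attached (hG : G.GemFree) (h2 : G.TwoConn) (h : IsHole G n c) :
    (∀ t, ∀ u ∉ Set.range c, ¬ G.Adj (c t) u) ∨ ∃ o j, 1 ≤ j ∧ j + 3 ≤ n ∧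
      (∃ u ∉ Set.range c, G.Adj (c o) u) ∧ (∃ u ∉ Set.range c, G.Adj (c (o + j)) u) ∧
      ∀ i, i < n → (∃ u ∉ Set.range c, G.Adj (c (o + i)) u) →
        i = 0 ∨ i = j ∨ (j = 2 ∧ i = 1) := by
  have hn := h.five_le
  set R : Set V := (Set.range c)ᶜ with hR
  have hcR : ∀ u t, c t ∉ G.compIn R u := fun u t ht => ht.1 ⟨t, rfl⟩
  -- By 2-connectivity, a component off the hole has contacts with at least two vertices of the
  -- hole.
  have htwo : ∀ u ∈ R, ∀ t, ∃ s, c s ≠ c t ∧ G.Touch (G.compIn R u) {c s} := by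
    intro u hu t
    obtain ⟨a, ha, b, hb, hbt, hab⟩ := h2.exists_adj (conn_compIn hu).1 (hcR u t) (hcR u (t + 1))
      (h.adj t).ne.symm
    by_cases hbR : b ∈ R
    · exact absurd (compIn_closed ha hbR hab) hb
    · rw [hR, Set.mem_compl_iff, not_not] at hbR
      obtain ⟨s, rfl⟩ := hbR
      exact ⟨s, hbt, a, ha, _, rfl, hab⟩
  have htouch : ∀ t u, u ∈ R → G.Adj (c t) u → G.Touch (G.compIn R u) {c t} := fun t u hu htu =>
    ⟨u, mem_compIn_self hu, _, rfl, htu.symm⟩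
  have htouch' : ∀ t u, G.Touch (G.compIn R u) {c t} → ∃ w ∉ Set.range c, G.Adj (c t) w := by
    rintro t u ⟨w, hw, _, rfl, hwt⟩
    exact ⟨w, hw.1, hwt.symm⟩
  by_cases hex : ∃ t, ∃ u ∉ Set.range c, G.Adj (c t) u
  swap
  · push Not at hex
    exact Or.inl hex
  right
  obtain ⟨t₀, u₀, hu₀, htu₀⟩ := hex
  have hU := conn_compIn (G := G) (S := R) hu₀
  have hd := hcR u₀
  by_cases hA : ∃ o d, 2 ≤ d ∧ d + 2 ≤ n ∧ G.Touch (G.compIn R u₀) {c o} ∧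
    G.Touch (G.compIn R u₀) {c (o + d)}
  · obtain ⟨o, j, hj, hjn, t0, tj⟩ : ∃ o d, 2 ≤ d ∧ d + 3 ≤ n ∧ G.Touch (G.compIn R u₀) {c o} ∧
        G.Touch (G.compIn R u₀) {c (o + d)} := by
      obtain ⟨o, d, hd2, hdn, t0, td⟩ := hA
      rcases Nat.lt_or_ge (d + 2) n with h1 | h1
      · exact ⟨o, d, hd2, h1, t0, td⟩
      · refine ⟨o + d, 2, le_rfl, by omega, td, ?_⟩
        rwa [show o + d + 2 = o + n by omega, h.period]
    have harc : ∀ o j, 2 ≤ j → j + 3 ≤ n → G.Touch (G.compIn R u₀) {c o} →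
        G.Touch (G.compIn R u₀) {c (o + j)} → ∀ i, j < i → i < n →
        ¬ ∃ u ∉ Set.range c, G.Adj (c (o + i)) u := by
      rintro o j hj hjn t0 tj i hji hin ⟨u, hu, hiu⟩
      by_cases hmem : u ∈ G.compIn R u₀
      · exact h.not_touch_arc hG hU hd hj hjn t0 tj hji hin ⟨u, hmem, _, rfl, hiu.symm⟩
      · exact h.not_touch_arc' hG hU hd (conn_compIn hu) (hcR u) (compIn_separated hmem).1.symm
          hj hjn t0 tj hji hin (htwo u hu _) (htouch _ u hu hiu)
    refine ⟨o, j, by omega, hjn, htouch' _ _ t0, htouch' _ _ tj, fun i hin hi => ?_⟩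
    by_contra hcon
    rcases Nat.lt_or_ge j i with hji | hij
    · exact harc o j hj hjn t0 tj i hji hin hi
    -- An attached vertex inside the near arc forces `j ≥ 3` here, so the arcs can exchange roles.
    · refine harc (o + j) (n - j) (by omega) (by omega) tj ?_ (i + (n - j)) (by omega) (by omega) ?_
      · rwa [show o + j + (n - j) = o + n by omega, h.period]
      · rwa [show o + j + (i + (n - j)) = o + i + n by omega, h.period]
  · push Not at hA
    obtain ⟨o, t0, t1⟩ : ∃ o, G.Touch (G.compIn R u₀) {c o} ∧
        G.Touch (G.compIn R u₀) {c (o + 1)} := by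
      have ht₀ := htouch t₀ u₀ hu₀ htu₀
      obtain ⟨s, hs, ts⟩ := htwo u₀ hu₀ t₀
      obtain ⟨d, hdn, e⟩ := h.exists_eq t₀ s
      rw [e] at ts hs
      rcases Nat.lt_or_ge d 2 with h1 | h1
      · have : d ≠ 0 := by rintro rfl; exact hs rfl
        have : d = 1 := by omega
        subst this
        exact ⟨t₀, ht₀, ts⟩
      · have : d = n - 1 := by
          by_contra hne
          exact hA t₀ d h1 (by omega) ht₀ ts
        subst this
        refine ⟨t₀ + (n - 1), ts, ?_⟩
        rwa [show t₀ + (n - 1) + 1 = t₀ + n by omega, h.period]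
    refine ⟨o, 1, le_rfl, by omega, htouch' _ _ t0, htouch' _ _ t1, ?_⟩
    rintro i hin ⟨u, hu, hiu⟩
    by_contra hcon
    have hi2 : 2 ≤ i := by omega
    have hti := htouch _ u hu hiu
    by_cases hmem : u ∈ G.compIn R u₀
    · have hti' : G.Touch (G.compIn R u₀) {c (o + i)} := ⟨u, hmem, _, rfl, hiu.symm⟩
      rcases Nat.lt_or_ge (i + 1) n with h1 | h1
      · exact hA o i hi2 (by omega) t0 hti'
      · refine hA (o + 1) (n - 2) (by omega) (by omega) t1 ?_
        rwa [show o + 1 + (n - 2) = o + i by omega]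
    · have hsep := compIn_separated hmem
      have hp := h.indPath (o + 1) (m := n - 1) (by omega)
      have hlast : c (o + 1 + (n - 1)) = c o := by
        rw [show o + 1 + (n - 1) = o + n by omega, h.period]
      have hno : ∀ t, 2 ≤ t → t < n → ¬ G.Touch (G.compIn R u₀) {c (o + t)} := by
        intro t ht htn tt
        rcases Nat.lt_or_ge (t + 1) n with h1 | h1
        · exact hA o t ht (by omega) t0 tt
        · refine hA (o + 1) (n - 2) (by omega) (by omega) t1 ?_
          rwa [show o + 1 + (n - 2) = o + t by omega]
      -- The component has just two adjacent contacts, so the way around the hole is a chorded path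
      -- with the component as `K`. Another component attached to its interior would have to touch
      -- this one.
      have hc : ChordPath G (fun t => c (o + 1 + t)) (n - 2) {c (o + 1)} {c o}
          (G.compIn R u₀) := by
        refine ⟨by rwa [show n - 2 + 1 = n - 1 by omega], by omega, conn_singleton _,
          conn_singleton _, hU, rfl, ?_, ?_, ?_, ?_, ?_, ?_, ?_, ?_, ?_, ?_, ?_, ?_, ?_⟩
        · rw [show n - 2 + 1 = n - 1 by omega, hlast]; rfl
        · simpa using (h.adj o).ne.symm
        · simpa using hd _
        · simpa using hd _
        · intro t ht htn e
          exact h.ne (o + 1) t ht (by omega) e.symm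
        · intro t ht htn e
          refine h.ne o (1 + t) (by omega) (by omega) ?_
          rw [← add_assoc]; exact e.symm
        · exact fun t _ _ => hd _
        · simpa using (h.adj o).symm
        · exact t1.symm
        · exact t0.symm
        · intro t ht htn
          rw [touch_singleton_singleton]
          exact h.not_adj (o + 1) t ht (by omega)
        · intro t ht htn
          rw [touch_singleton_singleton, add_assoc]
          exact h.not_adj o (1 + t) (by omega) (by omega)
        · intro t ht htn
          rw [add_assoc]
          exact hno (1 + t) (by omega) (by omega)
      have := hG.touch_of_chordPath hc (conn_compIn hu) (Set.disjoint_singleton_left.2 (hcR _ _))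
        (Set.disjoint_singleton_left.2 (hcR _ _)) hsep.1.symm (fun t _ _ => hcR _ _) (i := i - 1)
        (by omega) (by omega) (by rwa [show o + 1 + (i - 1) = o + i by omega]) (by
          obtain ⟨s, hs, ts⟩ := htwo u hu (o + i)
          obtain ⟨d, hdn, e⟩ := h.exists_eq o s
          rw [e] at ts hs
          rcases Nat.lt_or_ge d 2 with h1 | h1
          · interval_cases d
            · exact Or.inr (Or.inl ts)
            · exact Or.inl ts
          · refine Or.inr (Or.inr (Or.inr ⟨d - 1, by omega, by omega, ?_, ?_⟩))
            · intro e'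
              exact hs (by rw [show d = i by omega])
            · rwa [show o + 1 + (d - 1) = o + d by omega])
      exact hsep.2 this.2.2.1

end IsHole

end Hole
-- A 2-connected gem-free graph with a prism model has at most six vertices.
section Prism

variable {V : Type*} {G : SimpleGraph V}

theorem Conn.diff_compIn {B : Set V} (hB : G.Conn B) {r s : V} (hr : r ∈ B) :
    G.Conn (B \ G.compIn (B \ {r}) s) := by
  refine conn_of_root (u := r) ⟨hr, fun h => h.1.2 rfl⟩ fun X hX hcl => ?_
  have := hB.2 (X ∪ G.compIn (B \ {r}) s) ⟨r, hr, Or.inl hX⟩ ?_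
  · exact fun x hx => (this hx.1).resolve_right hx.2
  · intro a ha haX b hb hab
    by_cases hbS : b ∈ G.compIn (B \ {r}) s
    · exact Or.inr hbS
    left
    by_cases haS : a ∈ G.compIn (B \ {r}) s
    · by_cases hbr : b = r
      · exact hbr ▸ hX
      · exact absurd (compIn_closed haS ⟨hb, hbr⟩ hab) hbS
    · exact hcl a ⟨ha, haS⟩ (haX.resolve_right haS) b ⟨hb, hbS⟩ hab

/-- In a larger bag, let `r` be a vertex with a neighbor in another bag. By 2-connectivity a
component of the bag without `r` also has a neighbor outside the bag. So the bag splits into two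
connected pieces with outside contacts, contrary to `prism_not_split`. -/
theorem GemFree.prism_bag_subsingleton (hG : G.GemFree) (h2 : G.TwoConn) {b : Fin 6 → Set V}
    (hb : IsModel prism G b) (hu : ∀ v, ∃ i, v ∈ b i) (i : Fin 6) : (b i).Subsingleton := by
  by_contra hns
  obtain ⟨j, hij⟩ : ∃ j, prism.Adj i j := by
    clear hns; revert i; decide
  obtain ⟨r, hr, y, hy, hry⟩ := (hb.touch i j hij.ne).1 hij
  obtain ⟨s, hs, hsr⟩ := (Set.not_subsingleton_iff.1 hns).exists_ne r
  have hsm : s ∈ b i \ {r} := ⟨hs, hsr⟩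
  have hsub : G.compIn (b i \ {r}) s ⊆ b i := fun x hx => hx.1.1
  have hrS : r ∉ G.compIn (b i \ {r}) s := fun h => h.1.2 rfl
  obtain ⟨a, ha, c, hc, hcr, hac⟩ := h2.exists_adj (conn_compIn (G := G) hsm).1 hrS
    (fun h => Set.disjoint_left.1 (hb.disj i j hij.ne) (hsub h) hy) hry.ne.symm
  refine hG.prism_not_split hb (conn_compIn hsm) ((hb.conn i).diff_compIn hr)
    Set.disjoint_sdiff_right (Set.union_sdiff_cancel hsub).symm ?_ ?_ ⟨j, hij.ne.symm, r,
      ⟨hr, hrS⟩, y, hy, hry⟩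
  · by_contra hnt
    have := (hb.conn i).2 (G.compIn (b i \ {r}) s) ⟨s, hs, mem_compIn_self hsm⟩
      fun a _ ha c hc hac => by
        by_contra hcS
        exact hnt ⟨a, ha, c, ⟨hc, hcS⟩, hac⟩
    exact hrS (this hr)
  · obtain ⟨t, ht⟩ := hu c
    refine ⟨t, ?_, a, ha, c, ht, hac⟩
    rintro rfl
    exact hc (compIn_closed ha ⟨ht, hcr⟩ hac)

/-- A model of the prism that covers as many vertices as possible covers all vertices. -/
theorem GemFree.exists_prism_cover [Finite V] (hG : G.GemFree) (h2 : G.TwoConn)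
    {b : Fin 6 → Set V} (hb : IsModel prism G b) :
    ∃ b, IsModel prism G b ∧ ∀ v, ∃ i, v ∈ b i := by
  classical
  have : Nonempty {b : Fin 6 → Set V // IsModel prism G b} := ⟨⟨b, hb⟩⟩
  obtain ⟨⟨b, hb⟩, hmax⟩ := Finite.exists_max
    fun b : {b : Fin 6 → Set V // IsModel prism G b} => (⋃ i, b.1 i).ncard
  refine ⟨b, hb, ?_⟩
  by_contra! hcon
  obtain ⟨u, hu⟩ := hcon
  obtain ⟨x, hx⟩ := (hb.conn 0).1
  obtain ⟨y, hy⟩ := (hb.conn 1).1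
  have hxy : x ≠ y := by
    rintro rfl
    exact Set.disjoint_left.1 (hb.disj 0 1 (by decide)) hx hy
  set S : Set V := {v | ∀ i, v ∉ b i} with hS
  have huS : u ∈ S := hu
  obtain ⟨a, ha, c, hc, hcx, hac⟩ := h2.exists_adj (conn_compIn (G := G) huS).1
    (fun h => h.1 0 hx) (fun h => h.1 1 hy) hxy.symm
  obtain ⟨i, hi⟩ : ∃ i, c ∈ b i := by
    by_contra! hcS
    exact hc (compIn_closed ha hcS hac)
  set U := G.compIn S u
  have hU : G.Conn U := conn_compIn huS
  have hd : ∀ i, Disjoint (b i) U := fun i => Set.disjoint_right.2 fun v hv => hv.1 i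
  have hti : G.Touch (b i) U := ⟨c, hi, a, ha, hac.symm⟩
  have huniq : ∀ j, j ≠ i → ¬ G.Touch U (b j) := fun j hj h =>
    hj (hG.touch_prism_unique hb hU hd h.symm hti)
  -- An uncovered component touches exactly one bag and can be added to it without changing the
  -- pattern, against maximality.
  have hb' : IsModel prism G (Function.update b i (b i ∪ U)) := by
    refine ⟨fun j => ?_, fun j k hjk => ?_, fun j k hjk => ?_⟩
    · rcases eq_or_ne j i with rfl | hj
      · simpa using (hb.conn j).union hU hti
      · simpa [hj] using hb.conn j
    · rcases eq_or_ne j i with rfl | hj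
      · simpa [hjk.symm] using ⟨hb.disj j k hjk, (hd k).symm⟩
      · rcases eq_or_ne k i with rfl | hk
        · simpa [hj] using ⟨hb.disj j k hjk, hd j⟩
        · simpa [hj, hk] using hb.disj j k hjk
    · rcases eq_or_ne j i with rfl | hj
      · simp [hjk.symm, touch_union_left, huniq k hjk.symm, hb.touch j k hjk]
      · rcases eq_or_ne k i with rfl | hk
        · simp [hj, touch_union_right, touch_comm (T := U), huniq j hj, hb.touch j k hjk]
        · simpa [hj, hk] using hb.touch j k hjk
  have hlt : (⋃ j, b j).ncard < (⋃ j, Function.update b i (b i ∪ U) j).ncard := by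
    refine Set.ncard_lt_ncard ⟨Set.iUnion_mono fun j => ?_, fun h => ?_⟩
    · rcases eq_or_ne j i with rfl | hj
      · simp
      · simp [hj]
    · have := h (Set.mem_iUnion_of_mem i (by simpa using Or.inr (mem_compIn_self huS)))
      exact absurd (Set.mem_iUnion.1 this) (by simpa using hu)
  exact absurd (hmax ⟨_, hb'⟩) (not_le.2 hlt)

theorem GemFree.card_le_of_prism [Finite V] (hG : G.GemFree) (h2 : G.TwoConn)
    {b : Fin 6 → Set V} (hb : IsModel prism G b) : Nat.card V ≤ 6 := by
  obtain ⟨b, hb, hu⟩ := hG.exists_prism_cover h2 hb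
  choose f hf using hu
  have hinj : Function.Injective f := fun x y e =>
    hG.prism_bag_subsingleton h2 hb (fun v => ⟨f v, hf v⟩) (f x) (hf x) (e ▸ hf y)
  simpa using Nat.card_le_card_of_injective f hinj

end Prism

/-! ### From configurations to paths with inner vertices of degree two. -/

section Terminal

variable {V : Type*} {G : SimpleGraph V}

/-- A path of length at least three, without chords except possibly between its ends, whose inner
vertices have degree two; if its ends are not adjacent, they have at least two neighbors off the
path each. -/
structure Terminal (G : SimpleGraph V) (q : ℕ → V) (k : ℕ) : Prop where
  path : IndPath G q (k + 1)
  two_le : 2 ≤ k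
  inner : ∀ i, 0 < i → i ≤ k → ∀ u, G.Adj (q i) u → u = q (i - 1) ∨ u = q (i + 1)
  left : ¬ G.Adj (q 0) (q (k + 1)) → ∀ z, ∃ w ∉ seg q 0 (k + 1), w ≠ z ∧ G.Adj (q 0) w
  right : ¬ G.Adj (q 0) (q (k + 1)) → ∀ z, ∃ w ∉ seg q 0 (k + 1), w ≠ z ∧ G.Adj (q (k + 1)) w

theorem isHole_of_lt {n : ℕ} {c : ℕ → V} (hn : 5 ≤ n) (hne : ∀ i j, i < j → j < n → c i ≠ c j)
    (hadj : ∀ i, i + 1 < n → G.Adj (c i) (c (i + 1))) (hlast : G.Adj (c (n - 1)) (c 0))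
    (hno : ∀ i j, i + 1 < j → j < n → j - i + 1 < n → ¬ G.Adj (c i) (c j)) :
    IsHole G n fun t => c (t % n) := by
  have hmod : ∀ i d, d < n → ((i + d) % n = i % n + d ∧ i % n + d < n) ∨
      ((i + d) % n + n = i % n + d) := by
    intro i d hd
    have h1 := Nat.mod_lt i (show 0 < n by omega)
    rw [Nat.add_mod, Nat.mod_eq_of_lt hd]
    rcases Nat.lt_or_ge (i % n + d) n with h | h
    · exact Or.inl ⟨Nat.mod_eq_of_lt h, h⟩
    · right
      rw [Nat.mod_eq_sub_mod h, Nat.mod_eq_of_lt (by omega)]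
      omega
  refine ⟨hn, fun i => by simp, fun i d hd hdn => ?_, fun i => ?_, fun i d hd hdn => ?_⟩
  · rcases hmod i d hdn with ⟨h1, h2⟩ | h
    · simp only [h1]
      exact hne _ _ (by omega) h2
    · exact (hne _ _ (by omega) (Nat.mod_lt i (by omega))).symm
  · have h1 := Nat.mod_lt i (show 0 < n by omega)
    rcases hmod i 1 (by omega) with ⟨h1, h2⟩ | h
    · simp only [h1]
      exact hadj _ h2
    · have e1 : i % n = n - 1 := by omega
      have e2 : (i + 1) % n = 0 := by omega
      simp only [e1, e2]
      exact hlast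
  · have h0 := Nat.mod_lt i (show 0 < n by omega)
    rcases hmod i d (by omega) with ⟨h1, h2⟩ | h
    · simp only [h1]
      exact hno _ _ (by omega) h2 (by omega)
    · exact fun e => hno _ _ (by omega) h0 (by omega) e.symm

/-- Two induced paths with the same nonadjacent ends and no edges between their interiors form a
hole. -/
theorem exists_isHole {q p : ℕ → V} {k l : ℕ} (hq : IndPath G q (k + 1)) (hp : IndPath G p (l + 1))
    (hk : 2 ≤ k) (hl : 1 ≤ l) (e0 : p 0 = q (k + 1)) (e1 : p (l + 1) = q 0)
    (hno : ¬ G.Adj (q 0) (q (k + 1)))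
    (hne : ∀ i j, i ≤ k + 1 → 0 < j → j ≤ l → q i ≠ p j)
    (hna : ∀ i j, 0 < i → i ≤ k → 0 < j → j ≤ l → ¬ G.Adj (q i) (p j)) :
    ∃ c, IsHole G (k + l + 2) c ∧ (∀ t, t ≤ k + 1 → c t = q t) ∧
      ∀ t, t ≤ l → c (k + 1 + t) = p t := by
  set c : ℕ → V := fun t => if t ≤ k + 1 then q t else p (t - (k + 1)) with hc
  have c1 : ∀ t, t ≤ k + 1 → c t = q t := fun t ht => by simp [hc, ht]
  have c2 : ∀ t, k + 1 ≤ t → c t = p (t - (k + 1)) := fun t ht => by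
    rcases Nat.lt_or_ge (k + 1) t with h | h
    · simp [hc, show ¬ t ≤ k + 1 by omega]
    · have : t = k + 1 := by omega
      subst this
      simp [hc, e0]
  have hpno : ¬ G.Adj (p 0) (p (l + 1)) := by rw [e0, e1]; exact fun h => hno h.symm
  refine ⟨_, isHole_of_lt (c := c) (by omega) (fun i j hij hj => ?_) (fun i hi => ?_) ?_
    (fun i j hij hj hji => ?_), fun t ht => ?_, fun t ht => ?_⟩
  · rcases Nat.lt_or_ge (k + 1) j with h | h
    · rw [c2 j h.le]
      rcases Nat.lt_or_ge i (k + 1) with h' | h'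
      · rw [c1 i h'.le]
        exact hne _ _ h'.le (by omega) (by omega)
      · rw [c2 i h']
        exact hp.ne _ _ (by omega) (by omega)
    · rw [c1 j h, c1 i (by omega)]
      exact hq.ne _ _ hij h
  · rcases Nat.lt_or_ge i (k + 1) with h | h
    · rw [c1 i h.le, c1 (i + 1) h]
      exact hq.adj i h
    · rw [c2 i h, c2 (i + 1) (by omega), show i + 1 - (k + 1) = i - (k + 1) + 1 by omega]
      exact hp.adj _ (by omega)
  · rw [c2 _ (by omega), c1 0 (by omega), ← e1, show k + l + 2 - 1 - (k + 1) = l by omega]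
    exact hp.adj l (by omega)
  · rcases Nat.lt_or_ge (k + 1) j with h | h
    · rw [c2 j h.le]
      rcases Nat.lt_or_ge i (k + 1) with h' | h'
      · rw [c1 i h'.le]
        rcases Nat.eq_zero_or_pos i with rfl | hi
        · rw [← e1]
          exact fun e => hp.not_adj' (by omega) le_rfl (Or.inr (Or.inr hpno)) e.symm
        · exact hna _ _ hi (by omega) (by omega) (by omega)
      · rw [c2 i h']
        exact hp.not_adj' (by omega) (by omega) (Or.inr (Or.inr hpno))
    · rw [c1 j h, c1 i (by omega)]
      exact hq.not_adj' hij h (Or.inr (Or.inr hno))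
  · rw [Nat.mod_eq_of_lt (by omega), c1 t ht]
  · rw [Nat.mod_eq_of_lt (by omega), c2 _ (by omega)]
    congr 1
    omega

theorem IsHole.adj_iff {n : ℕ} {c : ℕ → V} (h : IsHole G n c) {t d : ℕ} (hd : d < n) :
    G.Adj (c t) (c (t + d)) ↔ d = 1 ∨ d = n - 1 := by
  have hn := h.five_le
  constructor
  · intro e
    by_contra hcon
    rcases Nat.eq_zero_or_pos d with rfl | h0
    · exact e.ne rfl
    · exact h.not_adj t d (by omega) (by omega) e
  · rintro (rfl | rfl)
    · exact h.adj t
    · have := h.adj (t + (n - 1))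
      rw [show t + (n - 1) + 1 = t + n by omega, h.period] at this
      exact this.symm

/-- If nothing is attached to the hole, the graph is the hole. Otherwise `IsHole.attached` leaves an
arc, from `c (o + j)` on to `c o`, whose inner vertices have no neighbors off the hole. -/
theorem IsHole.terminal_or (hG : G.GemFree) (h2 : G.TwoConn) {n : ℕ} {c : ℕ → V}
    (h : IsHole G n c) :
    (∀ v, ∃ a b, ∀ u, G.Adj v u → u = a ∨ u = b) ∨ ∃ q k, Terminal G q k := by
  have hn := h.five_le
  have hnb : ∀ t u, u ∈ Set.range c → G.Adj (c t) u → u = c (t + 1) ∨ u = c (t + (n - 1)) := by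
    rintro t _ ⟨s, rfl⟩ hu
    obtain ⟨d, hd, e⟩ := h.exists_eq t s
    rw [e] at hu ⊢
    rcases (h.adj_iff hd).1 hu with rfl | rfl
    · exact Or.inl rfl
    · exact Or.inr rfl
  rcases h.attached hG h2 with hno | ⟨o, j, hj, hjn, ⟨u₀, hu₀, hau₀⟩, ⟨u₁, hu₁, hau₁⟩, hatt⟩
  · left
    have hall : ∀ v, v ∈ Set.range c := by
      intro v
      by_contra hv
      obtain ⟨a, ha, b, hb, -, hab⟩ := h2.exists_adj (S := (Set.range c)ᶜ) ⟨v, hv⟩ (v := c 0)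
        (w := c 1) (fun h => h ⟨0, rfl⟩) (fun h => h ⟨1, rfl⟩) (h.adj 0).ne.symm
      rw [Set.mem_compl_iff, not_not] at hb
      obtain ⟨t, rfl⟩ := hb
      exact hno t a ha hab.symm
    intro v
    obtain ⟨t, rfl⟩ := hall v
    exact ⟨_, _, fun u => hnb t u (hall u)⟩
  · right
    have hend : c (o + j + (n - j - 1 + 1)) = c o := by
      rw [show o + j + (n - j - 1 + 1) = o + n by omega, h.period]
    have hnseg : ∀ t, 0 < t → t < j →
        c (o + t) ∉ seg (fun t => c (o + j + t)) 0 (n - j - 1 + 1) := by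
      rintro t ht htj ⟨s, ⟨-, hs⟩, e⟩
      refine h.ne (o + t) (j + s - t) (by omega) (by omega) ?_
      rw [show o + t + (j + s - t) = o + j + s by omega]
      exact e.symm
    have hnseg' : ∀ u, u ∉ Set.range c → u ∉ seg (fun t => c (o + j + t)) 0 (n - j - 1 + 1) := by
      rintro u hu ⟨s, -, e⟩
      exact hu ⟨_, e⟩
    have hjne : ¬ G.Adj (c (o + j + 0)) (c (o + j + (n - j - 1 + 1))) → 2 ≤ j := by
      intro hna
      by_contra hj2
      have : j = 1 := by omega
      subst this
      rw [hend] at hna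
      exact hna (h.adj o).symm
    refine ⟨fun t => c (o + j + t), n - j - 1, h.indPath (o + j) (by omega), by omega,
      fun i hi hik u hu => ?_, fun hna z => ?_, fun hna z => ?_⟩
    · have hur : u ∈ Set.range c := by
        by_contra hur
        have := hatt (j + i) (by omega) ⟨u, hur, by rwa [← add_assoc]⟩
        omega
      rcases hnb _ _ hur hu with e | e
      · exact Or.inr e
      · left
        rw [e, show o + j + i + (n - 1) = o + j + (i - 1) + n by omega, h.period]
    · have hj2 := hjne hna
      -- The end has two neighbors off the path: one off the hole and one on the other arc. At least
      -- one differs from `z`.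
      by_cases hz : u₁ = z
      · refine ⟨c (o + (j - 1)), hnseg _ (by omega) (by omega), ?_, ?_⟩
        · rintro rfl
          exact hu₁ ⟨_, hz.symm⟩
        · have := h.adj (o + (j - 1))
          rw [show o + (j - 1) + 1 = o + j by omega] at this
          exact this.symm
      · exact ⟨u₁, hnseg' _ hu₁, hz, hau₁⟩
    · have hj2 := hjne hna
      simp only [hend]
      by_cases hz : u₀ = z
      · refine ⟨c (o + 1), hnseg _ (by omega) (by omega), ?_, h.adj o⟩
        rintro rfl
        exact hu₀ ⟨_, hz.symm⟩
      · exact ⟨u₀, hnseg' _ hu₀, hz, hau₀⟩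

theorem Conf.chordPath {q : ℕ → V} {k : ℕ} {K : Set V} (h : Conf G q k K)
    (hadj : G.Adj (q 0) (q (k + 1))) : ChordPath G q k {q 0} {q (k + 1)} K := by
  refine ⟨h.path, h.two_le, conn_singleton _, conn_singleton _, h.conn, rfl, rfl, ?_, ?_, ?_, ?_,
    ?_, fun i _ hi => h.not_mem i (by omega), by simpa, h.touch_left, h.touch_right, ?_, ?_,
    fun i hi hik ht => h.not_touch i hi hik ht.symm⟩
  · simpa using hadj.ne
  · simpa using h.not_mem 0 (by omega)
  · simpa using h.not_mem (k + 1) le_rfl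
  · exact fun i hi hik e => h.path.ne 0 i hi (by omega) e.symm
  · exact fun i hi hik e => h.path.ne i (k + 1) (by omega) le_rfl e
  · intro i hi hik
    rw [touch_singleton_singleton]
    exact h.path.not_adj 0 i (by omega) (by omega) (Or.inr (by omega))
  · intro i hi hik
    rw [touch_singleton_singleton]
    exact fun e => h.path.not_adj i (k + 1) (by omega) le_rfl (Or.inl hi) e.symm

/-- A further neighbor of an inner vertex lies in a component `U` off the path and `K`. By
2-connectivity `U` has a second contact, so it touches `K`, `q 1` and `q k` and none of the path's
ends. This is a prism pattern if `k = 2`, excluded by the number of vertices, and a subdivided prism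
otherwise. -/
theorem Conf.inner_of_adj [Finite V] (hG : G.GemFree) (h2 : G.TwoConn) {q : ℕ → V} {k : ℕ}
    {K : Set V} (h : Conf G q k K) (hadj : G.Adj (q 0) (q (k + 1))) (hcard : 6 < Nat.card V) {i : ℕ}
    (hi : 0 < i) (hik : i ≤ k) {u : V} (hu : G.Adj (q i) u) : u = q (i - 1) ∨ u = q (i + 1) := by
  classical
  have hk := h.two_le
  have hc := h.chordPath hadj
  by_contra hcon
  have huq : ∀ t, t ≤ k + 1 → u ≠ q t := by
    rintro t ht rfl
    rcases (h.path.adj_iff (by omega) ht hi (by omega)).1 hu with rfl | rfl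
    · exact hcon (Or.inr rfl)
    · exact hcon (Or.inl rfl)
  have huK : u ∉ K := fun huK => h.not_touch i hi hik ⟨_, rfl, u, huK, hu⟩
  set R : Set V := {v | v ∉ K ∧ ∀ t, t ≤ k + 1 → v ≠ q t} with hR
  have huR : u ∈ R := ⟨huK, huq⟩
  set U := G.compIn R u
  have hU : G.Conn U := conn_compIn huR
  have hqU : ∀ t, t ≤ k + 1 → q t ∉ U := fun t ht hm => hm.1.2 t ht rfl
  have dK : Disjoint K U := Set.disjoint_right.2 fun v hv => hv.1.1
  have tU : G.Touch U {q i} := ⟨u, mem_compIn_self huR, _, rfl, hu.symm⟩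
  obtain ⟨a, ha, b, hb, hbi, hab⟩ := h2.exists_adj hU.1 (hqU i (by omega)) (hqU 0 (by omega))
    (h.path.ne 0 i hi (by omega))
  have hother : G.Touch U {q 0} ∨ G.Touch U {q (k + 1)} ∨ G.Touch U K ∨
      ∃ j, 0 < j ∧ j ≤ k ∧ j ≠ i ∧ G.Touch U {q j} := by
    by_cases hbK : b ∈ K
    · exact Or.inr (Or.inr (Or.inl ⟨a, ha, b, hbK, hab⟩))
    · obtain ⟨t, ht, rfl⟩ : ∃ t, t ≤ k + 1 ∧ b = q t := by
        by_contra! hbq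
        exact hb (compIn_closed ha ⟨hbK, hbq⟩ hab)
      have tt : G.Touch U {q t} := ⟨a, ha, _, rfl, hab⟩
      rcases Nat.eq_zero_or_pos t with rfl | h0
      · exact Or.inl tt
      · rcases Nat.lt_or_ge k t with h1 | h1
        · have : t = k + 1 := by omega
          subst this
          exact Or.inr (Or.inl tt)
        · exact Or.inr (Or.inr (Or.inr ⟨t, h0, h1, fun e => hbi (e ▸ rfl), tt⟩))
  obtain ⟨nX, nY, tK, t1, tk⟩ := hG.touch_of_chordPath hc hU (by simpa using hqU 0 (by omega))
    (by simpa using hqU (k + 1) le_rfl) dK (fun t _ ht => hqU t (by omega)) hi hik tU hother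
  have a01 := h.path.adj 0 (by omega)
  have ak := h.path.adj k (by omega)
  have n1y := h.path.not_adj 1 (k + 1) (by omega) le_rfl (by omega)
  have n0k := h.path.not_adj 0 k (by omega) (by omega) (by omega)
  have nK1 := hc.nK 1 one_pos (by omega)
  have nKk := hc.nK k (by omega) le_rfl
  have d01 := h.path.ne 0 1 (by omega) (by omega)
  have d0k := h.path.ne 0 k (by omega) (by omega)
  have d1y := h.path.ne 1 (k + 1) (by omega) (by omega)
  have dky := h.path.ne k (k + 1) (by omega) (by omega)
  -- For `k > 2` the segment from `q 2` to `q (k - 1)` is the subdividing bag of `long_prism_check`.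
  rcases Nat.lt_or_ge 2 k with hk3 | hk3
  · have hseg : ∀ t, t < 2 ∨ k - 1 < t → t ≤ k + 1 → Disjoint {q t} (seg q 2 (k - 1)) := by
      intro t ht htk
      rw [Set.disjoint_singleton_left, h.path.mem_seg_iff (by omega) htk]
      omega
    have hnts : ∀ t, t < 1 ∨ k < t → t ≤ k + 1 → ¬ G.Touch {q t} (seg q 2 (k - 1)) := by
      intro t ht htk hts
      rcases ht with ht | ht
      · rw [← seg_self q] at hts
        exact h.path.not_touch_seg (by omega) (by omega) (Or.inr (Or.inl (by omega))) hts
      · rw [← seg_self q] at hts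
        exact h.path.not_touch_seg (by omega) (by omega) (Or.inl (by omega)) hts.symm
    have hts1 : G.Touch {q 1} (seg q 2 (k - 1)) :=
      ⟨_, rfl, q 2, mem_seg_of_le le_rfl (by omega), h.path.adj 1 (by omega)⟩
    have htsk : G.Touch (seg q 2 (k - 1)) {q k} := by
      refine ⟨q (k - 1), mem_seg_of_le (by omega) le_rfl, _, rfl, ?_⟩
      have := h.path.adj (k - 1) (by omega)
      rwa [show k - 1 + 1 = k by omega] at this
    have n1k := h.path.not_adj 1 k (by omega) (by omega) (by omega)
    have d1k := h.path.ne 1 k (by omega) (by omega)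
    have nKs : ¬ G.Touch K (seg q 2 (k - 1)) := by
      rw [touch_seg_iff]
      rintro ⟨t, h1, h2, ht⟩
      exact hc.nK t (by omega) (by omega) ht
    have dKs : Disjoint K (seg q 2 (k - 1)) :=
      disjoint_seg_iff.2 fun t h1 h2 => h.not_mem t (by omega)
    have dUs : Disjoint (seg q 2 (k - 1)) U :=
      (disjoint_seg_iff.2 fun t h1 h2 => hqU t (by omega)).symm
    have dq : ∀ t, t ≤ k + 1 → Disjoint {q t} U := fun t ht => by simpa using hqU t ht
    have dqK : ∀ t, t ≤ k + 1 → Disjoint {q t} K := fun t ht => by simpa using h.not_mem t ht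
    refine hG.false_of_gemCheck (long_prism_check (decide (G.Touch (seg q 2 (k - 1)) U)))
      ![{q 0}, {q (k + 1)}, K, {q 1}, seg q 2 (k - 1), {q k}, U]
      (by
        intro i
        fin_cases i
        exacts [conn_singleton _, conn_singleton _, h.conn, conn_singleton _,
          h.path.conn_seg (by omega) (by omega), conn_singleton _, hU])
      (by
        intro i j hij
        fin_cases i <;> fin_cases j <;> first
          | exact absurd hij (by decide)
          | assumption
          | exact dq _ (by omega)
          | exact dqK _ (by omega)
          | exact (dqK _ (by omega)).symm
          | exact hseg _ (by omega) (by omega)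
          | exact (hseg _ (by omega) (by omega)).symm
          | exact Set.disjoint_singleton.2 (h.path.ne _ _ (by omega) (by omega))
          | exact Set.disjoint_singleton.2 (h.path.ne _ _ (by omega) (by omega)).symm)
      (by
        have := hc.tXY
        have := hc.tXK
        have := hc.tYK
        have := tK.symm
        have := t1.symm
        have := tk.symm
        intro i j hij
        fin_cases i <;> fin_cases j <;> first
          | exact absurd hij (by decide)
          | exact decide_eq_true_iff
          | exact iff_of_true rfl (by assumption)
          | exact iff_of_true rfl (touch_singleton_singleton.2 a01)
          | exact iff_of_true rfl (touch_singleton_singleton.2 ak.symm)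
          | exact iff_of_false Bool.false_ne_true (by assumption)
          | exact iff_of_false Bool.false_ne_true fun h => nX h.symm
          | exact iff_of_false Bool.false_ne_true fun h => nY h.symm
          | exact iff_of_false Bool.false_ne_true fun h =>
              n1y (touch_singleton_singleton.1 h).symm
          | exact iff_of_false Bool.false_ne_true fun h => n0k (touch_singleton_singleton.1 h)
          | exact iff_of_false Bool.false_ne_true fun h => n1k (touch_singleton_singleton.1 h)
          | exact iff_of_false Bool.false_ne_true (hnts _ (by omega) (by omega)))
  · have : k = 2 := by omega
    subst this
    have a12 := h.path.adj 1 (by omega)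
    have hlt : ∀ i j, i < j → (prism.Adj i j ↔
        G.Touch ((![K, {q 0}, {q 3}, U, {q 1}, {q 2}] : Fin 6 → Set V) i)
          ((![K, {q 0}, {q 3}, U, {q 1}, {q 2}] : Fin 6 → Set V) j)) := by
      intro i j hij
      fin_cases i <;> fin_cases j <;> first
        | exact absurd hij (by decide)
        | exact iff_of_true (by decide) hc.tXK.symm
        | exact iff_of_true (by decide) hc.tYK.symm
        | exact iff_of_true (by decide) hc.tXY
        | exact iff_of_true (by decide) tK.symm
        | exact iff_of_true (by decide) t1
        | exact iff_of_true (by decide) tk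
        | exact iff_of_true (by decide) (touch_singleton_singleton.2 a01)
        | exact iff_of_true (by decide) (touch_singleton_singleton.2 ak.symm)
        | exact iff_of_true (by decide) (touch_singleton_singleton.2 a12)
        | exact iff_of_false (by decide) nK1
        | exact iff_of_false (by decide) nKk
        | exact iff_of_false (by decide) fun h => nX h.symm
        | exact iff_of_false (by decide) fun h => nY h.symm
        | exact iff_of_false (by decide) fun h => n0k (touch_singleton_singleton.1 h)
        | exact iff_of_false (by decide) fun h => n1y (touch_singleton_singleton.1 h).symm
    have hdl : ∀ i j : Fin 6, i < j →
        Disjoint ((![K, {q 0}, {q 3}, U, {q 1}, {q 2}] : Fin 6 → Set V) i)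
          ((![K, {q 0}, {q 3}, U, {q 1}, {q 2}] : Fin 6 → Set V) j) := by
      have dqK : ∀ t, t ≤ 3 → Disjoint K {q t} := fun t ht => by simpa using h.not_mem t ht
      have dq : ∀ t, t ≤ 3 → Disjoint {q t} U := fun t ht => by simpa using hqU t ht
      intro i j hij
      fin_cases i <;> fin_cases j <;> first
        | exact absurd hij (by decide)
        | exact dK
        | exact dqK _ (by omega)
        | exact dq _ (by omega)
        | exact (dq _ (by omega)).symm
        | exact Set.disjoint_singleton.2 (h.path.ne _ _ (by omega) (by omega))
        | exact Set.disjoint_singleton.2 (h.path.ne _ _ (by omega) (by omega)).symm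
    refine absurd (hG.card_le_of_prism h2 (b := ![K, {q 0}, {q 3}, U, {q 1}, {q 2}])
      ⟨fun i => ?_, fun i j hij => ?_, fun i j hij => ?_⟩) (by omega)
    · fin_cases i
      exacts [h.conn, conn_singleton _, conn_singleton _, hU, conn_singleton _, conn_singleton _]
    · rcases lt_or_gt_of_ne hij with h | h
      · exact hdl i j h
      · exact (hdl j i h).symm
    · rcases lt_or_gt_of_ne hij with h | h
      · exact hlt i j h
      · rw [adj_comm, touch_comm]
        exact hlt j i h

theorem Conf.terminal_or [Finite V] (hG : G.GemFree) (h2 : G.TwoConn) {q : ℕ → V} {k : ℕ}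
    {K : Set V} (h : Conf G q k K) : Nat.card V ≤ 6 ∨
      (∀ v, ∃ a b, ∀ u, G.Adj v u → u = a ∨ u = b) ∨ ∃ q k, Terminal G q k := by
  by_cases hcard : Nat.card V ≤ 6
  · exact Or.inl hcard
  right
  by_cases hadj : G.Adj (q 0) (q (k + 1))
  · exact Or.inr ⟨q, k, h.path, h.two_le,
      fun i hi hik u hu => h.inner_of_adj hG h2 hadj (by omega) hi hik hu,
      fun hna => absurd hadj hna, fun hna => absurd hadj hna⟩
  -- Nonadjacent ends are joined by an induced path through `K`, which closes the given path to a
  -- hole.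
  · obtain ⟨l, p, hl, e0, e1, hp, hpK⟩ := exists_indPath h.conn (h.not_mem (k + 1) le_rfl)
      (h.not_mem 0 (by omega)) (h.path.ne 0 (k + 1) (by omega) le_rfl).symm h.touch_right
      h.touch_left
    obtain ⟨c, hc, -⟩ := exists_isHole h.path hp h.two_le hl e0 e1 hadj
      (fun i j hi hj hjl e => h.not_mem i hi (e ▸ hpK j hj hjl))
      (fun i j hi hik hj hjl e => h.not_touch i hi hik ⟨_, rfl, _, hpK j hj hjl, e⟩)
    exact hc.terminal_or hG h2

end Terminal
-- A part of a component that sees neither end of the path.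
section Gap

variable {V : Type*} {G : SimpleGraph V}

/-- `Q` and `K` are connected sets that do not touch each other and both touch `x` and `y`, and `D`
is a component of the part of `K` that touches neither `x` nor `y`. -/
structure Gap (G : SimpleGraph V) (x y : V) (Q K D : Set V) : Prop where
  cQ : G.Conn Q
  cK : G.Conn K
  cD : G.Conn D
  sub : D ⊆ K
  ne : x ≠ y
  xQ : x ∉ Q
  yQ : y ∉ Q
  xK : x ∉ K
  yK : y ∉ K
  dQK : Disjoint Q K
  txQ : G.Touch {x} Q
  tyQ : G.Touch {y} Q
  tyK : G.Touch {y} K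
  nQK : ¬ G.Touch Q K
  nx : ¬ G.Touch {x} D
  ny : ¬ G.Touch {y} D
  near : ∀ v ∈ K, v ∉ D → G.Touch {v} D → G.Adj x v ∨ G.Adj y v
  common : ∀ S ⊆ K, G.Conn S → G.Touch {x} S → G.Touch {y} S → ∃ m ∈ S, G.Adj x m ∧ G.Adj y m

namespace Gap

variable {x y : V} {Q K D : Set V}

theorem not_mem_of_adj_left (h : Gap G x y Q K D) {n : V} (hn : G.Adj x n) : n ∉ D :=
  fun hD => h.nx ⟨x, rfl, n, hD, hn⟩

theorem not_mem_of_adj_right (h : Gap G x y Q K D) {n : V} (hn : G.Adj y n) : n ∉ D :=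
  fun hD => h.ny ⟨y, rfl, n, hD, hn⟩

theorem not_touch (h : Gap G x y Q K D) {S : Set V} (hS : S ⊆ K) : ¬ G.Touch Q S :=
  fun ht => h.nQK (ht.mono subset_rfl hS)

theorem disjoint (h : Gap G x y Q K D) {S : Set V} (hS : S ⊆ K) : Disjoint Q S :=
  h.dQK.mono_right hS

/-- The gem has the path `Q, y, m, D` and the hub `{x, n}`. -/
theorem false_of_two_common (hG : G.GemFree) (h : Gap G x y Q K D) {n m : V} (hnm : n ≠ m)
    (hn : n ∈ K) (hm : m ∈ K) (nD : G.Touch {n} D) (mD : G.Touch {m} D) (xn : G.Adj x n)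
    (yn : G.Adj y n) (xm : G.Adj x m) (ym : G.Adj y m) : False := by
  have hnK : {n} ⊆ K := by simpa
  have hmK : {m} ⊆ K := by simpa
  refine hG.false_of_bags (A := Q) (B := {y}) (C := {m}) (D := D) (H := {x, n}) h.cQ
    (conn_singleton _) (conn_singleton _) h.cD (conn_pair xn) (by simpa using h.yQ)
    (h.disjoint hmK) (h.disjoint h.sub) ?_ (by simpa using ym.ne) ?_ ?_ ?_ ?_ ?_ h.tyQ.symm
    (by simpa) mD (h.txQ.mono (by simp) subset_rfl) ⟨n, by simp, y, rfl, yn.symm⟩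
    ⟨x, by simp, m, rfl, xm⟩ (nD.mono (by simp) subset_rfl) (h.not_touch hmK) (h.not_touch h.sub)
    h.ny
  · rw [Set.insert_eq, Set.disjoint_union_right]
    exact ⟨by simpa using h.xQ, h.disjoint hnK⟩
  · simpa using fun e => h.yK (h.sub e)
  · simpa using ⟨h.ne.symm, yn.ne⟩
  · simpa using h.not_mem_of_adj_left xm
  · simpa using ⟨xm.ne.symm, hnm.symm⟩
  · rw [Set.insert_eq, Set.disjoint_union_right]
    exact ⟨by simpa using fun e => h.xK (h.sub e), by simpa using h.not_mem_of_adj_left xn⟩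

/-- If `n` and `m` are adjacent, `m` is the hub over `D, n, x, {y} ∪ Q`. If `x` and `y` are, `x` is
the hub over `Q, y, m, {n} ∪ D`. -/
theorem false_of_left_common (hG : G.GemFree) (h : Gap G x y Q K D) {n m : V}
    (hn : n ∈ K) (hm : m ∈ K) (nD : G.Touch {n} D) (mD : G.Touch {m} D) (xn : G.Adj x n)
    (yn : ¬ G.Adj y n) (xm : G.Adj x m) (ym : G.Adj y m) (hor : G.Adj n m ∨ G.Adj x y) :
    False := by
  have hnK : {n} ⊆ K := by simpa
  have hmK : {m} ⊆ K := by simpa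
  have hnm : n ≠ m := fun e => yn (e ▸ ym)
  have nDy := h.not_mem_of_adj_left xn
  have mDy := h.not_mem_of_adj_left xm
  have xD : x ∉ D := fun e => h.xK (h.sub e)
  have yD : y ∉ D := fun e => h.yK (h.sub e)
  rcases hor with nm | xy
  · refine hG.false_of_bags (A := D) (B := {n}) (C := {x}) (D := {y} ∪ Q) (H := {m}) h.cD
      (conn_singleton _) (conn_singleton _) ((conn_singleton _).union h.cQ h.tyQ)
      (conn_singleton _) (by simpa) (by simpa) ?_ (by simpa) (by simpa using xn.ne.symm) ?_
      (by simpa using hnm) ?_ (by simpa using xm.ne) ?_ nD.symm (by simpa using xn.symm)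
      (h.txQ.mono subset_rfl Set.subset_union_right) mD (by simpa using nm.symm)
      (by simpa using xm.symm) (touch_union_right.2 (Or.inl (by simpa using ym.symm)))
      (fun e => h.nx e.symm) ?_ ?_
    · rw [Set.disjoint_union_right]
      exact ⟨by simpa, (h.disjoint h.sub).symm⟩
    · rw [Set.disjoint_union_right]
      exact ⟨by simpa using fun e : n = y => h.yK (e ▸ hn), (h.disjoint hnK).symm⟩
    · simpa using ⟨h.ne, h.xQ⟩
    · rw [Set.disjoint_union_left]
      exact ⟨by simpa using ym.ne, h.disjoint hmK⟩
    · rw [touch_union_right]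
      rintro (e | e)
      exacts [h.ny e.symm, h.not_touch h.sub e.symm]
    · rw [touch_union_right]
      rintro (e | e)
      exacts [yn (touch_singleton_singleton.1 e).symm, h.not_touch hnK e.symm]
  · have hnD : {n} ∪ D ⊆ K := Set.union_subset hnK h.sub
    refine hG.false_of_bags (A := Q) (B := {y}) (C := {m}) (D := {n} ∪ D) (H := {x}) h.cQ
      (conn_singleton _) (conn_singleton _) ((conn_singleton _).union h.cD nD)
      (conn_singleton _) (by simpa using h.yQ) (h.disjoint hmK) (h.disjoint hnD)
      (by simpa using h.xQ) (by simpa using ym.ne) ?_ (by simpa using h.ne.symm) ?_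
      (by simpa using xm.ne.symm) ?_ h.tyQ.symm (by simpa)
      (mD.mono subset_rfl Set.subset_union_right) h.txQ (by simpa) (by simpa)
      (touch_union_right.2 (Or.inl (by simpa))) (h.not_touch hmK) (h.not_touch hnD) ?_
    · rw [Set.disjoint_singleton_left]
      exact fun e => h.yK (hnD e)
    · simpa using ⟨hnm.symm, mDy⟩
    · rw [Set.disjoint_singleton_right]
      exact fun e => h.xK (hnD e)
    · rw [touch_union_right]
      rintro (e | e)
      exacts [yn (touch_singleton_singleton.1 e), h.ny e]

/-- The connected set formed by `n`, `D` and `n'` joins `x` to `y` but contains no common neighbor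
of them. -/
theorem false_of_left_right (h : Gap G x y Q K D) {n n' : V}
    (hn : n ∈ K) (hn' : n' ∈ K) (nD : G.Touch {n} D) (nD' : G.Touch {n'} D) (xn : G.Adj x n)
    (yn : ¬ G.Adj y n) (xn' : ¬ G.Adj x n') (yn' : G.Adj y n') : False := by
  obtain ⟨m, hm, xm, ym⟩ := h.common ({n} ∪ D ∪ {n'})
    (Set.union_subset (Set.union_subset (by simpa) h.sub) (by simpa))
    (((conn_singleton _).union h.cD nD).union (conn_singleton _)
      (touch_union_left.2 (Or.inr nD'.symm)))
    ⟨x, rfl, n, by simp, xn⟩ ⟨y, rfl, n', by simp, yn'⟩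
  rcases hm with (rfl | hm) | rfl
  exacts [yn ym, h.not_mem_of_adj_left xm hm, xn' xm]

/-- Without the common neighbors of `x` and `y`, the component `C` of `K` around `n` and `D` does
not see `y`. As `K` does, some `r` in `C` has a neighbor `m` adjacent to both ends, and `m` does not
see `D` by `hγ`. A route from `r` towards `D` and a second neighbor `p` of `D` then give a gem,
whose shape depends on whether `p` sees `m`. -/
theorem false_of_two_left (hG : G.GemFree) (h : Gap G x y Q K D)
    (hγ : ∀ n m, n ∈ K → m ∈ K → G.Touch {n} D → G.Touch {m} D → G.Adj x n → ¬ G.Adj y n →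
      G.Adj x m → G.Adj y m → False) {n n' : V} (hnn' : n ≠ n')
    (hn : n ∈ K) (hn' : n' ∈ K) (nD : G.Touch {n} D) (nD' : G.Touch {n'} D) (xn : G.Adj x n)
    (yn : ¬ G.Adj y n) (xn' : G.Adj x n') (yn' : ¬ G.Adj y n') : False := by
  set R : Set V := {v | v ∈ K ∧ ¬ (G.Adj x v ∧ G.Adj y v)} with hR
  have hnR : n ∈ R := ⟨hn, fun e => yn e.2⟩
  set C := G.compIn R n with hC
  have hCK : C ⊆ K := fun v hv => hv.1.1
  have cC : G.Conn C := conn_compIn hnR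
  have hDC : {n} ∪ D ⊆ C := Conn.subset_compIn ((conn_singleton _).union h.cD nD)
    (Set.union_subset (by simpa) fun v hv => ⟨h.sub hv, fun e => h.not_mem_of_adj_left e.1 hv⟩)
    (Or.inl rfl)
  have nyC : ¬ G.Touch {y} C := by
    intro ht
    obtain ⟨m, hm, hxy⟩ := h.common C hCK cC ⟨x, rfl, n, hDC (Or.inl rfl), xn⟩ ht
    exact hm.1.2 hxy
  obtain ⟨r, hr, m, hm, hmC, hrm⟩ : ∃ r ∈ C, ∃ m ∈ K, m ∉ C ∧ G.Adj r m := by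
    by_contra! hcon
    have := h.cK.2 C ⟨n, hn, hDC (Or.inl rfl)⟩ fun a _ ha b hb hab => by
      by_contra hbC
      exact hcon a ha b hb hbC hab
    exact nyC (h.tyK.mono subset_rfl this)
  have hxym : G.Adj x m ∧ G.Adj y m := by
    by_contra hxy
    exact hmC (compIn_closed hr ⟨hm, hxy⟩ hrm)
  obtain ⟨xm, ym⟩ := hxym
  have mD : ¬ G.Touch {m} D := fun e => hγ n m hn hm nD e xn yn xm ym
  have hrD : r ∉ D := fun e => mD ⟨m, rfl, r, e, hrm.symm⟩
  -- `N` leads from `r` to the boundary of `D` and contains just one vertex `f` that sees `D`. Hence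
  -- one of `n, n'` stays outside `N`.
  obtain ⟨N, f, cN, hNC, hND, hfN, fD, hrN, huniq⟩ : ∃ N f, G.Conn N ∧ N ⊆ C ∧ Disjoint N D ∧
      f ∈ N ∧ G.Touch {f} D ∧ r ∈ N ∧ ∀ v ∈ N, G.Touch {v} D → v = f := by
    set S : Set V := {v | v ∈ C ∧ v ∉ D ∧ ¬ G.Touch {v} D} with hS
    by_cases hrS : r ∈ S
    · have cS := conn_compIn (G := G) hrS
      have hSC : G.compIn S r ⊆ C := fun v hv => hv.1.1
      obtain ⟨a, ha, f, hf, hfS, haf⟩ : ∃ a ∈ G.compIn S r, ∃ f ∈ C, f ∉ G.compIn S r ∧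
          G.Adj a f := by
        by_contra! hcon
        have := cC.2 _ ⟨r, hr, mem_compIn_self hrS⟩ fun a _ ha b hb hab => by
          by_contra hbC
          exact hcon a ha b hb hbC hab
        exact (this (hDC (Or.inl rfl))).1.2.2 nD
      have hfD : f ∉ D := fun e => ha.1.2.2 ⟨a, rfl, f, e, haf⟩
      have tfD : G.Touch {f} D := by
        by_contra htf
        exact hfS (compIn_closed ha ⟨hf, hfD, htf⟩ haf)
      refine ⟨{f} ∪ G.compIn S r, f, (conn_singleton f).union cS ⟨f, rfl, a, ha, haf.symm⟩,
        Set.union_subset (by simpa) hSC, ?_, Or.inl rfl, tfD, Or.inr (mem_compIn_self hrS), ?_⟩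
      · rw [Set.disjoint_left]
        rintro v (rfl | hv)
        exacts [hfD, hv.1.2.1]
      · rintro v (rfl | hv) hvD
        exacts [rfl, absurd hvD hv.1.2.2]
    · have trD : G.Touch {r} D := by
        by_contra htr
        exact hrS ⟨hr, hrD, htr⟩
      refine ⟨{r}, r, conn_singleton r, by simpa, by simpa, rfl, trD, rfl, ?_⟩
      rintro v rfl -
      rfl
  obtain ⟨p, hp, pD, xp, yp, hpf⟩ : ∃ p ∈ K, G.Touch {p} D ∧ G.Adj x p ∧ ¬ G.Adj y p ∧ p ≠ f := by
    by_cases e : n = f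
    · exact ⟨n', hn', nD', xn', yn', fun e' => hnn' (e.trans e'.symm)⟩
    · exact ⟨n, hn, nD, xn, yn, e⟩
  have hpN : p ∉ N := fun e => hpf (huniq p e pD)
  have hpD := h.not_mem_of_adj_left xp
  have hmD := h.not_mem_of_adj_left xm
  have hpm : p ≠ m := fun e => yp (e ▸ ym)
  have hNK : N ⊆ K := hNC.trans hCK
  have hmN : m ∉ N := fun e => hmC (hNC e)
  have xD : x ∉ D := fun e => h.xK (h.sub e)
  have yD : y ∉ D := fun e => h.yK (h.sub e)
  have xf : G.Adj x f := by
    rcases h.near f (hNK hfN) (Set.disjoint_left.1 hND hfN) fD with e | e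
    · exact e
    · exact absurd ⟨y, rfl, f, hNC hfN, e⟩ nyC
  have tNm : G.Touch N {m} := ⟨r, hrN, m, rfl, hrm⟩
  have hpK : {p} ⊆ K := by simpa
  have hmK : {m} ⊆ K := by simpa
  by_cases pm : G.Adj p m
  · have hNmK : N ∪ {m} ⊆ K := Set.union_subset hNK hmK
    refine hG.false_of_bags (A := D) (B := {p}) (C := {x}) (D := {y} ∪ Q) (H := N ∪ {m}) h.cD
      (conn_singleton _) (conn_singleton _) ((conn_singleton _).union h.cQ h.tyQ)
      (cN.union (conn_singleton _) tNm) (by simpa) (by simpa) ?_ ?_ (by simpa using xp.ne.symm) ?_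
      ?_ ?_ ?_ ?_ pD.symm (by simpa using xp.symm) (h.txQ.mono subset_rfl Set.subset_union_right)
      (touch_union_left.2 (Or.inl (fD.mono (by simpa) subset_rfl)))
      ⟨m, by simp, p, rfl, pm.symm⟩ ⟨m, by simp, x, rfl, xm.symm⟩
      ⟨m, by simp, y, by simp, ym.symm⟩ (fun e => h.nx e.symm) ?_ ?_
    · rw [Set.disjoint_union_right]
      exact ⟨by simpa, (h.disjoint h.sub).symm⟩
    · rw [Set.disjoint_union_right]
      exact ⟨hND.symm, by simpa⟩
    · rw [Set.disjoint_union_right]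
      exact ⟨by simpa using fun e : p = y => h.yK (e ▸ hp), (h.disjoint hpK).symm⟩
    · simpa using ⟨hpm, hpN⟩
    · simpa using ⟨h.ne, h.xQ⟩
    · rw [Set.disjoint_singleton_left]
      exact fun e => h.xK (hNmK e)
    · rw [Set.disjoint_union_left]
      exact ⟨by rw [Set.disjoint_singleton_left]; exact fun e => h.yK (hNmK e), h.disjoint hNmK⟩
    · rw [touch_union_right]
      rintro (e | e)
      exacts [h.ny e.symm, h.not_touch h.sub e.symm]
    · rw [touch_union_right]
      rintro (e | e)
      exacts [yp (touch_singleton_singleton.1 e).symm, h.not_touch hpK e.symm]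
  · have hpDK : {p} ∪ D ⊆ K := Set.union_subset hpK h.sub
    refine hG.false_of_bags (A := {p} ∪ D) (B := N) (C := {m}) (D := {y}) (H := {x} ∪ Q)
      ((conn_singleton _).union h.cD pD) cN (conn_singleton _) (conn_singleton _)
      ((conn_singleton _).union h.cQ h.txQ) ?_ ?_ ?_ ?_ (by simpa) ?_ ?_
      (by simpa using ym.ne.symm) ?_ ?_ (touch_union_left.2 (Or.inr (fD.symm.mono subset_rfl
        (by simpa)))) tNm (by simpa using ym.symm) ⟨x, by simp, p, by simp, xp⟩
      ⟨x, by simp, f, hfN, xf⟩ ⟨x, by simp, m, rfl, xm⟩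
      (touch_union_left.2 (Or.inr h.tyQ.symm)) ?_ ?_ (fun e => nyC (e.symm.mono subset_rfl hNC))
    · rw [Set.disjoint_union_left]
      exact ⟨by simpa, hND.symm⟩
    · rw [Set.disjoint_union_left]
      exact ⟨by simpa using hpm, by simpa⟩
    · rw [Set.disjoint_singleton_right]
      exact fun e => h.yK (hpDK e)
    · rw [Set.disjoint_union_right]
      exact ⟨by rw [Set.disjoint_singleton_right]; exact fun e => h.xK (hpDK e),
        (h.disjoint hpDK).symm⟩
    · rw [Set.disjoint_singleton_right]
      exact fun e => h.yK (hNK e)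
    · rw [Set.disjoint_union_right]
      exact ⟨by rw [Set.disjoint_singleton_right]; exact fun e => h.xK (hNK e),
        (h.disjoint hNK).symm⟩
    · rw [Set.disjoint_union_right]
      exact ⟨by simpa using xm.ne.symm, (h.disjoint hmK).symm⟩
    · simpa using ⟨h.ne.symm, h.yQ⟩
    · rw [touch_union_left]
      rintro (e | e)
      exacts [pm (touch_singleton_singleton.1 e), mD e.symm]
    · rw [touch_union_left]
      rintro (e | e)
      exacts [yp (touch_singleton_singleton.1 e).symm, h.ny e.symm]

end Gap

end Gap

/-! ### A second long path between the ends of a terminal path. -/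

section Structure

variable {V : Type*} {G : SimpleGraph V} {q : ℕ → V} {k : ℕ}

namespace Terminal

theorem reverse (h : Terminal G q k) : Terminal G (fun i => q (k + 1 - i)) k := by
  have hseg : ∀ w, w ∉ seg q 0 (k + 1) → w ∉ seg (fun i => q (k + 1 - i)) 0 (k + 1) := by
    rintro w hw ⟨t, ⟨-, ht⟩, e⟩
    exact hw ⟨k + 1 - t, ⟨by omega, by omega⟩, e⟩
  refine ⟨h.path.reverse, h.two_le, fun i hi hik u hu => ?_, fun hna z => ?_, fun hna z => ?_⟩
  · rcases h.inner (k + 1 - i) (by omega) (by omega) u hu with e | e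
    · right
      rw [e]
      congr 1
    · left
      rw [e]
      congr 1
      omega
  · simp only [Nat.sub_zero, Nat.sub_self] at hna ⊢
    obtain ⟨w, hw, h'⟩ := h.right (fun e => hna e.symm) z
    exact ⟨w, hseg w hw, h'⟩
  · simp only [Nat.sub_zero, Nat.sub_self] at hna ⊢
    obtain ⟨w, hw, h'⟩ := h.left (fun e => hna e.symm) z
    exact ⟨w, hseg w hw, h'⟩

theorem seg_reverse (q : ℕ → V) (k : ℕ) :
    seg (fun i => q (k + 1 - i)) 0 (k + 1) = seg q 0 (k + 1) := by
  ext v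
  constructor
  · rintro ⟨t, ⟨-, ht⟩, e⟩
    exact ⟨k + 1 - t, ⟨by omega, by omega⟩, e⟩
  · rintro ⟨t, ⟨-, ht⟩, rfl⟩
    refine ⟨k + 1 - t, ⟨by omega, by omega⟩, ?_⟩
    simp only
    congr 1
    omega

theorem not_adj_of_not_mem (h : Terminal G q k) {i : ℕ} (hi : 0 < i) (hik : i ≤ k) {u : V}
    (hu : u ∉ seg q 0 (k + 1)) : ¬ G.Adj (q i) u := by
  intro e
  rcases h.inner i hi hik u e with rfl | rfl
  · exact hu (mem_seg_of_le (by omega) (by omega))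
  · exact hu (mem_seg_of_le (by omega) (by omega))

theorem eq_of_adj (h : Terminal G q k) {u v : V} (hu : u ∉ seg q 0 (k + 1))
    (hv : v ∈ seg q 0 (k + 1)) (huv : G.Adj u v) : v = q 0 ∨ v = q (k + 1) := by
  obtain ⟨t, ⟨-, ht⟩, rfl⟩ := hv
  by_contra hcon
  have h0 : t ≠ 0 := by rintro rfl; exact hcon (Or.inl rfl)
  have h1 : t ≠ k + 1 := by rintro rfl; exact hcon (Or.inr rfl)
  exact h.not_adj_of_not_mem (by omega) (by omega) hu huv.symm

theorem touch_left (h2 : G.TwoConn) (h : Terminal G q k) {u : V} (hu : u ∉ seg q 0 (k + 1)) :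
    G.Touch {q 0} (G.compIn (seg q 0 (k + 1))ᶜ u) := by
  have hmem : ∀ t, t ≤ k + 1 → q t ∉ G.compIn (seg q 0 (k + 1))ᶜ u := fun t ht hm =>
    hm.1 (mem_seg_of_le (by omega) ht)
  obtain ⟨a, ha, b, hb, hby, hab⟩ := h2.exists_adj (conn_compIn (G := G) (S := (seg q 0 (k + 1))ᶜ)
    hu).1 (hmem (k + 1) le_rfl) (hmem 0 (by omega)) (h.path.ne 0 (k + 1) (by omega) le_rfl)
  have hbQ : b ∈ seg q 0 (k + 1) := by
    by_contra hbQ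
    exact hb (compIn_closed ha hbQ hab)
  rcases h.eq_of_adj ha.1 hbQ hab with rfl | rfl
  · exact ⟨_, rfl, a, ha, hab.symm⟩
  · exact absurd rfl hby

theorem touch_right (h2 : G.TwoConn) (h : Terminal G q k) {u : V} (hu : u ∉ seg q 0 (k + 1)) :
    G.Touch {q (k + 1)} (G.compIn (seg q 0 (k + 1))ᶜ u) := by
  have := h.reverse.touch_left h2 (u := u) (by rwa [seg_reverse])
  rwa [seg_reverse] at this

/-- The inner vertices of a second long path between the ends have degree two. -/
theorem long_path_inner (hG : G.GemFree) (h2 : G.TwoConn) (h : Terminal G q k) {p : ℕ → V} {l : ℕ}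
    (hl : 2 ≤ l) (hp : IndPath G p (l + 1)) (e0 : p 0 = q 0) (e1 : p (l + 1) = q (k + 1))
    (hpq : ∀ i, 0 < i → i ≤ l → p i ∉ seg q 0 (k + 1)) {i : ℕ} (hi : 0 < i) (hil : i ≤ l) {u : V}
    (hu : G.Adj (p i) u) : u = p (i - 1) ∨ u = p (i + 1) := by
  have hk := h.two_le
  by_contra hcon
  have hup : ∀ t, t ≤ l + 1 → u ≠ p t := by
    rintro t ht rfl
    rcases (hp.adj_iff (by omega) ht hi (by omega)).1 hu with rfl | rfl
    · exact hcon (Or.inr rfl)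
    · exact hcon (Or.inl rfl)
  have huq : u ∉ seg q 0 (k + 1) := by
    intro huq
    rcases h.eq_of_adj (hpq i hi hil) huq hu with e | e
    · exact hup 0 (by omega) (e.trans e0.symm)
    · exact hup (l + 1) le_rfl (e.trans e1.symm)
  by_cases hadj : G.Adj (q 0) (q (k + 1))
  -- The new path and the interior of the old one form a configuration. A set attached to the new
  -- interior would have to touch the old interior, whose vertices have degree two.
  · set R : Set V := {v | v ∉ seg q 0 (k + 1) ∧ ∀ t, t ≤ l + 1 → v ≠ p t} with hR
    have huR : u ∈ R := ⟨huq, hup⟩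
    have cU := conn_compIn (G := G) huR
    have hpU : ∀ t, t ≤ l + 1 → p t ∉ G.compIn R u := fun t ht hm => hm.1.2 t ht rfl
    have hqU : ∀ t, t ≤ k + 1 → q t ∉ G.compIn R u := fun t ht hm =>
      hm.1.1 (mem_seg_of_le (by omega) ht)
    have hc : Conf G p l (seg q 1 k) := by
      refine ⟨hp, hl, h.path.conn_seg (by omega) (by omega), fun t ht => ?_, ?_, ?_,
        fun t ht htl => ?_⟩
      · rcases Nat.eq_zero_or_pos t with rfl | h0
        · rw [e0, h.path.mem_seg_iff (by omega) (by omega)]; omega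
        · rcases Nat.lt_or_ge l t with h1 | h1
          · rw [show t = l + 1 by omega, e1, h.path.mem_seg_iff (by omega) (by omega)]; omega
          · rintro ⟨s, ⟨hs1, hs2⟩, e⟩
            exact hpq t h0 h1 ⟨s, ⟨by omega, by omega⟩, e⟩
      · rw [e0]
        exact ⟨_, rfl, q 1, mem_seg_of_le le_rfl (by omega), h.path.adj 0 (by omega)⟩
      · rw [e1]
        exact ⟨_, rfl, q k, mem_seg_of_le (by omega) le_rfl, (h.path.adj k (by omega)).symm⟩
      · rintro ⟨_, rfl, _, ⟨s, ⟨hs1, hs2⟩, rfl⟩, e⟩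
        exact h.not_adj_of_not_mem hs1 hs2 (hpq t ht htl) e.symm
    have hch := hc.chordPath (by rwa [e0, e1])
    obtain ⟨a, ha, b, hb, hbi, hab⟩ := h2.exists_adj cU.1 (hpU i (by omega)) (hpU 0 (by omega))
      (hp.ne 0 i hi (by omega))
    have hUK : ¬ G.Touch (G.compIn R u) (seg q 1 k) := by
      rintro ⟨c, hc, _, ⟨s, ⟨hs1, hs2⟩, rfl⟩, e⟩
      exact h.not_adj_of_not_mem hs1 hs2 hc.1.1 e.symm
    refine hUK (hG.touch_of_chordPath hch cU (by simpa using hpU 0 (by omega))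
      (by simpa using hpU (l + 1) le_rfl) ?_ (fun t _ ht => hpU t (by omega)) hi hil
      ⟨u, mem_compIn_self huR, _, rfl, hu.symm⟩ ?_).2.2.1
    · rw [Set.disjoint_left]
      rintro _ ⟨s, ⟨hs1, hs2⟩, rfl⟩
      exact hqU s (by omega)
    · obtain ⟨t, ht, rfl⟩ : ∃ t, t ≤ l + 1 ∧ b = p t := by
        by_contra! hbp
        have hbq : b ∈ seg q 0 (k + 1) := by
          by_contra hbq
          exact hb (compIn_closed ha ⟨hbq, hbp⟩ hab)
        rcases h.eq_of_adj ha.1.1 hbq hab with e | e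
        · exact hbp 0 (by omega) (e.trans e0.symm)
        · exact hbp (l + 1) le_rfl (e.trans e1.symm)
      have tt : G.Touch (G.compIn R u) {p t} := ⟨a, ha, _, rfl, hab⟩
      rcases Nat.eq_zero_or_pos t with rfl | h0
      · exact Or.inl tt
      · rcases Nat.lt_or_ge l t with h1 | h1
        · rw [show t = l + 1 by omega] at tt
          exact Or.inr (Or.inl tt)
        · exact Or.inr (Or.inr (Or.inr ⟨t, h0, h1, fun e => hbi (e ▸ rfl), tt⟩))
  -- The two paths form a hole on which both ends and `p i` are attached. By `attached` the three
  -- are consecutive with `p i` in the middle, so `p i` sees both ends although `2 ≤ l`.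
  · obtain ⟨c, hc, hcq, hcp⟩ := exists_isHole h.path hp.reverse (l := l) h.two_le (by omega)
      (by simpa using e1) (by simpa using e0) hadj
      (fun s t hs ht htl e => hpq (l + 1 - t) (by omega) (by omega)
        ⟨s, ⟨by omega, hs⟩, e⟩)
      (fun s t hs hsk ht htl e => h.not_adj_of_not_mem hs hsk (hpq (l + 1 - t) (by omega)
        (by omega)) e)
    have hrange : ∀ v ∈ Set.range c, v ∈ seg q 0 (k + 1) ∨ ∃ t, t ≤ l + 1 ∧ v = p t := by
      rintro _ ⟨s, rfl⟩
      obtain ⟨d, hd, e⟩ := hc.exists_eq 0 s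
      rw [e, zero_add]
      rcases Nat.lt_or_ge (k + 1) d with h1 | h1
      · right
        refine ⟨l + 1 - (d - (k + 1)), by omega, ?_⟩
        rw [← hcp _ (by omega)]
        congr 1
        omega
      · rw [hcq d h1]
        exact Or.inl (mem_seg_of_le (by omega) h1)
    have hur : u ∉ Set.range c := fun hm => (hrange u hm).elim huq fun ⟨t, ht, e⟩ => hup t ht e
    have hpi : p i = c (k + 1 + (l + 1 - i)) := by
      rw [hcp _ (by omega)]
      congr 1
      omega
    have hx : ∃ w ∉ Set.range c, G.Adj (q 0) w := by
      -- Two neighbors off the old path are needed, since `p 1` is one of them but lies on the hole.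
      obtain ⟨w, hw, hwz, hadw⟩ := h.left hadj (p 1)
      refine ⟨w, fun hm => ?_, hadw⟩
      rcases hrange w hm with h' | ⟨t, ht, rfl⟩
      · exact hw h'
      · have h1 : t ≠ 1 := fun e => hwz (e ▸ rfl)
        have h0 : t ≠ 0 := by rintro rfl; rw [e0] at hadw; exact hadw.ne rfl
        rw [← e0] at hadw hadj
        rw [← e1] at hadj
        exact hp.not_adj' (by omega) ht (Or.inr (Or.inr hadj)) hadw
    have hy : ∃ w ∉ Set.range c, G.Adj (q (k + 1)) w := by
      obtain ⟨w, hw, hwz, hadw⟩ := h.right hadj (p l)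
      refine ⟨w, fun hm => ?_, hadw⟩
      rcases hrange w hm with h' | ⟨t, ht, rfl⟩
      · exact hw h'
      · have h1 : t ≠ l := fun e => hwz (e ▸ rfl)
        have h0 : t ≠ l + 1 := by rintro rfl; rw [e1] at hadw; exact hadw.ne rfl
        rw [← e1] at hadw hadj
        rw [← e0] at hadj
        exact hp.not_adj' (by omega) le_rfl (Or.inr (Or.inr hadj)) hadw.symm
    rcases hc.attached hG h2 with hno | ⟨o, j, hj, hjn, -, -, hatt⟩
    · exact hno _ u hur (hpi ▸ hu)
    · obtain ⟨a, ha, ea⟩ := hc.exists_eq o 0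
      obtain ⟨b, hb, eb⟩ := hc.exists_eq o (k + 1)
      obtain ⟨d, hd, ed⟩ := hc.exists_eq o (k + 1 + (l + 1 - i))
      rw [hcq 0 (by omega)] at ea
      rw [hcq (k + 1) le_rfl] at eb
      rw [← hpi] at ed
      have h1 := hatt a ha (by rwa [← ea])
      have h2 := hatt b hb (by rwa [← eb])
      have h3 := hatt d hd ⟨u, hur, by rwa [← ed]⟩
      have hab : a ≠ b := by
        rintro rfl
        exact h.path.ne 0 (k + 1) (by omega) le_rfl (ea.trans eb.symm)
      have had : a ≠ d := by
        rintro rfl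
        exact hp.ne 0 i hi (by omega) (e0.trans (ea.trans ed.symm))
      have hbd : b ≠ d := by
        rintro rfl
        exact hp.ne i (l + 1) (by omega) le_rfl (ed.trans (eb.symm.trans e1.symm))
      have hA : ∀ s, G.Adj (c (o + s)) (c (o + s + 1)) := fun s => hc.adj _
      have hj2 : j = 2 := by omega
      have hd1 : d = 1 := by
        by_contra hd1
        have : a = b + 1 ∨ b = a + 1 := by omega
        rcases this with rfl | rfl
        · exact hadj (by rw [ea, eb]; exact (hA b).symm)
        · exact hadj (by rw [ea, eb]; exact hA a)
      have hadx : G.Adj (p i) (p 0) ∧ G.Adj (p i) (p (l + 1)) := by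
        rw [e0, e1, ea, eb, ed, hd1]
        have : (a = 0 ∧ b = 2) ∨ (a = 2 ∧ b = 0) := by omega
        rcases this with ⟨rfl, rfl⟩ | ⟨rfl, rfl⟩
        · exact ⟨(hA 0).symm, hA 1⟩
        · exact ⟨hA 1, (hA 0).symm⟩
      have i1 := (hp.adj_iff (by omega) (by omega) hi (by omega)).1 hadx.1
      have i2 := (hp.adj_iff (by omega) le_rfl hi (by omega)).1 hadx.2
      omega

end Terminal

end Structure
-- Components off a terminal path and the structure of 2-connected graphs.
section Structure

variable {V : Type*} {G : SimpleGraph V} {q : ℕ → V} {k : ℕ}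

theorem Gap.symm {x y : V} {Q K D : Set V} (h : Gap G x y Q K D) (hx : G.Touch {x} K) :
    Gap G y x Q K D :=
  ⟨h.cQ, h.cK, h.cD, h.sub, h.ne.symm, h.yQ, h.xQ, h.yK, h.xK, h.dQK, h.tyQ, h.txQ, hx, h.nQK,
    h.ny, h.nx, fun v hv hv' ht => (h.near v hv hv' ht).symm, fun S hS cS hy hx => by
      obtain ⟨m, hm, h1, h2⟩ := h.common S hS cS hx hy
      exact ⟨m, hm, h2, h1⟩⟩

namespace Terminal

/-- If neither edge required by `Gap.false_of_left_common` is present, the path is prolonged by `m`,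
which is adjacent to `q 0`; then `{n} ∪ D` plays the role of `K`. The former end `q (k + 1)` is now
an inner vertex and has a further neighbor off the path. The component of this neighbor would have
to see `q 1`, a vertex of degree two. -/
theorem false_of_left_common (hG : G.GemFree) (h2 : G.TwoConn) (h : Terminal G q k)
    {Q K D : Set V} (hgap : Gap G (q 0) (q (k + 1)) Q K D) (hK : ∀ v ∈ K, v ∉ seg q 0 (k + 1))
    {n m : V} (hn : n ∈ K) (hm : m ∈ K) (nD : G.Touch {n} D) (mD : G.Touch {m} D)
    (xn : G.Adj (q 0) n) (yn : ¬ G.Adj (q (k + 1)) n) (xm : G.Adj (q 0) m)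
    (ym : G.Adj (q (k + 1)) m) : False := by
  have hk := h.two_le
  by_cases hor : G.Adj n m ∨ G.Adj (q 0) (q (k + 1))
  · exact hgap.false_of_left_common hG hn hm nD mD xn yn xm ym hor
  push Not at hor
  obtain ⟨hnm, hxy⟩ := hor
  have hqm : ∀ t, t ≤ k + 1 → q t ≠ m := fun t ht e => hK m hm (e ▸ mem_seg_of_le (by omega) ht)
  have hnD : {n} ∪ D ⊆ K := Set.union_subset (by simpa) hgap.sub
  have hmn : m ∉ {n} ∪ D := by
    rintro (rfl | e)
    exacts [yn ym, hgap.not_mem_of_adj_left xm e]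
  set p : ℕ → V := fun t => if t ≤ k + 1 then q t else m with hp
  have p1 : ∀ t, t ≤ k + 1 → p t = q t := fun t ht => by simp [hp, ht]
  have p2 : p (k + 2) = m := by simp [hp]
  have hpK : ∀ t, t ≤ k + 1 → p t ∉ {n} ∪ D := fun t ht e =>
    hK _ (hnD e) (p1 t ht ▸ mem_seg_of_le (by omega) ht)
  have hpath : IndPath G p (k + 1 + 1) := by
    refine ⟨fun i j hij hj => ?_, fun i hi => ?_, fun i j hij hj hor => ?_⟩
    · rw [p1 i (by omega)]
      rcases Nat.lt_or_ge (k + 1) j with hj' | hj'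
      · rw [show j = k + 2 by omega, p2]
        exact hqm i (by omega)
      · rw [p1 j hj']
        exact h.path.ne i j hij hj'
    · rw [p1 i (by omega)]
      rcases Nat.lt_or_ge i (k + 1) with hi' | hi'
      · rw [p1 _ hi']
        exact h.path.adj i hi'
      · rw [show i = k + 1 by omega, p2]
        exact ym
    · rw [p1 i (by omega)]
      rcases Nat.lt_or_ge (k + 1) j with hj' | hj'
      · rw [show j = k + 2 by omega, p2]
        exact h.not_adj_of_not_mem (by omega) (by omega) (hK m hm)
      · rw [p1 j hj']
        exact h.path.not_adj' hij hj' (Or.inr (Or.inr hxy))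
  have hch : ChordPath G p (k + 1) {q 0} {m} ({n} ∪ D) := by
    refine ⟨hpath, by omega, conn_singleton _, conn_singleton _,
      (conn_singleton _).union hgap.cD nD, p1 0 (by omega), p2, ?_, ?_, ?_, fun i hi hik => ?_,
      fun i hi hik => ?_, fun i hi hik => hpK i hik, by simpa, ⟨_, rfl, n, by simp, xn⟩,
      mD.mono subset_rfl Set.subset_union_right, fun i hi hik => ?_, fun i hi hik => ?_,
      fun i hi hik => ?_⟩
    · simpa using hqm 0 (by omega)
    · rw [Set.disjoint_singleton_left, ← p1 0 (by omega)]
      exact hpK 0 (by omega)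
    · rwa [Set.disjoint_singleton_left]
    · rw [p1 i hik]
      exact (h.path.ne 0 i hi hik).symm
    · rw [p1 i hik]
      exact hqm i hik
    · rw [p1 i hik, touch_singleton_singleton]
      exact h.path.not_adj' hi hik (Or.inr (Or.inr hxy))
    · rw [p1 i hik.le, touch_singleton_singleton]
      exact fun e => h.not_adj_of_not_mem hi (by omega) (hK m hm) e.symm
    · rw [p1 i hik]
      rcases Nat.lt_or_ge k i with hi' | hi'
      · rw [show i = k + 1 by omega, touch_union_left]
        rintro (e | e)
        exacts [yn (touch_singleton_singleton.1 e).symm, hgap.ny e.symm]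
      · rintro ⟨v, hv, _, rfl, e⟩
        exact h.not_adj_of_not_mem hi hi' (hK v (hnD hv)) e.symm
  obtain ⟨w, hw, hwm, yw⟩ := h.right hxy m
  set R : Set V := {v | v ∉ seg q 0 (k + 1) ∧ v ≠ m ∧ v ∉ {n} ∪ D} with hR
  have hwR : w ∈ R := by
    refine ⟨hw, hwm, ?_⟩
    rintro (rfl | e)
    exacts [yn yw, hgap.not_mem_of_adj_right yw e]
  have cU := conn_compIn (G := G) hwR
  have hqU : ∀ t, t ≤ k + 1 → q t ∉ G.compIn R w := fun t ht e =>
    e.1.1 (mem_seg_of_le (by omega) ht)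
  obtain ⟨a, ha, b, hb, hby, hab⟩ := h2.exists_adj cU.1 (hqU (k + 1) le_rfl) (hqU 0 (by omega))
    (h.path.ne 0 (k + 1) (by omega) le_rfl)
  have hother : G.Touch (G.compIn R w) {q 0} ∨ G.Touch (G.compIn R w) {m} ∨
      G.Touch (G.compIn R w) ({n} ∪ D) := by
    by_cases h1 : b ∈ seg q 0 (k + 1)
    · rcases h.eq_of_adj ha.1.1 h1 hab with rfl | rfl
      · exact Or.inl ⟨a, ha, _, rfl, hab⟩
      · exact absurd rfl hby
    by_cases h3 : b = m
    · exact Or.inr (Or.inl ⟨a, ha, b, h3, hab⟩)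
    by_cases h4 : b ∈ {n} ∪ D
    · exact Or.inr (Or.inr ⟨a, ha, b, h4, hab⟩)
    exact absurd (compIn_closed ha ⟨h1, h3, h4⟩ hab) hb
  have := hG.touch_of_chordPath hch cU (by simpa using hqU 0 (by omega))
    (by simpa using fun e : m ∈ G.compIn R w => e.1.2.1 rfl)
    (Set.disjoint_right.2 fun v hv => hv.1.2.2)
    (fun t _ ht => by rw [p1 t ht]; exact hqU t ht) (i := k + 1) (by omega) le_rfl
    (by rw [p1 _ le_rfl]; exact ⟨w, mem_compIn_self hwR, _, rfl, yw.symm⟩) (by tauto)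
  obtain ⟨a, ha, _, rfl, e⟩ := this.2.2.2.1
  rw [p1 1 (by omega)] at e
  exact h.not_adj_of_not_mem one_pos (by omega) ha.1.1 e.symm

/-- A component off the path either consists of vertices of degree two or lies in the neighborhood
of the ends of the path. -/
theorem component (hG : G.GemFree) (h2 : G.TwoConn) (h : Terminal G q k) {u : V}
    (hu : u ∉ seg q 0 (k + 1)) :
    (∀ w ∈ G.compIn (seg q 0 (k + 1))ᶜ u, ∃ a b, ∀ z, G.Adj w z → z = a ∨ z = b) ∨
      ∀ w ∈ G.compIn (seg q 0 (k + 1))ᶜ u, G.Adj (q 0) w ∨ G.Adj (q (k + 1)) w := by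
  have hk := h.two_le
  set K := G.compIn (seg q 0 (k + 1))ᶜ u with hKdef
  have hK : ∀ v ∈ K, v ∉ seg q 0 (k + 1) := fun v hv => hv.1
  have cK : G.Conn K := conn_compIn (S := (seg q 0 (k + 1))ᶜ) hu
  have hqK : ∀ t, t ≤ k + 1 → q t ∉ K := fun t ht e => hK _ e (mem_seg_of_le (by omega) ht)
  have txK := h.touch_left h2 hu
  have tyK := h.touch_right h2 hu
  have hxy := h.path.ne 0 (k + 1) (by omega) le_rfl
  by_cases hlong : ∃ l p, 2 ≤ l ∧ IndPath G p (l + 1) ∧ p 0 = q 0 ∧ p (l + 1) = q (k + 1) ∧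
      ∀ i, 0 < i → i ≤ l → p i ∈ K
  · left
    obtain ⟨l, p, hl, hp, e0, e1, hpK⟩ := hlong
    have hin := fun i hi hil z => h.long_path_inner hG h2 hl hp e0 e1
      (fun i hi hil => hK _ (hpK i hi hil)) (i := i) hi hil (u := z)
    -- The interior of the long path is closed under adjacency in `K`, so it is all of `K`.
    have := cK.2 {v | ∃ i, 0 < i ∧ i ≤ l ∧ p i = v} ⟨p 1, hpK 1 one_pos (by omega), 1, one_pos,
      by omega, rfl⟩ ?_
    · intro w hw
      obtain ⟨i, hi, hil, rfl⟩ := this hw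
      exact ⟨_, _, fun z => hin i hi hil z⟩
    · rintro _ - ⟨i, hi, hil, rfl⟩ b hb hab
      have hb0 : ∀ t, b = p t → t ≠ 0 ∧ t ≠ l + 1 := by
        rintro t rfl
        constructor
        · rintro rfl; exact hqK 0 (by omega) (e0 ▸ hb)
        · rintro rfl; exact hqK (k + 1) le_rfl (e1 ▸ hb)
      rcases hin i hi hil b hab with e | e
      · have := hb0 _ e
        exact ⟨i - 1, by omega, by omega, e.symm⟩
      · have := hb0 _ e
        exact ⟨i + 1, by omega, by omega, e.symm⟩
  right
  by_contra! hcon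
  obtain ⟨w, hw, hwx, hwy⟩ := hcon
  set R : Set V := {v | v ∈ K ∧ ¬ G.Adj (q 0) v ∧ ¬ G.Adj (q (k + 1)) v} with hR
  have hwR : w ∈ R := ⟨hw, hwx, hwy⟩
  set D := G.compIn R w with hD
  have hDK : D ⊆ K := fun v hv => hv.1.1
  have hgap : Gap G (q 0) (q (k + 1)) (seg q 1 k) K D := by
    refine ⟨h.path.conn_seg (by omega) (by omega), cK, conn_compIn hwR, hDK, hxy, ?_, ?_,
      hqK 0 (by omega), hqK _ le_rfl, ?_, ⟨_, rfl, q 1, mem_seg_of_le le_rfl (by omega),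
      h.path.adj 0 (by omega)⟩, ⟨_, rfl, q k, mem_seg_of_le (by omega) le_rfl,
      (h.path.adj k (by omega)).symm⟩, tyK, ?_, ?_, ?_, fun v hv hvD ht => ?_,
      fun S hS cS hx hy => ?_⟩
    · rw [h.path.mem_seg_iff (by omega) (by omega)]; omega
    · rw [h.path.mem_seg_iff (by omega) (by omega)]; omega
    · rw [Set.disjoint_left]
      rintro _ ⟨t, ⟨h1, h3⟩, rfl⟩
      exact hqK t (by omega)
    · rintro ⟨_, ⟨t, ⟨h1, h3⟩, rfl⟩, v, hv, e⟩
      exact h.not_adj_of_not_mem h1 h3 (hK v hv) e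
    · rintro ⟨_, rfl, v, hv, e⟩
      exact hv.1.2.1 e
    · rintro ⟨_, rfl, v, hv, e⟩
      exact hv.1.2.2 e
    · obtain ⟨_, rfl, d, hd, e⟩ := ht
      by_contra! hcon
      exact hvD (compIn_closed hd ⟨hv, hcon⟩ e.symm)
    · obtain ⟨l, p, hl, e0, e1, hp, hpS⟩ := exists_indPath cS (fun e => hqK 0 (by omega) (hS e))
        (fun e => hqK _ le_rfl (hS e)) hxy hx hy
      rcases Nat.lt_or_ge 1 l with hl' | hl'
      · exact absurd ⟨l, p, hl', hp, e0, e1, fun i hi hil => hS (hpS i hi hil)⟩ hlong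
      · have : l = 1 := by omega
        subst this
        refine ⟨p 1, hpS 1 one_pos le_rfl, ?_, ?_⟩
        · rw [← e0]; exact hp.adj 0 (by omega)
        · rw [← e1]; exact (hp.adj 1 (by omega)).symm
  have hnb : ∀ v, v ∉ D → (∀ b ∈ D, G.Adj b v → v ∈ K) := by
    intro v hv b hb e
    refine compIn_closed (hDK hb) (fun hvQ => ?_) e
    rcases h.eq_of_adj (hK b (hDK hb)) hvQ e with rfl | rfl
    · exact hb.1.2.1 e.symm
    · exact hb.1.2.2 e.symm
  -- By 2-connectivity `D` has two outside neighbors. Both lie in `K` and see an end of the path,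
  -- and every combination of ends is contradictory.
  obtain ⟨a, ha, n, hnD, hnx, han⟩ := h2.exists_adj (conn_compIn (G := G) hwR).1
    (fun e => hqK 0 (by omega) (hDK e)) (fun e => hqK _ le_rfl (hDK e)) hxy.symm
  obtain ⟨a', ha', n', hnD', hnn', han'⟩ := h2.exists_adj (conn_compIn (G := G) hwR).1 hnD
    (fun e => hqK 0 (by omega) (hDK e)) hnx.symm
  have hn := hnb n hnD a ha han
  have hn' := hnb n' hnD' a' ha' han'
  have tn : G.Touch {n} D := ⟨n, rfl, a, ha, han.symm⟩
  have tn' : G.Touch {n'} D := ⟨n', rfl, a', ha', han'.symm⟩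
  have hgap' := hgap.symm txK
  have γ := fun n m hn hm nD mD xn yn xm ym => h.false_of_left_common hG h2 hgap hK (n := n)
    (m := m) hn hm nD mD xn yn xm ym
  have γ' : ∀ n m, n ∈ K → m ∈ K → G.Touch {n} D → G.Touch {m} D → G.Adj (q (k + 1)) n →
      ¬ G.Adj (q 0) n → G.Adj (q (k + 1)) m → G.Adj (q 0) m → False :=
    fun n m hn hm nD mD yn xn ym xm => h.reverse.false_of_left_common hG h2 (Q := seg q 1 k)
      (K := K) (D := D) (by simpa using hgap') (fun v hv => by rw [seg_reverse]; exact hK v hv)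
      hn hm nD mD (by simpa using yn) (by simpa using xn) (by simpa using ym) (by simpa using xm)
  by_cases xn : G.Adj (q 0) n
  · by_cases yn : G.Adj (q (k + 1)) n
    · by_cases xn' : G.Adj (q 0) n'
      · by_cases yn' : G.Adj (q (k + 1)) n'
        · exact hgap.false_of_two_common hG hnn' hn' hn tn' tn xn' yn' xn yn
        · exact γ n' n hn' hn tn' tn xn' yn' xn yn
      · have yn' := (hgap.near n' hn' hnD' tn').resolve_left xn'
        exact γ' n' n hn' hn tn' tn yn' xn' yn xn
    · by_cases xn' : G.Adj (q 0) n'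
      · by_cases yn' : G.Adj (q (k + 1)) n'
        · exact γ n n' hn hn' tn tn' xn yn xn' yn'
        · exact hgap.false_of_two_left hG γ hnn' hn' hn tn' tn xn' yn' xn yn
      · have yn' := (hgap.near n' hn' hnD' tn').resolve_left xn'
        exact hgap.false_of_left_right hn hn' tn tn' xn yn xn' yn'
  · have yn := (hgap.near n hn hnD tn).resolve_left xn
    by_cases xn' : G.Adj (q 0) n'
    · by_cases yn' : G.Adj (q (k + 1)) n'
      · exact γ' n n' hn hn' tn tn' yn xn yn' xn'
      · exact hgap.false_of_left_right hn' hn tn' tn xn' yn' xn yn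
    · have yn' := (hgap.near n' hn' hnD' tn').resolve_left xn'
      exact hgap'.false_of_two_left hG γ' hnn' hn' hn tn' tn yn' xn' yn xn

end Terminal

/-- No four vertices of `A` induce a path. -/
def NoP4 (G : SimpleGraph V) (A : Set V) : Prop :=
  ∀ a ∈ A, ∀ b ∈ A, ∀ c ∈ A, ∀ d ∈ A, G.Adj a b → G.Adj b c → G.Adj c d → ¬ G.Adj a c →
    ¬ G.Adj b d → ¬ G.Adj a d → False

theorem Terminal.noP4 (hG : G.GemFree) (h : Terminal G q k) {A : Set V}
    (hA : ∀ v ∈ A, v ∉ seg q 0 (k + 1) ∧ (G.Adj (q 0) v ∨ G.Adj (q (k + 1)) v)) : NoP4 G A := by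
  intro a ha b hb c hc d hd hab hbc hcd hac hbd had
  have dQ : ∀ v ∈ A, Disjoint {v} (seg q 0 (k + 1)) := fun v hv => by simpa using (hA v hv).1
  have tQ : ∀ v ∈ A, G.Touch (seg q 0 (k + 1)) {v} := by
    intro v hv
    rcases (hA v hv).2 with e | e
    · exact ⟨_, mem_seg_of_le le_rfl (by omega), v, rfl, e⟩
    · exact ⟨_, mem_seg_of_le (by omega) le_rfl, v, rfl, e⟩
  have nac : a ≠ c := by rintro rfl; exact had hcd
  have nbd : b ≠ d := by rintro rfl; exact had hab
  have nad : a ≠ d := by rintro rfl; exact hbd hab.symm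
  exact hG.false_of_bags (A := {a}) (B := {b}) (C := {c}) (D := {d}) (conn_singleton _)
    (conn_singleton _) (conn_singleton _) (conn_singleton _)
    (h.path.conn_seg (Nat.zero_le _) le_rfl) (by simpa using hab.ne) (by simpa) (by simpa)
    (dQ a ha) (by simpa using hbc.ne) (by simpa) (dQ b hb) (by simpa using hcd.ne) (dQ c hc)
    (dQ d hd) (by simpa) (by simpa) (by simpa) (tQ a ha) (tQ b hb) (tQ c hc) (tQ d hd) (by simpa)
    (by simpa) (by simpa)

/-- A 2-connected graph without a gem consists of at most six vertices, a part without induced paths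
on four vertices, and a part of vertices of degree two. -/
theorem GemFree.exists_structure [Finite V] (hG : G.GemFree) (h2 : G.TwoConn) :
    ∃ X A : Set V, X.ncard ≤ 6 ∧ Disjoint X A ∧ (∀ a ∈ A, ∀ b ∉ A, b ∉ X → ¬ G.Adj a b) ∧
      NoP4 G A ∧ ∀ v ∉ A, v ∉ X → ∃ a b, ∀ u, G.Adj v u → u = a ∨ u = b := by
  by_cases hP : NoP4 G Set.univ
  · exact ⟨∅, Set.univ, by simp, by simp, by simp, hP, by simp⟩
  obtain ⟨q, k, K, hC⟩ : ∃ q k K, Conf G q k K := by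
    simp only [NoP4, not_forall] at hP
    obtain ⟨a, -, b, -, c, -, d, -, hab, hbc, hcd, hac, hbd, had, -⟩ := hP
    refine exists_conf hG h2 hab hbc hcd hac hbd had ?_ ?_ ?_
    · rintro rfl; exact had hcd
    · rintro rfl; exact had hab
    · rintro rfl; exact hbd hab.symm
  rcases hC.terminal_or hG h2 with h | h | ⟨q, k, h⟩
  · exact ⟨Set.univ, ∅, by rwa [Set.ncard_univ], by simp, by simp, by simp [NoP4], by simp⟩
  · exact ⟨∅, ∅, by simp, by simp, by simp, by simp [NoP4], fun v _ _ => h v⟩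
  -- `A` collects the components all of whose vertices see an end; only the two ends can attach it
  -- to the rest.
  set A : Set V := {v | v ∉ seg q 0 (k + 1) ∧ ∀ w ∈ G.compIn (seg q 0 (k + 1))ᶜ v,
    G.Adj (q 0) w ∨ G.Adj (q (k + 1)) w} with hA
  refine ⟨{q 0, q (k + 1)}, A, (Set.ncard_insert_le _ _).trans (by simp), ?_, ?_, ?_, ?_⟩
  · rw [Set.disjoint_left]
    rintro v (rfl | rfl) hv
    · exact hv.1 (mem_seg_of_le le_rfl (by omega))
    · exact hv.1 (mem_seg_of_le (by omega) le_rfl)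
  · intro a ha b hbA hbX hab
    have hbQ : b ∉ seg q 0 (k + 1) := fun hbQ => hbX (h.eq_of_adj ha.1 hbQ hab)
    refine hbA ⟨hbQ, fun w hw => ha.2 w ?_⟩
    have hba : b ∈ G.compIn (seg q 0 (k + 1))ᶜ a :=
      compIn_closed (mem_compIn_self (S := (seg q 0 (k + 1))ᶜ) ha.1) hbQ hab
    exact (conn_compIn (S := (seg q 0 (k + 1))ᶜ) hbQ).subset_compIn (compIn_subset _ _)
      (compIn_closed (mem_compIn_self (S := (seg q 0 (k + 1))ᶜ) hbQ) ha.1 hab.symm) hw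
  · exact h.noP4 hG fun v hv => ⟨hv.1, hv.2 v (mem_compIn_self (S := (seg q 0 (k + 1))ᶜ) hv.1)⟩
  · intro v hvA hvX
    by_cases hvQ : v ∈ seg q 0 (k + 1)
    · obtain ⟨t, ⟨-, ht⟩, rfl⟩ := hvQ
      have h0 : t ≠ 0 := by rintro rfl; exact hvX (Or.inl rfl)
      have h1 : t ≠ k + 1 := by rintro rfl; exact hvX (Or.inr rfl)
      exact ⟨_, _, h.inner t (by omega) (by omega)⟩
    · rcases h.component hG h2 hvQ with hc | hc
      · exact hc v (mem_compIn_self (S := (seg q 0 (k + 1))ᶜ) hvQ)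
      · exact absurd ⟨hvQ, hc⟩ hvA

end Structure
-- Hierarchical partitions of bounded diversity.
section Tree

variable {V : Type*} {G : SimpleGraph V}

/-- `S` has a hierarchical partition into singletons all of whose parts with at least two blocks
satisfy `p`. -/
inductive PartTree (p : Set V → Prop) : Set V → Prop
  | empty : PartTree p ∅
  | single (v : V) : PartTree p {v}
  | union {S T : Set V} (hd : Disjoint S T) (hp : p (S ∪ T)) (hS : PartTree p S)
      (hT : PartTree p T) : PartTree p (S ∪ T)

theorem PartTree.inter {p p' : Set V → Prop} {S Z : Set V} (h : PartTree p S)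
    (hp : ∀ Y, p Y → p' (Y ∩ Z)) : PartTree p' (S ∩ Z) := by
  induction h with
  | empty => simpa using PartTree.empty
  | single v =>
    by_cases hv : v ∈ Z
    · simpa [hv] using PartTree.single v
    · simpa [hv] using PartTree.empty
  | union hd hpY _ _ ihS ihT =>
    rw [Set.union_inter_distrib_right]
    refine PartTree.union (hd.mono Set.inter_subset_left Set.inter_subset_left) ?_ ihS ihT
    rw [← Set.union_inter_distrib_right]
    exact hp _ hpY

theorem PartTree.of_superset [Finite V] {p : Set V → Prop} {Y : Set V} (h : PartTree p Y)
    (hp : ∀ Z, Y ⊆ Z → p Z) : PartTree p Set.univ := by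
  have key : ∀ S : Set V, S.Finite → PartTree p (S ∪ Y) := by
    intro S hS
    induction S, hS using Set.Finite.induction_on with
    | empty => simpa using h
    | @insert v S _ _ ih =>
      rw [Set.insert_union]
      by_cases hv : v ∈ S ∪ Y
      · rwa [Set.insert_eq_of_mem hv]
      · rw [Set.insert_eq]
        exact PartTree.union (by simpa using hv)
          (hp _ (Set.subset_union_right.trans Set.subset_union_right)) (PartTree.single v) ih
  simpa using key _ Set.finite_univ

/-- The vertices of `Y` can be colored by `C` such that vertices of the same color have the same
neighbors outside `Y`. -/
def Div (C : Type) (G : SimpleGraph V) (Y : Set V) : Prop :=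
  ∃ c : V → C, ∀ u ∈ Y, ∀ w ∈ Y, c u = c w → ∀ z ∉ Y, G.Adj u z ↔ G.Adj w z

/-- A finite set of colors. -/
abbrev Code : Type := Option (Fin 6) × Set (Fin 6)

theorem exists_injOn_fin [Finite V] {S : Set V} {n : ℕ} [NeZero n] (hS : S.ncard ≤ n) :
    ∃ f : V → Fin n, Set.InjOn f S := by
  classical
  have := Fintype.ofFinite S
  have hcard : Fintype.card S ≤ Fintype.card (Fin n) := by
    rwa [← Nat.card_eq_fintype_card, Nat.card_coe_set_eq, Fintype.card_fin]
  obtain ⟨e⟩ := Function.Embedding.nonempty_of_card_le hcard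
  refine ⟨fun v => if h : v ∈ S then e ⟨v, h⟩ else 0, fun u hu w hw h => ?_⟩
  simp only [hu, hw, dif_pos] at h
  exact congrArg Subtype.val (e.injective h)

/-- The color of a vertex names it if it belongs to the small set `T` of exceptional vertices, and
records its neighbors in the small set `X`. All remaining differences are excluded by `h`. -/
theorem div_of_exceptional [Finite V] {X T Y : Set V} (hX : X.ncard ≤ 6) (hT : T.ncard ≤ 6)
    (h : ∀ u ∈ Y, u ∉ T → ∀ w ∈ Y, w ∉ T → ∀ z ∉ Y, z ∉ X → (G.Adj u z ↔ G.Adj w z)) :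
    Div Code G Y := by
  classical
  obtain ⟨f, hf⟩ := exists_injOn_fin hT
  obtain ⟨g, hg⟩ := exists_injOn_fin hX
  refine ⟨fun u => (if u ∈ T then some (f u) else none, {i | ∃ x ∈ X, g x = i ∧ G.Adj u x}), ?_⟩
  have key : ∀ u w z, z ∈ X → {i | ∃ x ∈ X, g x = i ∧ G.Adj u x} =
      {i | ∃ x ∈ X, g x = i ∧ G.Adj w x} → G.Adj u z → G.Adj w z := by
    intro u w z hz e huz
    have : g z ∈ {i | ∃ x ∈ X, g x = i ∧ G.Adj u x} := ⟨z, hz, rfl, huz⟩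
    rw [e] at this
    obtain ⟨x, hx, hgx, hwx⟩ := this
    exact hg hx hz hgx ▸ hwx
  intro u hu w hw e z hz
  rw [Prod.mk.injEq] at e
  obtain ⟨e1, e2⟩ := e
  by_cases huT : u ∈ T
  · by_cases hwT : w ∈ T
    · simp only [huT, hwT, if_true, Option.some.injEq] at e1
      rw [hf huT hwT e1]
    · simp [huT, hwT] at e1
  · by_cases hwT : w ∈ T
    · simp [huT, hwT] at e1
    · by_cases hzX : z ∈ X
      · exact ⟨key u w z hzX e2, key w u z hzX e2.symm⟩
      · exact h u hu huT w hw hwT z hz hzX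

/-- The edges from `Y` to the rest of `B`. -/
def cut (G : SimpleGraph V) (B Y : Set V) : Set (V × V) :=
  {e | e.1 ∈ Y ∧ e.2 ∈ B ∧ e.2 ∉ Y ∧ G.Adj e.1 e.2}

/-- Vertices are added one at a time. The next one is the far end of a cut edge if there is any:
this edge leaves the cut and at most one new edge enters. From an empty cut any vertex adds at most
two edges. -/
theorem partTree_of_degree_two [Finite V] {B : Set V}
    (hB : ∀ v ∈ B, ∃ a b, ∀ u, G.Adj v u → u = a ∨ u = b) {p : Set V → Prop}
    (hp : ∀ Y ⊆ B, (G.cut B Y).ncard ≤ 2 → p Y) : PartTree p B := by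
  have key : ∀ n ≤ B.ncard, ∃ Y ⊆ B, Y.ncard = n ∧ PartTree p Y ∧ (G.cut B Y).ncard ≤ 2 := by
    intro n
    induction n with
    | zero =>
      intro _
      refine ⟨∅, by simp, by simp, PartTree.empty, ?_⟩
      simp [cut]
    | succ n ih =>
      intro hn
      obtain ⟨Y, hYB, hYn, hY, hcut⟩ := ih (by omega)
      obtain ⟨z, hz, hzY, hcut'⟩ : ∃ z ∈ B, z ∉ Y ∧ (G.cut B ({z} ∪ Y)).ncard ≤ 2 := by
        rcases (G.cut B Y).eq_empty_or_nonempty with he | ⟨⟨y, z⟩, hyz⟩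
        · obtain ⟨z, hz, hzY⟩ : ∃ z ∈ B, z ∉ Y := by
            by_contra! hcon
            have := Set.ncard_le_ncard (s := B) (t := Y) hcon
            omega
          obtain ⟨a, b, hab⟩ := hB z hz
          refine ⟨z, hz, hzY, (Set.ncard_le_ncard (t := {(z, a), (z, b)}) ?_).trans
            ((Set.ncard_insert_le _ _).trans (by simp))⟩
          rintro ⟨u, w⟩ ⟨hu, hwB, hwY, huw⟩
          rcases hu with rfl | hu
          · rcases hab w huw with rfl | rfl <;> simp
          · have : (u, w) ∈ G.cut B Y := ⟨hu, hwB, fun h => hwY (Or.inr h), huw⟩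
            simp [he] at this
        · obtain ⟨o, ho⟩ : ∃ o, ∀ u, G.Adj z u → u = y ∨ u = o := by
            obtain ⟨a, b, hab⟩ := hB z hyz.2.1
            rcases hab y hyz.2.2.2.symm with rfl | rfl
            · exact ⟨b, hab⟩
            · exact ⟨a, fun u hu => (hab u hu).symm⟩
          refine ⟨z, hyz.2.1, hyz.2.2.1, (Set.ncard_le_ncard
            (t := insert (z, o) (G.cut B Y \ {(y, z)})) ?_).trans
            ((Set.ncard_insert_le _ _).trans ?_)⟩
          · rintro ⟨u, w⟩ ⟨hu, hwB, hwY, huw⟩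
            have hwz : w ≠ z := fun h => hwY (Or.inl h)
            rcases hu with rfl | hu
            · rcases ho w huw with rfl | rfl
              · exact absurd (Or.inr hyz.1) hwY
              · simp
            · exact Or.inr ⟨⟨hu, hwB, fun h => hwY (Or.inr h), huw⟩, by simp [hwz]⟩
          · rw [Set.ncard_sdiff_singleton_of_mem hyz]
            omega
      have hsub : {z} ∪ Y ⊆ B := Set.union_subset (by simpa) hYB
      refine ⟨{z} ∪ Y, hsub, ?_, PartTree.union (by simpa) (hp _ hsub hcut') (PartTree.single z) hY,
        hcut'⟩
      rw [Set.singleton_union, Set.ncard_insert_of_notMem hzY, hYn]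
  obtain ⟨Y, hYB, hYn, hY, -⟩ := key _ le_rfl
  rwa [Set.eq_of_subset_of_ncard_le hYB hYn.ge] at hY

/-- `S` is the union of two nonempty sets with no edges or all edges between them. -/
def Splits (G : SimpleGraph V) (S : Set V) : Prop :=
  ∃ S₁ S₂ : Set V, S₁.Nonempty ∧ S₂.Nonempty ∧ Disjoint S₁ S₂ ∧ S₁ ∪ S₂ = S ∧
    ((∀ a ∈ S₁, ∀ b ∈ S₂, ¬ G.Adj a b) ∨ ∀ a ∈ S₁, ∀ b ∈ S₂, G.Adj a b)

theorem NoP4.mono {S T : Set V} (h : NoP4 G T) (hST : S ⊆ T) : NoP4 G S :=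
  fun a ha b hb c hc d hd => h a (hST ha) b (hST hb) c (hST hc) d (hST hd)

/-- The path on four vertices is self-complementary: `a, b, c, d` becomes `c, a, d, b`. -/
theorem NoP4.compl {S : Set V} (h : NoP4 G S) : NoP4 Gᶜ S := by
  intro a ha b hb c hc d hd hab hbc hcd hac hbd had
  simp only [compl_adj, not_and, not_not] at *
  have nac : a ≠ c := by rintro rfl; exact hcd.2 (had hcd.1)
  have nbd : b ≠ d := by rintro rfl; exact hab.2 (had hab.1)
  have nad : a ≠ d := by rintro rfl; exact hab.2 (hbd hab.1.symm).symm
  exact h c hc a ha d hd b hb (hac nac).symm (had nad) (hbd nbd).symm (fun e => hcd.2 e)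
    hab.2 fun e => hbc.2 e.symm

theorem splits_compl {S : Set V} : Splits Gᶜ S → Splits G S := by
  rintro ⟨S₁, S₂, h1, h2, hd, hS, h⟩
  have hne : ∀ a ∈ S₁, ∀ b ∈ S₂, a ≠ b := fun a ha b hb e => Set.disjoint_left.1 hd ha (e ▸ hb)
  refine ⟨S₁, S₂, h1, h2, hd, hS, ?_⟩
  rcases h with h | h
  · right
    intro a ha b hb
    by_contra hab
    exact h a ha b hb ((compl_adj _ _ _).2 ⟨hne a ha b hb, hab⟩)
  · left
    intro a ha b hb hab
    exact ((compl_adj _ _ _).1 (h a ha b hb)).2 hab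

theorem NoP4.splits_insert_aux {S₁ S₂ : Set V} {v w : V} (hv : v ∉ S₁ ∪ S₂)
    (h : NoP4 G (insert v (S₁ ∪ S₂))) (hd : Disjoint S₁ S₂)
    (hno : ∀ a ∈ S₁, ∀ b ∈ S₂, ¬ G.Adj a b) (hw : w ∈ S₁) (hvw : ¬ G.Adj v w)
    {c : V} (hc : c ∈ S₂) (hvc : G.Adj v c) : Splits G (insert v (S₁ ∪ S₂)) := by
  refine ⟨{s | s ∈ S₁ ∧ ¬ G.Adj v s}, insert v ({s | s ∈ S₁ ∧ G.Adj v s} ∪ S₂), ⟨w, hw, hvw⟩,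
    ⟨v, Or.inl rfl⟩, ?_, ?_, Or.inl ?_⟩
  · rw [Set.disjoint_left]
    rintro s ⟨hs, hvs⟩ (rfl | ⟨-, hvs'⟩ | hs')
    exacts [hv (Or.inl hs), hvs hvs', Set.disjoint_left.1 hd hs hs']
  · ext s
    simp only [Set.mem_union, Set.mem_insert_iff, Set.mem_ofPred_eq]
    tauto
  · rintro b ⟨hb, hvb⟩ s (rfl | ⟨hs, hvs⟩ | hs) hbs
    · exact hvb hbs.symm
    -- An edge between a nonneighbor `b` and a neighbor `s` of `v` in `S₁` would give the induced
    -- path `b, s, v, c`.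
    · exact h b (Or.inr (Or.inl hb)) s (Or.inr (Or.inl hs)) v (Or.inl rfl) c (Or.inr (Or.inr hc))
        hbs hvs.symm hvc (fun e => hvb e.symm) (hno s hs c hc) (hno b hb c hc)
    · exact hno b hb s hs hbs

theorem NoP4.splits_insert {S₁ S₂ : Set V} {v : V} (hv : v ∉ S₁ ∪ S₂)
    (h : NoP4 G (insert v (S₁ ∪ S₂))) (h1 : S₁.Nonempty) (h2 : S₂.Nonempty) (hd : Disjoint S₁ S₂)
    (hno : ∀ a ∈ S₁, ∀ b ∈ S₂, ¬ G.Adj a b) : Splits G (insert v (S₁ ∪ S₂)) := by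
  by_cases hn1 : ∀ s ∈ S₁, ¬ G.Adj v s
  · refine ⟨S₁, insert v S₂, h1, ⟨v, Or.inl rfl⟩, ?_, by rw [Set.union_insert], Or.inl ?_⟩
    · rw [Set.insert_eq, Set.disjoint_union_right]
      exact ⟨by simpa using fun e => hv (Or.inl e), hd⟩
    · rintro a ha b (rfl | hb) hab
      exacts [hn1 a ha hab.symm, hno a ha b hb hab]
  by_cases hn2 : ∀ s ∈ S₂, ¬ G.Adj v s
  · refine ⟨insert v S₁, S₂, ⟨v, Or.inl rfl⟩, h2, ?_, by rw [Set.insert_union], Or.inl ?_⟩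
    · rw [Set.insert_eq, Set.disjoint_union_left]
      exact ⟨by simpa using fun e => hv (Or.inr e), hd⟩
    · rintro a (rfl | ha) b hb hab
      exacts [hn2 b hb hab, hno a ha b hb hab]
  push Not at hn1 hn2
  obtain ⟨c₁, hc₁, hvc₁⟩ := hn1
  obtain ⟨c₂, hc₂, hvc₂⟩ := hn2
  by_cases hall : ∀ s ∈ S₁ ∪ S₂, G.Adj v s
  · refine ⟨{v}, S₁ ∪ S₂, ⟨v, rfl⟩, ⟨c₁, Or.inl hc₁⟩, by simpa using hv, by rw [Set.insert_eq],
      Or.inr ?_⟩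
    rintro _ rfl b hb
    exact hall b hb
  push Not at hall
  obtain ⟨w, hw | hw, hvw⟩ := hall
  · exact h.splits_insert_aux hv hd hno hw hvw hc₂ hvc₂
  · rw [Set.union_comm] at hv h ⊢
    exact h.splits_insert_aux hv hd.symm (fun a ha b hb e => hno b hb a ha e.symm) hw hvw hc₁ hvc₁

/-- A set of at least two vertices without induced paths on four vertices splits. -/
theorem NoP4.splits [Finite V] {S : Set V} (h : NoP4 G S) (hS : S.Nontrivial) : Splits G S := by
  induction S, S.toFinite using Set.Finite.induction_on with
  | empty => simp at hS
  | @insert v S hv _ ih =>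
    by_cases hS' : S.Nontrivial
    · obtain ⟨S₁, S₂, h1, h2, hd, rfl, hor⟩ := ih (h.mono (Set.subset_insert _ _)) hS'
      rcases hor with hno | hall
      · exact h.splits_insert hv h1 h2 hd hno
      · exact splits_compl (h.compl.splits_insert hv h1 h2 hd fun a ha b hb e =>
          ((compl_adj _ _ _).1 e).2 (hall a ha b hb))
    · rw [Set.not_nontrivial_iff] at hS'
      obtain ⟨w, hw⟩ : S.Nonempty := by
        by_contra hem
        rw [Set.not_nonempty_iff_eq_empty] at hem
        simp [hem] at hS
      have : S = {w} := hS'.eq_singleton_of_mem hw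
      subst this
      refine ⟨{v}, {w}, ⟨v, rfl⟩, ⟨w, rfl⟩, by simpa using hv, by rw [Set.insert_eq], ?_⟩
      by_cases hvw : G.Adj v w
      · exact Or.inr (by simpa)
      · exact Or.inl (by simpa)

/-- Repeated splitting produces only modules of `A`: the vertices of one side are all alike towards
the other side. -/
theorem NoP4.partTree [Finite V] {A : Set V} (hA : NoP4 G A) {p : Set V → Prop}
    (hp : ∀ Y ⊆ A, (∀ u ∈ Y, ∀ w ∈ Y, ∀ z ∈ A, z ∉ Y → (G.Adj u z ↔ G.Adj w z)) → p Y) :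
    PartTree p A := by
  have key : ∀ n, ∀ Y ⊆ A, Y.ncard = n →
      (∀ u ∈ Y, ∀ w ∈ Y, ∀ z ∈ A, z ∉ Y → (G.Adj u z ↔ G.Adj w z)) → PartTree p Y := by
    intro n
    induction n using Nat.strong_induction_on with
    | _ n ih =>
    intro Y hY hn hmod
    by_cases hnt : Y.Nontrivial
    · obtain ⟨S₁, S₂, h1, h2, hd, rfl, hor⟩ := (hA.mono hY).splits hnt
      have hlt1 : S₁.ncard < n := by
        rw [← hn]
        refine Set.ncard_lt_ncard ⟨Set.subset_union_left, fun hs => ?_⟩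
        obtain ⟨b, hb⟩ := h2
        exact Set.disjoint_left.1 hd (hs (Or.inr hb)) hb
      have hlt2 : S₂.ncard < n := by
        rw [← hn]
        refine Set.ncard_lt_ncard ⟨Set.subset_union_right, fun hs => ?_⟩
        obtain ⟨b, hb⟩ := h1
        exact Set.disjoint_left.1 hd hb (hs (Or.inl hb))
      refine PartTree.union hd (hp _ hY hmod)
        (ih _ hlt1 S₁ (Set.subset_union_left.trans hY) rfl fun u hu w hw z hz hz' => ?_)
        (ih _ hlt2 S₂ (Set.subset_union_right.trans hY) rfl fun u hu w hw z hz hz' => ?_)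
      · by_cases hz2 : z ∈ S₂
        · rcases hor with h | h
          · exact iff_of_false (h u hu z hz2) (h w hw z hz2)
          · exact iff_of_true (h u hu z hz2) (h w hw z hz2)
        · exact hmod u (Or.inl hu) w (Or.inl hw) z hz (fun e => e.elim hz' hz2)
      · by_cases hz2 : z ∈ S₁
        · rcases hor with h | h
          · exact iff_of_false (fun e => h z hz2 u hu e.symm) (fun e => h z hz2 w hw e.symm)
          · exact iff_of_true (h z hz2 u hu).symm (h z hz2 w hw).symm
        · exact hmod u (Or.inr hu) w (Or.inr hw) z hz (fun e => e.elim hz2 hz')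
    · rw [Set.not_nontrivial_iff] at hnt
      rcases hnt.eq_empty_or_singleton with rfl | ⟨v, rfl⟩
      · exact PartTree.empty
      · exact PartTree.single v
  exact key _ A subset_rfl rfl fun u _ w _ z hz hz' => absurd hz hz'

/-- A 2-connected graph without a gem has a hierarchical partition of bounded diversity. -/
theorem GemFree.exists_partTree [Finite V] (hG : G.GemFree) (h2 : G.TwoConn) :
    PartTree (Div Code G) Set.univ := by
  obtain ⟨X, A, hX, hXA, hAB, hA, hdeg⟩ := hG.exists_structure h2
  have tA : PartTree (Div Code G) A := by
    refine hA.partTree fun Y hY hmod => div_of_exceptional (T := ∅) hX (by simp) ?_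
    intro u hu _ w hw _ z hz hzX
    by_cases hzA : z ∈ A
    · exact hmod u hu w hw z hzA hz
    · exact iff_of_false (hAB u (hY hu) z hzA hzX) (hAB w (hY hw) z hzA hzX)
  have tB : PartTree (Div Code G) {v | v ∉ A ∧ v ∉ X} := by
    -- The exceptional vertices are the inner ends of the at most two cut edges; all others have
    -- outside neighbors in `X` only.
    refine partTree_of_degree_two (fun v hv => hdeg v hv.1 hv.2) fun Y hY hcut =>
      div_of_exceptional (T := Prod.fst '' G.cut {v | v ∉ A ∧ v ∉ X} Y) hX
        ((Set.ncard_image_le (Set.toFinite _)).trans (by omega)) ?_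
    have hn : ∀ u ∈ Y, u ∉ Prod.fst '' G.cut {v | v ∉ A ∧ v ∉ X} Y → ∀ z ∉ Y, z ∉ X →
        ¬ G.Adj u z := by
      intro u hu huT z hz hzX huz
      by_cases hzA : z ∈ A
      · exact hAB z hzA u (hY hu).1 (hY hu).2 huz.symm
      · exact huT ⟨(u, z), ⟨hu, ⟨hzA, hzX⟩, hz, huz⟩, rfl⟩
    exact fun u hu huT w hw hwT z hz hzX =>
      iff_of_false (hn u hu huT z hz hzX) (hn w hw hwT z hz hzX)
  have hsup : ∀ Z, A ∪ {v | v ∉ A ∧ v ∉ X} ⊆ Z → Div Code G Z := by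
    refine fun Z hZ => div_of_exceptional (T := ∅) hX (by simp) ?_
    intro u _ _ w _ _ z hz hzX
    by_cases hzA : z ∈ A
    · exact absurd (hZ (Or.inl hzA)) hz
    · exact absurd (hZ (Or.inr ⟨hzA, hzX⟩)) hz
  refine (PartTree.union ?_ (hsup _ subset_rfl) tA tB).of_superset hsup
  exact Set.disjoint_left.2 fun v hv h => h.1 hv

end Tree
-- Constructing graphs with labels along a hierarchical partition.
section Built

variable {V W : Type u} {G : SimpleGraph V} {H : SimpleGraph W} {L : Type} [Finite L]

/-- The graph `H` labeled by `lab` can be constructed with the labels from `L`. -/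
def IsBuilt (H : SimpleGraph W) (lab : W → L) : Prop :=
  IsLabelConstructible (Nat.card L) H fun x => Finite.equivFin L (lab x)

/-- Labels are renamed one by one. Idempotence of `f` ensures that the order does not matter: a
label reached by a renaming is fixed by later ones. -/
theorem IsBuilt.relabel {lab lab' : W → L} (h : IsBuilt H lab) (f : L → L)
    (hf : ∀ i, f (f i) = f i) (hlab : ∀ x, lab' x = f (lab x)) : IsBuilt H lab' := by
  classical
  have := Fintype.ofFinite L
  have key : ∀ s : Finset L, IsBuilt H fun x => if lab x ∈ s then f (lab x) else lab x := by
    intro s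
    induction s using Finset.induction_on with
    | empty => simpa using h
    | insert i s his ih =>
      have := IsLabelConstructible.rename (Finite.equivFin L i) (Finite.equivFin L (f i)) ih
      unfold IsBuilt
      convert this using 2 with x
      simp only [EmbeddingLike.apply_eq_iff_eq, Finset.mem_insert]
      by_cases h1 : lab x ∈ s
      · by_cases h2 : f (lab x) = i
        · simp only [h1, h2, or_true, if_true]
          rw [← h2, hf]
        · simp [h1, h2]
      · by_cases h2 : lab x = i
        · simp [h2, his]
        · simp [h1, h2]
  have := key Finset.univ
  simp only [Finset.mem_univ, if_true] at this
  rwa [show lab' = fun x => f (lab x) from funext hlab]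

theorem IsBuilt.join {lab : W → L} (h : IsBuilt H lab) (r : L → L → Prop)
    (hr : ∀ i j, r i j → i ≠ j) : IsBuilt (H ⊔ fromRel fun x y => r (lab x) (lab y)) lab := by
  classical
  have := Fintype.ofFinite L
  have key : ∀ S : Finset (L × L), (∀ p ∈ S, p.1 ≠ p.2) →
      IsBuilt (H ⊔ fromRel fun x y => (lab x, lab y) ∈ S) lab := by
    intro S
    induction S using Finset.induction_on with
    | empty =>
      intro _
      convert h using 1
      ext x y
      simp
    | insert p S _ ih =>
      intro hS
      have := IsLabelConstructible.join (Finite.equivFin L p.1) (Finite.equivFin L p.2)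
        (by simpa using hS p (by simp)) (ih fun p hp => hS p (by simp [hp]))
      unfold IsBuilt
      convert this using 1
      ext x y
      simp only [joinLabels, sup_adj, fromRel_adj, Finset.mem_insert, EmbeddingLike.apply_eq_iff_eq,
        Prod.ext_iff]
      tauto
  have := key (Finset.univ.filter fun p => r p.1 p.2) (by simpa using hr)
  simpa using this

/-- The subgraph induced by `F`, labeled by `lab`, can be constructed. -/
def BuiltOn (G : SimpleGraph V) (F : Set V) (lab : V → L) : Prop :=
  F = ∅ ∨ IsBuilt (G.induce F) fun x => lab x

theorem BuiltOn.relabel {F : Set V} {lab lab' : V → L} (h : BuiltOn G F lab) (f : L → L)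
    (hf : ∀ i, f (f i) = f i) (hlab : ∀ x ∈ F, lab' x = f (lab x)) : BuiltOn G F lab' :=
  h.imp_right fun h => h.relabel f hf fun x => hlab x x.2

theorem BuiltOn.congr {F : Set V} {lab lab' : V → L} (h : BuiltOn G F lab)
    (hlab : ∀ x ∈ F, lab' x = lab x) : BuiltOn G F lab' :=
  h.relabel id (fun _ => rfl) hlab

theorem builtOn_singleton (v : V) (lab : V → L) : BuiltOn G {v} lab := by
  right
  refine IsLabelConstructible.iso (G := (⊥ : SimpleGraph PUnit)) (lab := fun _ =>
    Finite.equivFin L (lab v)) ⟨(Equiv.equivPUnit ({v} : Set V)).symm, ?_⟩ ?_ (.vertex _)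
  · intro a b
    have : ((Equiv.equivPUnit ({v} : Set V)).symm a) = (Equiv.equivPUnit ({v} : Set V)).symm b :=
      Subsingleton.elim _ _
    simp
  · intro x
    congr 2

/-- After the disjoint union, the pairs of labels in `r` are joined. By `hno` such a pair occurs
only across the two sides, so no edge is added inside one of them. -/
theorem BuiltOn.union {F₁ F₂ : Set V} {lab : V → L} (h₁ : BuiltOn G F₁ lab)
    (h₂ : BuiltOn G F₂ lab) (hd : Disjoint F₁ F₂) (r : L → L → Prop)
    (hr : ∀ i j, r i j → i ≠ j)
    (hcross : ∀ u ∈ F₁, ∀ w ∈ F₂, (G.Adj u w ↔ r (lab u) (lab w)))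
    (hno : ∀ i j, r i j → (∀ u ∈ F₁, lab u ≠ j) ∧ ∀ u ∈ F₂, lab u ≠ i) :
    BuiltOn G (F₁ ∪ F₂) lab := by
  classical
  rcases h₁ with rfl | h₁
  · simpa using h₂
  rcases h₂ with rfl | h₂
  · exact Or.inr (by rwa [Set.union_empty])
  right
  have hu := IsLabelConstructible.union h₁ h₂
  have hu' : IsBuilt (G.induce F₁ ⊕g G.induce F₂)
      (Sum.elim (fun x : F₁ => lab x) fun x : F₂ => lab x) := by
    unfold IsBuilt
    convert hu using 2 with x
    rcases x with x | x <;> rfl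
  refine IsLabelConstructible.iso ⟨(Equiv.Set.union hd).symm, ?_⟩ ?_ (hu'.join r hr)
  · rintro (⟨a, ha⟩ | ⟨a, ha⟩) (⟨b, hb⟩ | ⟨b, hb⟩)
    · have : ¬ r (lab a) (lab b) ∧ ¬ r (lab b) (lab a) :=
        ⟨fun h => (hno _ _ h).1 b hb rfl, fun h => (hno _ _ h).1 a ha rfl⟩
      simp [this.1, this.2]
    · have : ¬ r (lab b) (lab a) := fun h => (hno _ _ h).1 a ha rfl
      simp [hcross a ha b hb, this]
    · have : ¬ r (lab a) (lab b) := fun h => (hno _ _ h).1 b hb rfl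
      simp [adj_comm _ a b, hcross b hb a ha, this]
    · have : ¬ r (lab a) (lab b) ∧ ¬ r (lab b) (lab a) :=
        ⟨fun h => (hno _ _ h).2 a ha rfl, fun h => (hno _ _ h).2 b hb rfl⟩
      simp [this.1, this.2]
  · rintro (⟨a, ha⟩ | ⟨a, ha⟩) <;> simp

variable {C : Type}

/-- The subgraph induced by `F` can be constructed such that just the vertices in `R` get a special
label. -/
def GoodOn (C : Type) [Finite C] (G : SimpleGraph V) (F R : Set V) : Prop :=
  ∃ lab : V → Fin 3 × Option C, (∀ u ∈ R, lab u = (1, none)) ∧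
    (∀ u ∈ F, u ∉ R → lab u = (0, none)) ∧ BuiltOn G F lab

theorem goodOn_singleton [Finite C] (v : V) (R : Set V) : GoodOn C G {v} R := by
  classical
  exact ⟨fun u => if u ∈ R then (1, none) else (0, none), fun u hu => by simp [hu],
    fun u _ hu => by simp [hu], builtOn_singleton _ _⟩

theorem GoodOn.union [Finite C] {F₁ F₂ R₁ R₂ : Set V} (h₁ : GoodOn C G F₁ R₁) (h₂ : GoodOn C G F₂ R₂)
    (hR₁ : R₁ ⊆ F₁) (hR₂ : R₂ ⊆ F₂) (hd : Disjoint F₁ F₂)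
    (hno : ∀ u ∈ F₁, ∀ w ∈ F₂, ¬ G.Adj u w) : GoodOn C G (F₁ ∪ F₂) (R₁ ∪ R₂) := by
  classical
  obtain ⟨lab₁, hl₁, hn₁, hb₁⟩ := h₁
  obtain ⟨lab₂, hl₂, hn₂, hb₂⟩ := h₂
  have hd' := Set.disjoint_left.1 hd
  refine ⟨fun u => if u ∈ R₁ ∪ R₂ then (1, none) else (0, none), fun u hu => if_pos hu,
    fun u _ hu => if_neg hu, ?_⟩
  refine BuiltOn.union (hb₁.congr fun u hu => ?_) (hb₂.congr fun u hu => ?_) hd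
    (fun _ _ => False) (by simp) (by simpa using hno) (by simp)
  · by_cases h : u ∈ R₁
    · simp [h, hl₁ u h]
    · have : u ∉ R₂ := fun h' => hd' hu (hR₂ h')
      simp [h, this, hn₁ u hu h]
  · by_cases h : u ∈ R₂
    · simp [h, hl₂ u h]
    · have : u ∉ R₁ := fun h' => hd' (hR₁ h') hu
      simp [h, this, hn₂ u hu h]

/-- The special label of the second graph is moved to tag `2`, joined to that of the first, and then
retired. Only `R₁` stays available for later edges. -/
theorem GoodOn.attach [Finite C] {F₁ F₂ R₁ R₂ : Set V} (h₁ : GoodOn C G F₁ R₁) (h₂ : GoodOn C G F₂ R₂)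
    (hR₁ : R₁ ⊆ F₁) (hR₂ : R₂ ⊆ F₂) (hd : Disjoint F₁ F₂)
    (hadj : ∀ u ∈ F₁, ∀ w ∈ F₂, (G.Adj u w ↔ u ∈ R₁ ∧ w ∈ R₂)) : GoodOn C G (F₁ ∪ F₂) R₁ := by
  classical
  obtain ⟨lab₁, hl₁, hn₁, hb₁⟩ := h₁
  obtain ⟨lab₂, hl₂, hn₂, hb₂⟩ := h₂
  have hd' := Set.disjoint_left.1 hd
  set lab : V → Fin 3 × Option C := fun u =>
    if u ∈ R₁ then (1, none) else if u ∈ R₂ then (2, none) else (0, none) with hlab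
  have e₁ : ∀ u ∈ F₁, lab u = if u ∈ R₁ then (1, none) else (0, none) := by
    intro u hu
    have : u ∉ R₂ := fun h' => hd' hu (hR₂ h')
    simp [hlab, this]
  have e₂ : ∀ u ∈ F₂, lab u = if u ∈ R₂ then (2, none) else (0, none) := by
    intro u hu
    have : u ∉ R₁ := fun h' => hd' (hR₁ h') hu
    simp [hlab, this]
  have hb : BuiltOn G (F₁ ∪ F₂) lab := by
    refine BuiltOn.union (hb₁.congr fun u hu => ?_)
      (hb₂.relabel (fun i => if i = (1, none) then (2, none) else i) (fun i => ?_) fun u hu => ?_) hd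
      (fun i j => i = (1, none) ∧ j = (2, none)) ?_ (fun u hu w hw => ?_) ?_
    · rw [e₁ u hu]
      split_ifs with h
      · rw [hl₁ u h]
      · rw [hn₁ u hu h]
    · by_cases h : i = (1, none) <;> simp [h]
    · rw [e₂ u hu]
      split_ifs with h h' h'
      · rfl
      · exact absurd (hl₂ u h) h'
      · rw [hn₂ u hu h] at h'
        simp at h'
      · rw [hn₂ u hu h]
    · rintro i j ⟨rfl, rfl⟩
      simp
    · rw [hadj u hu w hw, e₁ u hu, e₂ w hw]
      by_cases h1 : u ∈ R₁ <;> by_cases h2 : w ∈ R₂ <;> simp [h1, h2]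
    · rintro i j ⟨rfl, rfl⟩
      refine ⟨fun u hu => ?_, fun u hu => ?_⟩
      · rw [e₁ u hu]
        split_ifs <;> simp
      · rw [e₂ u hu]
        split_ifs <;> simp
  refine ⟨fun u => if u ∈ R₁ then (1, none) else (0, none), fun u hu => if_pos hu,
    fun u _ hu => if_neg hu, hb.relabel (fun i => if i = (2, none) then (0, none) else i)
      (fun i => ?_) fun u _ => ?_⟩
  · by_cases h : i = (2, none) <;> simp [h]
  · simp only [hlab]
    by_cases h1 : u ∈ R₁ <;> by_cases h2 : u ∈ R₂ <;> simp [h1, h2]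

/-- The sets `F x` are disjoint, `R x` is contained in `F x`, and the edges of `G` between `F x` and
`F y` join all of `R x` to all of `R y` if `x` and `y` are adjacent in `Γ`. -/
structure Blowup {β : Type v} (Γ : SimpleGraph β) (S : Set β) (G : SimpleGraph V)
    (F R : β → Set V) : Prop where
  sub : ∀ x ∈ S, R x ⊆ F x
  disj : ∀ x ∈ S, ∀ y ∈ S, x ≠ y → Disjoint (F x) (F y)
  adj : ∀ x ∈ S, ∀ y ∈ S, x ≠ y → ∀ u ∈ F x, ∀ w ∈ F y,
    (G.Adj u w ↔ Γ.Adj x y ∧ u ∈ R x ∧ w ∈ R y)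

variable {β : Type v} {Γ : SimpleGraph β} {F R : β → Set V}

/-- The vertices in the sets `R x` with `x ∈ S` are labeled by `t` and `d x`, the other ones
by `t`. -/
def LabeledBy (F R : β → Set V) (t : Fin 3) (d : β → C) (S : Set β) (lab : V → Fin 3 × Option C) :
    Prop :=
  ∀ x ∈ S, ∀ u ∈ F x, (u ∈ R x → lab u = (t, some (d x))) ∧ (u ∉ R x → lab u = (t, none))

theorem LabeledBy.map {t t' : Fin 3} {d d' : β → C} {S : Set β} {lab : V → Fin 3 × Option C}
    (h : LabeledBy F R t d S lab) (f : Fin 3 × Option C → Fin 3 × Option C)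
    (hd : ∀ x ∈ S, f (t, some (d x)) = (t', some (d' x))) (hn : f (t, none) = (t', none)) :
    LabeledBy F R t' d' S fun u => f (lab u) := fun x hx u hu =>
  ⟨fun hR => by simp only [(h x hx u hu).1 hR, hd x hx],
    fun hR => by simp only [(h x hx u hu).2 hR, hn]⟩

theorem LabeledBy.congr {t : Fin 3} {d : β → C} {S : Set β} {lab lab' : V → Fin 3 × Option C}
    (h : LabeledBy F R t d S lab) (hl : ∀ x ∈ S, ∀ u ∈ F x, lab' u = lab u) :
    LabeledBy F R t d S lab' := fun x hx u hu => by
  rw [hl x hx u hu]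
  exact h x hx u hu

theorem LabeledBy.fst_eq {t : Fin 3} {d : β → C} {S : Set β} {lab : V → Fin 3 × Option C}
    (h : LabeledBy F R t d S lab) {u : V} (hu : u ∈ ⋃ x ∈ S, F x) : (lab u).1 = t := by
  simp only [Set.mem_iUnion] at hu
  obtain ⟨x, hx, hu⟩ := hu
  by_cases hR : u ∈ R x
  · rw [(h x hx u hu).1 hR]
  · rw [(h x hx u hu).2 hR]

/-- Old colors are sent to the new color of a chosen representative. It suffices that each vertex
shares its old color, hence its outside neighborhood, with that representative. -/
theorem exists_recolor (d c : β → C) (S : Set β) :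
    ∃ f : C → C, ∀ x ∈ S, ∃ y ∈ S, d y = d x ∧ f (d x) = c y := by
  classical
  refine ⟨fun a => if h : ∃ x ∈ S, d x = a then c h.choose else a, fun x hx => ?_⟩
  have h : ∃ y ∈ S, d y = d x := ⟨x, hx, rfl⟩
  exact ⟨h.choose, h.choose_spec.1, h.choose_spec.2, by simp only [h, dif_pos]⟩

theorem Blowup.mono {S T : Set β} (h : Blowup Γ T G F R) (hST : S ⊆ T) : Blowup Γ S G F R :=
  ⟨fun x hx => h.sub x (hST hx), fun x hx y hy => h.disj x (hST hx) y (hST hy),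
    fun x hx y hy => h.adj x (hST hx) y (hST hy)⟩

theorem Blowup.disjoint_biUnion {S T U : Set β} (h : Blowup Γ U G F R) (hS : S ⊆ U) (hT : T ⊆ U)
    (hd : Disjoint S T) : Disjoint (⋃ x ∈ S, F x) (⋃ x ∈ T, F x) := by
  simp only [Set.disjoint_iUnion_left, Set.disjoint_iUnion_right]
  exact fun x hx y hy => h.disj y (hS hy) x (hT hx) fun e => Set.disjoint_left.1 hd hy (e ▸ hx)

/-- Invariant: the color in the label of an attachment vertex determines the neighbors outside the
part of the vertex of `Γ` carrying it. At a union, the sides are tagged `1` and `2`, the required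
pairs of colors are joined, and the colors are compressed by the `Div` coloring of the union so that
they do not accumulate. -/
theorem PartTree.builtOn [Finite C] [Nonempty C] {S : Set β} (h : PartTree (Div C Γ) S)
    (hbl : Blowup Γ S G F R) (hgood : ∀ x ∈ S, GoodOn C G (F x) (R x)) :
    ∃ (d : β → C) (lab : V → Fin 3 × Option C),
      (∀ x ∈ S, ∀ y ∈ S, d x = d y → ∀ z ∉ S, (Γ.Adj x z ↔ Γ.Adj y z)) ∧
      LabeledBy F R 0 d S lab ∧ BuiltOn G (⋃ x ∈ S, F x) lab := by
  classical
  induction h with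
  | empty =>
    obtain ⟨c⟩ := ‹Nonempty C›
    exact ⟨fun _ => c, fun _ => (0, none), by simp, by simp [LabeledBy], by simp [BuiltOn]⟩
  | single v =>
    obtain ⟨c⟩ := ‹Nonempty C›
    obtain ⟨lab, hl, hn, hb⟩ := hgood v rfl
    refine ⟨fun _ => c, fun u => if lab u = (1, none) then (0, some c) else lab u, ?_, ?_, ?_⟩
    · rintro x rfl y rfl - z -
      rfl
    · rintro x rfl u hu
      refine ⟨fun hR => by simp [hl u hR], fun hR => by simp [hn u hu hR]⟩
    · simp only [Set.mem_singleton_iff, Set.iUnion_iUnion_eq_left]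
      refine hb.relabel (fun i => if i = (1, none) then (0, some c) else i) (fun i => ?_)
        fun u _ => rfl
      by_cases hi : i = (1, none) <;> simp [hi]
  | @union S T hd hdiv _ _ ihS ihT =>
    obtain ⟨dS, labS, hvS, hlS, hbS⟩ := ihS (hbl.mono Set.subset_union_left)
      fun x hx => hgood x (Or.inl hx)
    obtain ⟨dT, labT, hvT, hlT, hbT⟩ := ihT (hbl.mono Set.subset_union_right)
      fun x hx => hgood x (Or.inr hx)
    have hdF := Set.disjoint_left.1 (hbl.disjoint_biUnion Set.subset_union_left
      Set.subset_union_right hd)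
    have hnST : ∀ {x}, x ∈ T → x ∉ S := fun hT hS => Set.disjoint_left.1 hd hS hT
    obtain ⟨c, hc⟩ := hdiv
    obtain ⟨fS, hfS⟩ := exists_recolor dS c S
    obtain ⟨fT, hfT⟩ := exists_recolor dT c T
    set g : Fin 3 → Fin 3 × Option C → Fin 3 × Option C := fun t i =>
      if i.1 = 0 then (t, i.2) else i with hg
    have hgg : ∀ t i, g t (g t i) = g t i := by
      intro t i
      simp only [hg]
      split_ifs <;> simp_all
    set lab : V → Fin 3 × Option C := fun u =>
      if u ∈ ⋃ x ∈ S, F x then g 1 (labS u) else g 2 (labT u) with hlab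
    have e₁ : ∀ u ∈ ⋃ x ∈ S, F x, lab u = g 1 (labS u) := fun u hu => if_pos hu
    have e₂ : ∀ u ∈ ⋃ x ∈ T, F x, lab u = g 2 (labT u) := fun u hu => if_neg fun h => hdF h hu
    have l₁ : LabeledBy F R 1 dS S lab := (hlS.map (g 1) (fun _ _ => rfl) rfl).congr
      fun x hx u hu => e₁ u (Set.mem_biUnion hx hu)
    have l₂ : LabeledBy F R 2 dT T lab := (hlT.map (g 2) (fun _ _ => rfl) rfl).congr
      fun x hx u hu => e₂ u (Set.mem_biUnion hx hu)
    have hb : BuiltOn G ((⋃ x ∈ S, F x) ∪ ⋃ x ∈ T, F x) lab := by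
      refine BuiltOn.union (hbS.relabel (g 1) (hgg 1) e₁) (hbT.relabel (g 2) (hgg 2) e₂)
        (Set.disjoint_left.2 hdF) (fun i j => ∃ x ∈ S, ∃ y ∈ T, i = (1, some (dS x)) ∧
          j = (2, some (dT y)) ∧ Γ.Adj x y) ?_ ?_ ?_
      · rintro i j ⟨x, -, y, -, rfl, rfl, -⟩
        simp
      · intro u hu w hw
        simp only [Set.mem_iUnion] at hu hw
        obtain ⟨x, hx, hu⟩ := hu
        obtain ⟨y, hy, hw⟩ := hw
        have hxy : x ≠ y := fun e => hnST hy (e ▸ hx)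
        rw [hbl.adj x (Or.inl hx) y (Or.inr hy) hxy u hu w hw]
        by_cases hRu : u ∈ R x
        · by_cases hRw : w ∈ R y
          · rw [(l₁ x hx u hu).1 hRu, (l₂ y hy w hw).1 hRw]
            simp only [hRu, hRw, and_true, Prod.mk.injEq, Option.some.injEq, true_and]
            refine ⟨fun h => ⟨x, hx, y, hy, rfl, rfl, h⟩, ?_⟩
            rintro ⟨x', hx', y', hy', h1, h2, h3⟩
            rw [hvS x hx x' hx' h1 y (hnST hy), adj_comm,
              hvT y hy y' hy' h2 x' (fun e => hnST e hx'), adj_comm]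
            exact h3
          · rw [(l₂ y hy w hw).2 hRw]
            simp [hRw]
        · rw [(l₁ x hx u hu).2 hRu]
          simp [hRu]
      · rintro i j ⟨x, -, y, -, rfl, rfl, -⟩
        refine ⟨fun u hu e => ?_, fun u hu e => ?_⟩
        · have := l₁.fst_eq hu
          simp [e] at this
        · have := l₂.fst_eq hu
          simp [e] at this
    -- Both tags return to `0` while each side is recolored by its own map.
    set f : Fin 3 × Option C → Fin 3 × Option C := fun i =>
      (0, i.2.map (if i.1 = 1 then fS else if i.1 = 2 then fT else id)) with hf
    set d : β → C := fun x => if x ∈ S then fS (dS x) else fT (dT x) with hdd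
    have hdrep : ∀ x ∈ S ∪ T, ∃ y ∈ S ∪ T, d x = c y ∧ ∀ z ∉ S ∪ T, (Γ.Adj x z ↔ Γ.Adj y z) := by
      rintro x (hx | hx)
      · obtain ⟨y, hy, h1, h2⟩ := hfS x hx
        exact ⟨y, Or.inl hy, by simp [hdd, hx, h2],
          fun z hz => hvS x hx y hy h1.symm z fun e => hz (Or.inl e)⟩
      · obtain ⟨y, hy, h1, h2⟩ := hfT x hx
        exact ⟨y, Or.inr hy, by simp [hdd, hnST hx, h2],
          fun z hz => hvT x hx y hy h1.symm z fun e => hz (Or.inr e)⟩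
    refine ⟨d, fun u => f (lab u), fun x hx y hy hxy z hz => ?_, ?_, ?_⟩
    · obtain ⟨x', hx', h1, h2⟩ := hdrep x hx
      obtain ⟨y', hy', h3, h4⟩ := hdrep y hy
      rw [h2 z hz, h4 z hz]
      exact hc x' hx' y' hy' (by rw [← h1, ← h3, hxy]) z hz
    · rintro x (hx | hx)
      · exact l₁.map f (t' := 0) (d' := d) (fun x hx => by simp [hf, hdd, hx]) rfl x hx
      · exact l₂.map f (t' := 0) (d' := d) (fun x hx => by simp [hf, hdd, hnST hx]) rfl x hx
    · rw [Set.biUnion_union]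
      exact hb.relabel f (fun i => by simp [hf]) fun u _ => rfl

/-- As `v` lies outside `S`, the color tells whether a vertex of `Γ` is adjacent to `v`; such colors
become the special label and all others are forgotten. -/
theorem PartTree.goodOn [Finite C] [Nonempty C] {S : Set β} (h : PartTree (Div C Γ) S)
    (hbl : Blowup Γ S G F R) (hgood : ∀ x ∈ S, GoodOn C G (F x) (R x)) {v : β} (hv : v ∉ S) :
    GoodOn C G (⋃ x ∈ S, F x) (⋃ x ∈ {x | x ∈ S ∧ Γ.Adj v x}, R x) := by
  classical
  obtain ⟨d, lab, hd, hl, hb⟩ := h.builtOn hbl hgood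
  set f : Fin 3 × Option C → Fin 3 × Option C := fun i =>
    if i.1 = 0 then (if ∃ x ∈ S, i.2 = some (d x) ∧ Γ.Adj v x then (1, none) else (0, none))
    else i with hf
  refine ⟨fun u => f (lab u), fun u hu => ?_, fun u hu hnu => ?_,
    hb.relabel f (fun i => ?_) fun u _ => rfl⟩
  · simp only [Set.mem_iUnion] at hu
    obtain ⟨x, ⟨hx, hvx⟩, hu⟩ := hu
    simp only [(hl x hx u (hbl.sub x hx hu)).1 hu, hf, if_true]
    rw [if_pos ⟨x, hx, rfl, hvx⟩]
  · simp only [Set.mem_iUnion] at hu hnu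
    obtain ⟨x, hx, hu⟩ := hu
    by_cases hR : u ∈ R x
    · simp only [(hl x hx u hu).1 hR, hf, if_true]
      rw [if_neg]
      rintro ⟨y, hy, e, hvy⟩
      refine hnu ⟨x, ⟨hx, ?_⟩, hR⟩
      rw [adj_comm, hd x hx y hy (by simpa using e) v hv]
      exact hvy.symm
    · simp [(hl x hx u hu).2 hR, hf]
  · simp only [hf]
    split_ifs <;> simp_all

end Built
-- Gluing along cut vertices and the final bound.
section Core

variable {β : Type v} {Γ : SimpleGraph β}

theorem GemFree.induce (h : Γ.GemFree) (A : Set β) : (Γ.induce A).GemFree := by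
  intro b hb
  refine h (fun w => Subtype.val '' b w) ⟨fun w => ⟨(hb.conn w).1.image _, ?_⟩,
    fun w w' hw => (Set.disjoint_image_iff Subtype.val_injective).2 (hb.disj w w' hw),
    fun w w' hw => (hb.touch w w' hw).trans ⟨?_, ?_⟩⟩
  · rintro T ⟨_, ⟨a, ha, rfl⟩, haT⟩ hT
    have := (hb.conn w).2 (Subtype.val ⁻¹' T) ⟨a, ha, haT⟩
      fun c hc hcT d hd hcd => hT c ⟨c, hc, rfl⟩ hcT d ⟨d, hd, rfl⟩ hcd
    rintro _ ⟨c, hc, rfl⟩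
    exact this hc
  · rintro ⟨a, ha, c, hc, hac⟩
    exact ⟨a, ⟨a, ha, rfl⟩, c, ⟨c, hc, rfl⟩, hac⟩
  · rintro ⟨_, ⟨a, ha, rfl⟩, _, ⟨c, hc, rfl⟩, hac⟩
    exact ⟨a, ha, c, hc, hac⟩

theorem exists_separation {A : Set β} (h : ¬ (Γ.induce A).TwoConn) :
    ∃ (P Q : Set β) (x : β), P.Nonempty ∧ Q.Nonempty ∧ Disjoint P Q ∧ x ∉ P ∧ x ∉ Q ∧
      insert x (P ∪ Q) = A ∧ ∀ a ∈ P, ∀ b ∈ Q, ¬ Γ.Adj a b := by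
  simp only [TwoConn, not_forall, not_or] at h
  obtain ⟨S, x, hS, hx, hN, w, hwS, hwx⟩ := h
  have hmem : ∀ a : A, (a : β) ∈ Subtype.val '' S ↔ a ∈ S := fun a => by simp
  refine ⟨Subtype.val '' S, {a | a ∈ A ∧ a ∉ Subtype.val '' S ∧ a ≠ x}, x, hS.image _,
    ⟨w, w.2, by rwa [hmem], fun e => hwx (Subtype.ext e)⟩, ?_, by rwa [hmem], fun h => h.2.2 rfl,
    ?_, ?_⟩
  · exact Set.disjoint_left.2 fun a ha h => h.2.1 ha
  · ext a
    simp only [Set.mem_insert_iff, Set.mem_union, Set.mem_ofPred_eq]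
    constructor
    · rintro (rfl | ⟨a, -, rfl⟩ | h)
      exacts [x.2, a.2, h.1]
    · intro ha
      by_cases h1 : a ∈ Subtype.val '' S
      · exact Or.inr (Or.inl h1)
      · by_cases h2 : a = x
        · exact Or.inl h2
        · exact Or.inr (Or.inr ⟨ha, h1, h2⟩)
  · rintro _ ⟨a, ha, rfl⟩ b ⟨hb, hbS, hbx⟩ hab
    have hbS' : (⟨b, hb⟩ : A) ∉ S := fun h => hbS ⟨_, h, rfl⟩
    exact hbx (congrArg Subtype.val (hN a ha ⟨b, hb⟩ hbS' hab))

variable {V : Type u} {G : SimpleGraph V}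

theorem GemFree.goodOn_of_twoConn [Finite β] (hΓ : Γ.GemFree) (h2 : Γ.TwoConn) (v : β)
    {F R : β → Set V} (hbl : Blowup Γ {v}ᶜ G F R)
    (hgood : ∀ x ∈ ({v}ᶜ : Set β), GoodOn (Code × Bool) G (F x) (R x)) :
    GoodOn (Code × Bool) G (⋃ x ∈ ({v}ᶜ : Set β), F x)
      (⋃ x ∈ {x | x ∈ ({v}ᶜ : Set β) ∧ Γ.Adj v x}, R x) := by
  classical
  have htree : PartTree (Div (Code × Bool) Γ) (Set.univ ∩ {v}ᶜ) := by
    refine (hΓ.exists_partTree h2).inter fun Y hY => ?_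
    obtain ⟨c, hc⟩ := hY
    -- Removing `v` from a part turns it into an outside vertex; the extra bit records adjacency to
    -- it.
    refine ⟨fun u => (c u, decide (Γ.Adj u v)), fun u hu w hw e z hz => ?_⟩
    rw [Prod.mk.injEq] at e
    by_cases hzv : z = v
    · rw [hzv]
      exact decide_eq_decide.1 e.2
    · exact hc u hu.1 w hw.1 e.1 z fun h => hz ⟨h, hzv⟩
  rw [Set.univ_inter] at htree
  exact htree.goodOn hbl hgood (by simp)

/-- What hangs on `x` is moved into `F x` without enlarging `R x`: the vertices from `P` have no
edges to the other bags. -/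
theorem Blowup.merge {S P : Set β} {x : β} {F R : β → Set V} [DecidableEq β]
    (hbl : Blowup Γ (S ∪ P) G F R) (hx : x ∈ S) (hSP : Disjoint S P)
    (hno : ∀ a ∈ P, ∀ b ∈ S, b ≠ x → ¬ Γ.Adj a b) :
    Blowup Γ S G (Function.update F x (F x ∪ ⋃ y ∈ P, F y)) R := by
  have hxP : ∀ y ∈ P, ∀ z ∈ S, z ≠ y := fun y hy z hz e =>
    Set.disjoint_left.1 hSP hz (e ▸ hy)
  have hadj : ∀ y ∈ S, y ≠ x → ∀ u ∈ F x ∪ ⋃ y ∈ P, F y, ∀ w ∈ F y,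
      (G.Adj u w ↔ Γ.Adj x y ∧ u ∈ R x ∧ w ∈ R y) := by
    rintro y hy hyx u (hu | hu) w hw
    · exact hbl.adj x (Or.inl hx) y (Or.inl hy) hyx.symm u hu w hw
    · simp only [Set.mem_iUnion] at hu
      obtain ⟨z, hz, hu⟩ := hu
      have hux : u ∉ R x := fun h => Set.disjoint_left.1 (hbl.disj x (Or.inl hx) z (Or.inr hz)
        (hxP z hz x hx)) (hbl.sub x (Or.inl hx) h) hu
      rw [hbl.adj z (Or.inr hz) y (Or.inl hy) (hxP z hz y hy).symm u hu w hw]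
      simp [hux, hno z hz y hy hyx]
  have hdisj : ∀ y ∈ S, y ≠ x → Disjoint (F x ∪ ⋃ y ∈ P, F y) (F y) := by
    intro y hy hyx
    simp only [Set.disjoint_union_left, Set.disjoint_iUnion_left]
    exact ⟨hbl.disj x (Or.inl hx) y (Or.inl hy) hyx.symm,
      fun z hz => hbl.disj z (Or.inr hz) y (Or.inl hy) (hxP z hz y hy).symm⟩
  refine ⟨fun y hy => ?_, fun y hy z hz hyz => ?_, fun y hy z hz hyz u hu w hw => ?_⟩
  · rcases eq_or_ne y x with rfl | hyx
    · simpa using (hbl.sub y (Or.inl hy)).trans Set.subset_union_left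
    · simpa [hyx] using hbl.sub y (Or.inl hy)
  · rcases eq_or_ne y x with rfl | hyx
    · rw [Function.update_self, Function.update_of_ne hyz.symm]
      exact hdisj z hz hyz.symm
    · rw [Function.update_of_ne hyx]
      rcases eq_or_ne z x with rfl | hzx
      · rw [Function.update_self]
        exact (hdisj y hy hyx).symm
      · rw [Function.update_of_ne hzx]
        exact hbl.disj y (Or.inl hy) z (Or.inl hz) hyz
  · rcases eq_or_ne y x with rfl | hyx
    · rw [Function.update_self] at hu
      rw [Function.update_of_ne hyz.symm] at hw
      exact hadj z hz hyz.symm u hu w hw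
    · rw [Function.update_of_ne hyx] at hu
      rcases eq_or_ne z x with rfl | hzx
      · rw [Function.update_self] at hw
        rw [adj_comm, hadj y hy hyx w hw u hu, adj_comm]
        tauto
      · rw [Function.update_of_ne hzx] at hw
        exact hbl.adj y (Or.inl hy) z (Or.inl hz) hyz u hu w hw

/-- The blowup of a graph without a gem by constructible graphs, with one vertex removed. -/
theorem GemFree.goodOn_blowup [Finite β] (hΓ : Γ.GemFree) (n : ℕ) :
    ∀ (S : Set β) (v : β) (F R : β → Set V), S.ncard = n → v ∉ S → Blowup Γ S G F R →
      (∀ x ∈ S, GoodOn (Code × Bool) G (F x) (R x)) →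
      GoodOn (Code × Bool) G (⋃ x ∈ S, F x) (⋃ x ∈ {x | x ∈ S ∧ Γ.Adj v x}, R x) := by
  classical
  induction n using Nat.strong_induction_on with
  | _ n ih =>
  intro S v F R hn hv hbl hgood
  have hRF : ∀ (T : Set β) (x : β), T ⊆ S →
      (⋃ y ∈ {y | y ∈ T ∧ Γ.Adj x y}, R y) ⊆ ⋃ y ∈ T, F y := fun T x hT =>
    Set.iUnion₂_subset fun y hy =>
      (hbl.sub y (hT hy.1)).trans (Set.subset_biUnion_of_mem (u := fun y => F y) hy.1)
  -- `x` is a cut vertex other than the root `v`, and `P` is a side without `v`. The side is built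
  -- with root `x`, attached to `F x`, and absorbed there; the induction continues without `P`.
  have step : ∀ (P Q : Set β) (x : β), P.Nonempty → x ∉ P → x ∉ Q → v ∉ P → Disjoint P Q → x ≠ v →
      insert x (P ∪ Q) = S → (∀ a ∈ P, ∀ b ∈ Q, ¬ Γ.Adj a b) → (∀ a ∈ P, ¬ Γ.Adj v a) →
      GoodOn (Code × Bool) G (⋃ x ∈ S, F x) (⋃ x ∈ {x | x ∈ S ∧ Γ.Adj v x}, R x) := by
    intro P Q x hP hxP hxQ hvP hd hxv hS hno hvno
    have hxS : x ∈ S := hS ▸ Or.inl rfl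
    have hPS : P ⊆ S := fun a ha => hS ▸ Or.inr (Or.inl ha)
    have hQS : insert x Q ⊆ S := by
      rintro a (rfl | ha)
      exacts [hxS, hS ▸ Or.inr (Or.inr ha)]
    have hdP : Disjoint (insert x Q) P := by
      rw [Set.insert_eq, Set.disjoint_union_left]
      exact ⟨by simpa, hd.symm⟩
    have hSU : insert x Q ∪ P = S := by
      rw [← hS, Set.insert_union, Set.union_comm]
    have hg1 := ih _ (hn ▸ Set.ncard_lt_ncard ⟨hPS, fun h => hxP (h hxS)⟩) P x F R rfl hxP
      (hbl.mono hPS) fun y hy => hgood y (hPS hy)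
    have hdx : Disjoint (F x) (⋃ y ∈ P, F y) := by
      have := hbl.disjoint_biUnion (S := {x}) (T := P) (by simpa) hPS (by simpa)
      simpa using this
    have hg2 := (hgood x hxS).attach hg1 (hbl.sub x hxS) (hRF P x hPS) hdx (by
      intro u hu w hw
      simp only [Set.mem_iUnion] at hw
      obtain ⟨y, hy, hw⟩ := hw
      have hxy : x ≠ y := fun e => hxP (e ▸ hy)
      rw [hbl.adj x hxS y (hPS hy) hxy u hu w hw]
      simp only [Set.mem_iUnion, Set.mem_ofPred_eq, exists_prop]
      constructor
      · rintro ⟨h1, h2, h3⟩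
        exact ⟨h2, y, ⟨hy, h1⟩, h3⟩
      · rintro ⟨h2, z, ⟨hz, h1⟩, h3⟩
        have : z = y := by
          by_contra hzy
          exact Set.disjoint_left.1 (hbl.disj z (hPS hz) y (hPS hy) hzy)
            (hbl.sub z (hPS hz) h3) hw
        subst this
        exact ⟨h1, h2, h3⟩)
    have hlt : (insert x Q).ncard < n := by
      rw [← hn]
      refine Set.ncard_lt_ncard ⟨hQS, fun h => ?_⟩
      obtain ⟨a, ha⟩ := hP
      exact Set.disjoint_left.1 hdP (h (hPS ha)) ha
    have hfin := ih _ hlt (insert x Q) v (Function.update F x (F x ∪ ⋃ y ∈ P, F y)) R rfl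
      (fun h => hv (hQS h)) ((hSU.symm ▸ hbl : Blowup Γ (insert x Q ∪ P) G F R).merge (Or.inl rfl)
        hdP (by
          rintro a ha b (rfl | hb) hbx
          exacts [absurd rfl hbx, hno a ha b hb])) (by
        intro y hy
        rcases eq_or_ne y x with rfl | hyx
        · rwa [Function.update_self]
        · rw [Function.update_of_ne hyx]
          exact hgood y (hQS hy))
    have e1 : (⋃ y ∈ insert x Q, Function.update F x (F x ∪ ⋃ y ∈ P, F y) y) = ⋃ y ∈ S, F y := by
      have : ∀ y ∈ Q, Function.update F x (F x ∪ ⋃ y ∈ P, F y) y = F y := by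
        intro y hy
        rw [Function.update_of_ne]
        rintro rfl
        exact hxQ hy
      rw [Set.biUnion_insert, Function.update_self, Set.iUnion₂_congr this, ← hS,
        Set.biUnion_insert, Set.biUnion_union, Set.union_assoc]
    have e2 : {y | y ∈ insert x Q ∧ Γ.Adj v y} = {y | y ∈ S ∧ Γ.Adj v y} := by
      ext y
      constructor
      · exact fun h => ⟨hQS h.1, h.2⟩
      · rintro ⟨hy, hvy⟩
        rw [← hSU] at hy
        exact ⟨hy.resolve_right fun h => hvno y h hvy, hvy⟩
    rwa [e1, e2] at hfin
  by_cases h2 : (Γ.induce (insert v S)).TwoConn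
  · set v' : (insert v S : Set β) := ⟨v, Or.inl rfl⟩ with hv'
    have hmem : ∀ x : (insert v S : Set β), x ∈ ({v'}ᶜ : Set _) ↔ (x : β) ∈ S := by
      rintro ⟨x, rfl | hx⟩
      · simpa [hv'] using hv
      · simp only [Set.mem_compl_iff, Set.mem_singleton_iff, hv', hx, iff_true]
        intro e
        exact hv ((show x = v from congrArg Subtype.val e) ▸ hx)
    have := (hΓ.induce (insert v S)).goodOn_of_twoConn h2 v' (G := G) (F := fun x => F x)
      (R := fun x => R x) ⟨fun x hx => hbl.sub x ((hmem x).1 hx),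
        fun x hx y hy hxy => hbl.disj x ((hmem x).1 hx) y ((hmem y).1 hy)
          fun e => hxy (Subtype.ext e),
        fun x hx y hy hxy => hbl.adj x ((hmem x).1 hx) y ((hmem y).1 hy)
          fun e => hxy (Subtype.ext e)⟩ fun x hx => hgood x ((hmem x).1 hx)
    convert this using 1
    · ext u
      simp only [Set.mem_iUnion, exists_prop, hmem, Subtype.exists, Set.mem_insert_iff]
      constructor
      · rintro ⟨x, hx, hu⟩
        exact ⟨x, Or.inr hx, hx, hu⟩
      · rintro ⟨x, -, hx, hu⟩
        exact ⟨x, hx, hu⟩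
    · ext u
      simp only [Set.mem_iUnion, exists_prop, hmem, Subtype.exists, Set.mem_insert_iff,
        Set.mem_ofPred_eq, comap_adj, Function.Embedding.subtype_apply]
      constructor
      · rintro ⟨x, hx, hu⟩
        exact ⟨x, Or.inr hx.1, hx, hu⟩
      · rintro ⟨x, -, hx, hu⟩
        exact ⟨x, hx, hu⟩
  · obtain ⟨P, Q, x, hP, hQ, hd, hxP, hxQ, hA, hno⟩ := exists_separation h2
    have hin : ∀ y, y ∈ insert x (P ∪ Q) ↔ y = v ∨ y ∈ S := fun y => by rw [hA]; rfl
    have hd' := Set.disjoint_left.1 hd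
    -- If the root itself is the cut vertex, the two sides are built independently and put together
    -- by a disjoint union.
    by_cases hxv : x = v
    · subst hxv
      have hS : P ∪ Q = S := by
        ext y
        by_cases hy : y = x
        · subst hy
          exact iff_of_false (fun h => h.elim hxP hxQ) hv
        · simpa [hy] using hin y
      have hPS : P ⊆ S := hS ▸ Set.subset_union_left
      have hQS : Q ⊆ S := hS ▸ Set.subset_union_right
      have hlP : P.ncard < n := hn ▸ Set.ncard_lt_ncard ⟨hPS, fun h => by
        obtain ⟨a, ha⟩ := hQ
        exact hd' (h (hQS ha)) ha⟩
      have hlQ : Q.ncard < n := hn ▸ Set.ncard_lt_ncard ⟨hQS, fun h => by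
        obtain ⟨a, ha⟩ := hP
        exact hd' ha (h (hPS ha))⟩
      have g1 := ih _ hlP P x F R rfl hxP (hbl.mono hPS) fun y hy => hgood y (hPS hy)
      have g2 := ih _ hlQ Q x F R rfl hxQ (hbl.mono hQS) fun y hy => hgood y (hQS hy)
      have := g1.union g2 (hRF P x hPS) (hRF Q x hQS) (hbl.disjoint_biUnion hPS hQS hd) (by
        intro u hu w hw
        simp only [Set.mem_iUnion] at hu hw
        obtain ⟨y, hy, hu⟩ := hu
        obtain ⟨z, hz, hw⟩ := hw
        rw [hbl.adj y (hPS hy) z (hQS hz) (fun e => hd' hy (e ▸ hz)) u hu w hw]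
        simp [hno y hy z hz])
      rw [← Set.biUnion_union, ← Set.biUnion_union, hS] at this
      have e : {y | y ∈ S ∧ Γ.Adj x y} = {y | y ∈ P ∧ Γ.Adj x y} ∪ {y | y ∈ Q ∧ Γ.Adj x y} := by
        rw [← hS]
        ext y
        simp only [Set.mem_ofPred_eq, Set.mem_union]
        tauto
      rwa [e]
    · have hvPQ : v ∈ P ∨ v ∈ Q := by
        have := (hin v).2 (Or.inl rfl)
        exact this.resolve_left fun e => hxv e.symm
      have key : ∀ P Q : Set β, P.Nonempty → Disjoint P Q → x ∉ P → x ∉ Q → v ∈ Q →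
          (∀ y, y ∈ insert x (P ∪ Q) ↔ y = v ∨ y ∈ S) → (∀ a ∈ P, ∀ b ∈ Q, ¬ Γ.Adj a b) →
          GoodOn (Code × Bool) G (⋃ x ∈ S, F x) (⋃ x ∈ {x | x ∈ S ∧ Γ.Adj v x}, R x) := by
        intro P Q hP hd hxP hxQ hvQ hin hno
        have hvP : v ∉ P := fun h => Set.disjoint_left.1 hd h hvQ
        refine step P (Q \ {v}) x hP hxP (fun h => hxQ h.1) hvP (hd.mono_right Set.sdiff_subset)
          hxv ?_ (fun a ha b hb => hno a ha b hb.1) fun a ha e => hno a ha v hvQ e.symm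
        ext y
        by_cases hy : y = v
        · subst hy
          refine iff_of_false ?_ hv
          rintro (h | h | h)
          exacts [hxv h.symm, hvP h, h.2 rfl]
        · simpa [hy] using hin y
      rcases hvPQ with hvP | hvQ
      · exact key Q P hQ hd.symm hxQ hxP hvP (by simpa only [Set.union_comm Q P] using hin)
          fun a ha b hb e => hno b hb a ha e.symm
      · exact key P Q hP hd hxP hxQ hvQ hin hno

/-- The number of labels that suffices for graphs without a gem. -/
noncomputable def labelBound : ℕ := Nat.card (Fin 3 × Option (Code × Bool))

theorem GemFree.constructibleWithLabels [Finite V] (hG : G.GemFree) :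
    G.ConstructibleWithLabels labelBound := by
  rcases isEmpty_or_nonempty V with hV | ⟨⟨v⟩⟩
  · exact Or.inl hV
  right
  -- The graph is the trivial blowup of itself by single vertices; the root `v` is left out and
  -- attached at the end.
  have hbl : Blowup G ({v}ᶜ : Set V) G (fun x => {x}) fun x => {x} :=
    ⟨fun _ _ => subset_rfl, fun x _ y _ hxy => by simpa using hxy, by
      rintro x _ y _ _ u rfl w rfl
      simp⟩
  have h1 := hG.goodOn_blowup (G := G) _ ({v}ᶜ : Set V) v _ _ rfl (by simp) hbl
    fun x _ => goodOn_singleton x _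
  have h2 := (goodOn_singleton (C := Code × Bool) (G := G) v {v}).attach h1 subset_rfl
    (Set.iUnion₂_subset fun x hx => Set.subset_biUnion_of_mem (u := fun x => {x}) hx.1) (by simp)
    (by
      rintro u rfl w hw
      have : w ≠ u := by simpa using hw
      simp [this])
  have e : ({v} ∪ ⋃ x ∈ ({v}ᶜ : Set V), {x} : Set V) = Set.univ := by
    rw [Set.biUnion_of_singleton, Set.union_compl_self]
  rw [e] at h2
  obtain ⟨lab, -, -, h3⟩ := h2
  rcases h3 with h3 | h3
  · exact absurd h3 (Set.nonempty_of_mem (Set.mem_univ v)).ne_empty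
  · exact ⟨_, IsLabelConstructible.iso (lab' := fun x => Finite.equivFin _ (lab x))
      (induceUnivIso G) (fun _ => rfl) h3⟩

end Core
end SimpleGraph

theorem mainTheorem7 {W : Type v} (H : SimpleGraph W)
    (hH : SimpleGraph.IsIndContained H SimpleGraph.gem) :
    ∃ c : ℕ, ∀ (V : Type u) [Finite V] (G : SimpleGraph V),
      SimpleGraph.InducedMinorFree H G → G.cliqueWidth ≤ (c : ℕ∞) :=
  ⟨SimpleGraph.labelBound, fun _ _ _ hG => iInf₂_le _ (hG.gemFree hH).constructibleWithLabels⟩
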